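/- Let $s = s_1, \ldots, s_n$ be a sequence of elements of a totally ordered set, with $\sigma \geq 2$ distinct elements, in which the $i$th smallest distinct element occurs $n_i$ times, and let $H = \sum_{i=1}^{\sigma} \frac{n_i}{n} \log_2 \frac{n}{n_i}$ be its entropy. Let $\pi$ be the permutation of $\{1, \ldots, n\}$ such that $s_{\pi(1)}, \ldots, s_{\pi(n)}$ is the stable sort of $s$, i.e., $s_{\pi(i)} \leq s_{\pi(i+1)}$ and, if $s_{\pi(i)} = s_{\pi(i+1)}$, then $\pi(i) < \pi(i+1)$. Consider a random-access machine with words of $w = \Theta(\log n)$ bits that reads the elements of $s$, in order and once only, from a one-way input tape, and writes to a write-only output tape. It does not know $n$ in advance. It can store elements, each of which occupies a constant number $\kappa$ of words; it can compare two stored elements in unit time; and it performs the standard operations on words in unit time. Memory is counted in bits, the tapes not included. Then $\pi(1), \ldots, \pi(n)$ can be computed in one pass using $O((H+1)n)$ time and $O(Hn)$ bits of memory. More precisely, there are a fixed program and a constant $c_0$ such that, for all constants $C$ and $\kappa$, there is a constant $K$ such that the following holds for every totally ordered set, every $n$, every such sequence $s$ with $\sigma \geq 2$, and every word length $w$ with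 $\log_2 n + c_0 \leq w \leq C \log_2 n$: the program, started on $s$, halts with output $\pi(1), \ldots, \pi(n)$ after at most $K (H+1) n$ units of time, and uses at most $K H n$ bits of memory. -/

import Mathlib

namespace StreamRAM

/-- Binary operations of the machine on words. -/
inductive BinOp
  | add | sub | mul | div | mod | and | or | xor | shl | shr | eq | lt

/-- Value of an operation on words, which are numbers below `2 ^ w`.  The machine keeps only the
low-order `w` bits of the result, so arithmetic is modulo `2 ^ w`; division by `0` yields `0`;
comparisons yield `1` (true) or `0` (false). -/
def BinOp.eval (w : ℕ) : BinOp → ℕ → ℕ → ℕ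
  | .add, a, b => a + b
  | .sub, a, b => a + (2 ^ w - b)
  | .mul, a, b => a * b
  | .div, a, b => a / b
  | .mod, a, b => a % b
  | .and, a, b => a &&& b
  | .or, a, b => a ||| b
  | .xor, a, b => a ^^^ b
  | .shl, a, b => a <<< b
  | .shr, a, b => a >>> b
  | .eq, a, b => if a = b then 1 else 0
  | .lt, a, b => if a < b then 1 else 0

/-- Unit-time instructions.  The arguments `i j k` are addresses of words fixed in the program;
there are no registers outside the memory.  Write `m` for the word memory and `e` for the element
memory. -/
inductive Instr
  /-- `m[i] := c` -/
  | const (i c : ℕ)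
  /-- `m[i] := m[j] o m[k]` -/
  | op (o : BinOp) (i j k : ℕ)
  /-- `m[i] := m[m[j]]` -/
  | load (i j : ℕ)
  /-- `m[m[i]] := m[j]` -/
  | store (i j : ℕ)
  /-- `e[m[i]] := e[m[j]]` -/
  | emove (i j : ℕ)
  /-- `m[i] := 1` if `e[m[j]] ≤ e[m[k]]`, and `m[i] := 0` otherwise -/
  | ele (i j k : ℕ)
  /-- If the input tape is at its end, `m[j] := 0`.  Otherwise the next element of the tape is put
  into `e[m[i]]`, the head moves forward by one element, and `m[j] := 1`. -/
  | read (i j : ℕ)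
  /-- Append `m[i]` to the write-only output tape. -/
  | write (i : ℕ)

/-- Programs. -/
inductive Prog
  | skip
  | instr (a : Instr)
  | seq (p q : Prog)
  /-- if `m[i] ≠ 0` then `p` else `q` -/
  | ite (i : ℕ) (p q : Prog)
  /-- while `m[i] ≠ 0` do `p` -/
  | loop (i : ℕ) (p : Prog)

/-- The size of a machine: the number of bits of a word, the number of words of the word memory,
and the number of cells of the element memory. -/
structure Machine where
  wordBits : ℕ
  words : ℕ
  elems : ℕ

/-- The number of bits of memory of a machine, if an element occupies `κ` words. -/
def Machine.memoryBits (M : Machine) (κ : ℕ) : ℕ :=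
  (M.words + κ * M.elems) * M.wordBits

/-- A configuration.  `input` is the part of the input tape that has not been read yet.  Element
cells into which nothing has been put are `none`. -/
structure State (α : Type*) where
  mem : ℕ → ℕ
  emem : ℕ → Option α
  input : List α
  output : List ℕ

/-- The initial configuration: all words are `0`, and no elements are stored. -/
def State.init {α : Type*} (input : List α) : State α where
  mem := fun _ => 0
  emem := fun _ => none
  input := input
  output := []

section Semantics

variable {α : Type*}

/-! An access outside the memory, or to an element cell that is empty, fails (`none`). -/

def getW (M : Machine) (S : State α) (i : ℕ) : Option ℕ :=
  if i < M.words then some (S.mem i) else none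

def setW (M : Machine) (S : State α) (i v : ℕ) : Option (State α) :=
  if i < M.words then
    some { S with mem := Function.update S.mem i (v % 2 ^ M.wordBits) }
  else none

def getE (M : Machine) (S : State α) (i : ℕ) : Option α :=
  if i < M.elems then S.emem i else none

def setE (M : Machine) (S : State α) (i : ℕ) (x : α) : Option (State α) :=
  if i < M.elems then some { S with emem := Function.update S.emem i (some x) } else none

/-- The effect of one instruction (`none` if it fails). -/
def Instr.step [LinearOrder α] (M : Machine) (S : State α) : Instr → Option (State α)
  | .const i c => setW M S i c
  | .op o i j k =>
      (getW M S j).bind fun a => (getW M S k).bind fun b =>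
        setW M S i (o.eval M.wordBits a b)
  | .load i j =>
      (getW M S j).bind fun a => (getW M S a).bind fun v => setW M S i v
  | .store i j =>
      (getW M S i).bind fun a => (getW M S j).bind fun v => setW M S a v
  | .emove i j =>
      (getW M S i).bind fun a => (getW M S j).bind fun b =>
        (getE M S b).bind fun x => setE M S a x
  | .ele i j k =>
      (getW M S j).bind fun a => (getW M S k).bind fun b =>
        (getE M S a).bind fun x => (getE M S b).bind fun y =>
          setW M S i (if x ≤ y then 1 else 0)
  | .read i j =>
      match S.input with
      | [] => setW M S j 0
      | x :: rest =>
          (getW M S i).bind fun a =>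
            (setE M { S with input := rest } a x).bind fun S' => setW M S' j 1
  | .write i =>
      (getW M S i).bind fun v => some { S with output := S.output ++ [v] }

/-- `Exec M p S S' t`: on the machine `M`, the program `p` started in `S` halts in `S'` after `t`
units of time, and no access fails.  Every instruction and every evaluation of a test takes one
unit of time. -/
inductive Exec [LinearOrder α] (M : Machine) : Prog → State α → State α → ℕ → Prop
  | skip (S : State α) : Exec M .skip S S 1
  | instr {a : Instr} {S S' : State α} (h : a.step M S = some S') : Exec M (.instr a) S S' 1
  | seq {p q : Prog} {S S' S'' : State α} {t t' : ℕ}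
      (hp : Exec M p S S' t) (hq : Exec M q S' S'' t') : Exec M (.seq p q) S S'' (t + t')
  | iteTrue {i v : ℕ} {p q : Prog} {S S' : State α} {t : ℕ}
      (hi : getW M S i = some v) (hv : v ≠ 0) (hp : Exec M p S S' t) :
      Exec M (.ite i p q) S S' (1 + t)
  | iteFalse {i : ℕ} {p q : Prog} {S S' : State α} {t : ℕ}
      (hi : getW M S i = some 0) (hq : Exec M q S S' t) : Exec M (.ite i p q) S S' (1 + t)
  | loopTrue {i v : ℕ} {p : Prog} {S S' S'' : State α} {t t' : ℕ}
      (hi : getW M S i = some v) (hv : v ≠ 0) (hp : Exec M p S S' t)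
      (hl : Exec M (.loop i p) S' S'' t') : Exec M (.loop i p) S S'' (1 + t + t')
  | loopFalse {i : ℕ} {p : Prog} {S : State α}
      (hi : getW M S i = some 0) : Exec M (.loop i p) S S 1

/-- Started on the input tape `input`, the program `p` halts on the machine `M` after `t` units of
time with `output` on its output tape. -/
def Computes [LinearOrder α] (M : Machine) (p : Prog) (input : List α) (output : List ℕ)
    (t : ℕ) : Prop :=
  ∃ S : State α, Exec M p (State.init input) S t ∧ S.output = output

end Semantics

end StreamRAM

/-- The number of distinct elements of a sequence. -/
def numDistinct {α : Type*} [LinearOrder α] {n : ℕ} (s : Fin n → α) : ℕ :=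
  (Finset.univ.image s).card

/-- The number of occurrences of `a` in a sequence. -/
def occ {α : Type*} [LinearOrder α] {n : ℕ} (s : Fin n → α) (a : α) : ℕ :=
  (Finset.univ.filter fun i => s i = a).card

/-- The (binary) entropy `∑ₐ (nₐ / n) log₂ (n / nₐ)` of the distribution of elements in a sequence,
where `a` ranges over the distinct elements and `nₐ` is the number of occurrences of `a`. -/
noncomputable def seqEntropy {α : Type*} [LinearOrder α] {n : ℕ} (s : Fin n → α) : ℝ :=
  ∑ a ∈ Finset.univ.image s, ((occ s a : ℝ) / n) * Real.logb 2 ((n : ℝ) / occ s a)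

/-- `s ∘ π` is the stable sort of `s`. -/
def IsStableSort {α : Type*} [LinearOrder α] {n : ℕ} (s : Fin n → α)
    (π : Equiv.Perm (Fin n)) : Prop :=
  ∀ i j : Fin n, (j : ℕ) = i + 1 →
    s (π i) ≤ s (π j) ∧ (s (π i) = s (π j) → π i < π j)

/-! The program keeps a sorted linked list of the distinct elements met so far. Each of them has a
queue of bits that encodes the increasing list of its positions. The input is read in batches of `d
+ 1` elements, where `d` is the current number of distinct elements. A batch is sorted by bottom-up
merge sort in which equal elements are chained together as soon as they meet, so that a merge costs
only the number of distinct keys of the two lists. The sorted batch is then merged into the main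
list. In the end the queues are decoded in the order of the list. Chains and queues grow only at
their ends, by later positions, so the sort is stable.

Time. A potential argument (`pot_add_le`, `sortCost_singles_le`) bounds the cost of sorting a batch
of length `m` by `m` times its entropy plus `O(m)`. By the log sum inequality (`ent_add_le`), length
times entropy is superadditive under concatenation (`entList_append_le`), so all batches together
cost `O((H + 1) n)`. A walk along the main list costs `O(d)`, which the `d + 1` elements of a full
batch pay for. Writing and reading the queues takes time proportional to their lengths and to `n`.

Space. Positions are encoded as the lengths of runs of consecutive positions and the gaps between
them, in a prefix code with `2 log x + O(1)` bits. An element that occurs `c ≤ n / 2` times has at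
most `c` pairs of numbers with total at most `n`, so concavity of the logarithm gives `O(c log (n /
c))` bits. An element that fills more than half of the sequence has at most `q = n - c` gaps, which
gives `O(q log (n / q))` bits; this is at most what the other elements contribute to `H n`. Hence
the queues have `O(H n)` bits (`sum_qbits_le`). Nodes, batch buffer and partly filled words take
`O(σ)` words, that is `O(σ log n)` bits, and `σ log n ≤ 4 H n`, since every element but the most
frequent one occurs at most `n / 2` times.

The program is written in a small structured language with variables, arrays and a clock, and is
verified by weakest preconditions; `Stmt.exec` transfers the result to the machine at a constant
cost per tick. The program knows neither `n` nor `w`: the end of a word is detected by overflow when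
the weight of a bit is doubled. The size of the machine is computed from the final contents of the
queues (`room`), and `cells_le_room` shows that no intermediate state needs more. -/

namespace StreamRAM

/-! ### The structured language and its weakest preconditions -/

/-- Expressions over variables, constants and arrays. -/
inductive Expr
  | c (k : ℕ)
  | v (r : ℕ)
  | a (f : ℕ) (i : Expr)
  | op (o : BinOp) (x y : Expr)

/-- Statements of a structured language with variables, arrays and element cells. -/
inductive Stmt
  | skip
  /-- variable `r` becomes `e` -/
  | asg (r : ℕ) (e : Expr)
  /-- entry `i` of array `f` becomes `e` -/
  | ast (f : ℕ) (i e : Expr)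
  /-- variable `r` tells whether element `i` is at most element `j` -/
  | ele (r : ℕ) (i j : Expr)
  /-- element `j` is copied to cell `i` -/
  | emv (i j : Expr)
  /-- the next element is read into cell `i`; variable `r` tells whether there was one -/
  | rd (i : Expr) (r : ℕ)
  | wr (e : Expr)
  | seq (p q : Stmt)
  | ite (e : Expr) (p q : Stmt)
  | whl (e : Expr) (p : Stmt)

/-- A block of statements. -/
def blk : List Stmt → Stmt
  | [] => .skip
  | [p] => p
  | p :: q :: l => .seq p (blk (q :: l))

/-- Abstract states; `tm` counts executed statements and tests. -/
@[ext] structure HS (α : Type*) where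
  v : ℕ → ℕ
  a : ℕ → ℕ → ℕ
  e : ℕ → Option α
  inp : List α
  out : List ℕ
  tm : ℕ

namespace HS
variable {α : Type*}

def tick (H : HS α) : HS α := { H with tm := H.tm + 1 }

def setV (H : HS α) (r x : ℕ) : HS α :=
  { H with v := Function.update H.v r x, tm := H.tm + 1 }

def setA (H : HS α) (f i x : ℕ) : HS α :=
  { H with a := Function.update H.a f (Function.update (H.a f) i x), tm := H.tm + 1 }

def setE (H : HS α) (i : ℕ) (x : α) : HS α :=
  { H with e := Function.update H.e i (some x), tm := H.tm + 1 }

def setI (H : HS α) (l : List α) : HS α := { H with inp := l }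

def app (H : HS α) (x : ℕ) : HS α := { H with out := H.out ++ [x], tm := H.tm + 1 }

variable (H : HS α) (r x f i : ℕ) (y : α) (l : List α)

@[simp] theorem tick_v : H.tick.v = H.v := rfl
@[simp] theorem tick_a : H.tick.a = H.a := rfl
@[simp] theorem tick_e : H.tick.e = H.e := rfl
@[simp] theorem tick_inp : H.tick.inp = H.inp := rfl
@[simp] theorem tick_out : H.tick.out = H.out := rfl
@[simp] theorem tick_tm : H.tick.tm = H.tm + 1 := rfl
@[simp] theorem setV_v (r' : ℕ) : (H.setV r x).v r' = if r' = r then x else H.v r' := by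
  simp [setV, Function.update_apply]
@[simp] theorem setV_a : (H.setV r x).a = H.a := rfl
@[simp] theorem setV_e : (H.setV r x).e = H.e := rfl
@[simp] theorem setV_inp : (H.setV r x).inp = H.inp := rfl
@[simp] theorem setV_out : (H.setV r x).out = H.out := rfl
@[simp] theorem setV_tm : (H.setV r x).tm = H.tm + 1 := rfl
@[simp] theorem setA_v : (H.setA f i x).v = H.v := rfl
@[simp] theorem setA_a (f' : ℕ) :
    (H.setA f i x).a f' = if f' = f then Function.update (H.a f) i x else H.a f' := by
  simp [setA, Function.update_apply]
@[simp] theorem setA_e : (H.setA f i x).e = H.e := rfl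
@[simp] theorem setA_inp : (H.setA f i x).inp = H.inp := rfl
@[simp] theorem setA_out : (H.setA f i x).out = H.out := rfl
@[simp] theorem setA_tm : (H.setA f i x).tm = H.tm + 1 := rfl
@[simp] theorem setE_v : (H.setE i y).v = H.v := rfl
@[simp] theorem setE_a : (H.setE i y).a = H.a := rfl
@[simp] theorem setE_e : (H.setE i y).e = Function.update H.e i (some y) := rfl
@[simp] theorem setE_inp : (H.setE i y).inp = H.inp := rfl
@[simp] theorem setE_out : (H.setE i y).out = H.out := rfl
@[simp] theorem setE_tm : (H.setE i y).tm = H.tm + 1 := rfl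
@[simp] theorem setI_v : (H.setI l).v = H.v := rfl
@[simp] theorem setI_a : (H.setI l).a = H.a := rfl
@[simp] theorem setI_e : (H.setI l).e = H.e := rfl
@[simp] theorem setI_inp : (H.setI l).inp = l := rfl
@[simp] theorem setI_out : (H.setI l).out = H.out := rfl
@[simp] theorem setI_tm : (H.setI l).tm = H.tm := rfl
@[simp] theorem app_v : (H.app x).v = H.v := rfl
@[simp] theorem app_a : (H.app x).a = H.a := rfl
@[simp] theorem app_e : (H.app x).e = H.e := rfl
@[simp] theorem app_inp : (H.app x).inp = H.inp := rfl
@[simp] theorem app_out : (H.app x).out = H.out ++ [x] := rfl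
@[simp] theorem app_tm : (H.app x).tm = H.tm + 1 := rfl

end HS

/-- The value of an expression when no sum or difference leaves the range of words. -/
def Expr.val {α : Type*} (w : ℕ) (H : HS α) : Expr → ℕ
  | .c k => k
  | .v r => H.v r
  | .a f i => H.a f (i.val w H)
  | .op .sub x y => x.val w H - y.val w H
  -- Only products may overflow: doubling the weight of the highest bit of a word must give `0`,
  -- which is how the program notices that a word is full.
  | .op .mul x y => x.val w H * y.val w H % 2 ^ w
  | .op o x y => o.eval w (x.val w H) (y.val w H)

/-- Array indices are below `X`, and sums and differences stay in the range of words. -/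
def Expr.ok {α : Type*} (w X : ℕ) (H : HS α) : Expr → Prop
  | .c k => k < 2 ^ w
  | .v _ => True
  | .a _ i => i.ok w X H ∧ i.val w H < X
  | .op .add x y => x.ok w X H ∧ y.ok w X H ∧ x.val w H + y.val w H < 2 ^ w
  | .op .sub x y => x.ok w X H ∧ y.ok w X H ∧ y.val w H ≤ x.val w H
  | .op .shl _ _ => False
  | .op _ x y => x.ok w X H ∧ y.ok w X H

/-- Weakest preconditions (total correctness). -/
def Stmt.wp {α : Type*} [LinearOrder α] (w X : ℕ) : Stmt → (HS α → Prop) → HS α → Prop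
  | .skip, Q, H => Q H.tick
  | .asg r e, Q, H => e.ok w X H ∧ Q (H.setV r (e.val w H))
  | .ast f i e, Q, H => i.ok w X H ∧ e.ok w X H ∧ i.val w H < X ∧
      Q (H.setA f (i.val w H) (e.val w H))
  | .ele r i j, Q, H => i.ok w X H ∧ j.ok w X H ∧ i.val w H < 2 * X ∧ j.val w H < 2 * X ∧
      ∃ x y, H.e (i.val w H) = some x ∧ H.e (j.val w H) = some y ∧
        Q (H.setV r (if x ≤ y then 1 else 0))
  | .emv i j, Q, H => i.ok w X H ∧ j.ok w X H ∧ i.val w H < 2 * X ∧ j.val w H < 2 * X ∧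
      ∃ x, H.e (j.val w H) = some x ∧ Q (H.setE (i.val w H) x)
  | .rd i r, Q, H => i.ok w X H ∧ i.val w H < 2 * X ∧
      (H.inp = [] → Q (H.setV r 0)) ∧
      (∀ x l, H.inp = x :: l → Q (((H.setI l).setE (i.val w H) x).setV r 1))
  | .wr e, Q, H => e.ok w X H ∧ Q (H.app (e.val w H))
  | .seq p q, Q, H => p.wp w X (q.wp w X Q) H
  | .ite e p q, Q, H => e.ok w X H ∧ (e.val w H ≠ 0 → p.wp w X Q H.tick) ∧
      (e.val w H = 0 → q.wp w X Q H.tick)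
  -- The least fixed point, as the intersection of all predicates closed under one round of the
  -- loop; being least, it includes termination.
  | .whl e p, Q, H => ∀ I : HS α → Prop, (∀ H, e.ok w X H → (e.val w H ≠ 0 → p.wp w X I H.tick) →
      (e.val w H = 0 → Q H.tick) → I H) → I H

theorem Stmt.wp_mono {α : Type*} [LinearOrder α] {w X : ℕ} (p : Stmt) {Q Q' : HS α → Prop}
    {H : HS α} (h : p.wp w X Q H) (hQ : ∀ H, Q H → Q' H) : p.wp w X Q' H := by
  induction p generalizing Q Q' H with
  | skip => exact hQ _ h
  | asg r e => exact ⟨h.1, hQ _ h.2⟩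
  | ast f i e => exact ⟨h.1, h.2.1, h.2.2.1, hQ _ h.2.2.2⟩
  | ele r i j =>
    obtain ⟨h1, h2, h3, h4, x, y, h5, h6, h7⟩ := h
    exact ⟨h1, h2, h3, h4, x, y, h5, h6, hQ _ h7⟩
  | emv i j =>
    obtain ⟨h1, h2, h3, h4, x, h5, h6⟩ := h
    exact ⟨h1, h2, h3, h4, x, h5, hQ _ h6⟩
  | rd i r => exact ⟨h.1, h.2.1, fun h' => hQ _ (h.2.2.1 h'), fun x l h' => hQ _ (h.2.2.2 x l h')⟩
  | wr e => exact ⟨h.1, hQ _ h.2⟩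
  | seq p q ihp ihq => exact ihp h fun H h' => ihq h' hQ
  | ite e p q ihp ihq =>
    exact ⟨h.1, fun h' => ihp (h.2.1 h') hQ, fun h' => ihq (h.2.2 h') hQ⟩
  | whl e p ih => exact fun I hI => h I fun H h1 h2 h3 => hI H h1 h2 fun h4 => hQ _ (h3 h4)

theorem Stmt.wp_seq {α : Type*} [LinearOrder α] {w X : ℕ} {p q : Stmt} {Q : HS α → Prop} :
    (Stmt.seq p q).wp w X Q = p.wp w X (q.wp w X Q) := rfl

/-- Unfolding the fixed point once. All loops below are treated by this rule together with an
induction on a measure, so no invariant is ever supplied to the definition itself. -/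
theorem Stmt.wp_whl {α : Type*} [LinearOrder α] {w X : ℕ} {e : Expr} {p : Stmt}
    {Q : HS α → Prop} {H : HS α} (h1 : e.ok w X H)
    (h2 : e.val w H ≠ 0 → p.wp w X ((Stmt.whl e p).wp w X Q) H.tick)
    (h3 : e.val w H = 0 → Q H.tick) : (Stmt.whl e p).wp w X Q H := fun I hI =>
  hI H h1 (fun h => p.wp_mono (h2 h) fun _ h' => h' I hI) h3

/-! ### Compilation -/

/-- Code that puts the value of an expression into word `k`, using the words from `k` on. -/
def Expr.comp : Expr → ℕ → Prog
  | .c x, k => .instr (.const k x)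
  -- A disjunction of a word with itself serves as the copy instruction.
  | .v r, k => .instr (.op .or k r r)
  -- Arrays are interleaved with stride 16 from word 64 on. Addresses then do not depend on the size
  -- of the arrays, which a fixed program cannot know.
  | .a f i, k => .seq (i.comp k) (.seq (.instr (.const (k + 1) 16))
      (.seq (.instr (.op .mul k k (k + 1))) (.seq (.instr (.const (k + 1) (64 + f)))
        (.seq (.instr (.op .add k k (k + 1))) (.instr (.load k k))))))
  | .op o x y, k => .seq (x.comp k) (.seq (y.comp (k + 1)) (.instr (.op o k k (k + 1))))

/-- Bounds the scratch words that are used from `k` on and, up to the factor 5, the time. The limit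
30 in `Expr.small` keeps an evaluation that starts at word 32 or 33 below word 64, where the arrays
begin. -/
def Expr.depth : Expr → ℕ
  | .c _ => 1
  | .v _ => 1
  | .a _ i => i.depth + 2
  | .op _ x y => x.depth + y.depth + 1

/-- Variables are among the first 32 words, there are at most 16 arrays, expressions are small. -/
def Expr.wf : Expr → Bool
  | .c _ => true
  | .v r => r < 32
  | .a f i => f < 16 && i.wf
  | .op _ x y => x.wf && y.wf

def Expr.small (e : Expr) : Bool := e.wf && e.depth ≤ 30

def Stmt.comp : Stmt → Prog
  | .skip => .skip
  | .asg r e => .seq (e.comp 32) (.instr (.op .or r 32 32))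
  | .ast f i e => .seq (e.comp 32) (.seq (i.comp 33) (.seq (.instr (.const 34 16))
      (.seq (.instr (.op .mul 33 33 34)) (.seq (.instr (.const 34 (64 + f)))
        (.seq (.instr (.op .add 33 33 34)) (.instr (.store 33 32)))))))
  | .ele r i j => .seq (i.comp 32) (.seq (j.comp 33) (.instr (.ele r 32 33)))
  | .emv i j => .seq (i.comp 32) (.seq (j.comp 33) (.instr (.emove 32 33)))
  | .rd i r => .seq (i.comp 32) (.instr (.read 32 r))
  | .wr e => .seq (e.comp 32) (.instr (.write 32))
  | .seq p q => .seq p.comp q.comp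
  | .ite e p q => .seq (e.comp 32) (.ite 32 p.comp q.comp)
  -- The machine tests a word, not an expression, so the test is evaluated before the loop and again
  -- at the end of each round.
  | .whl e p => .seq (e.comp 32) (.loop 32 (.seq p.comp (e.comp 32)))

def Stmt.wf : Stmt → Bool
  | .skip => true
  | .asg r e => r < 32 && e.small
  | .ast f i e => f < 16 && i.small && e.small
  | .ele r i j => r < 32 && i.small && j.small
  | .emv i j => i.small && j.small
  | .rd i r => r < 32 && i.small
  | .wr e => e.small
  | .seq p q => p.wf && q.wf
  | .ite e p q => e.small && p.wf && q.wf
  | .whl e p => e.small && p.wf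

/-- The state of the machine represents the abstract state. -/
structure Sim {α : Type*} (w X : ℕ) (S : State α) (H : HS α) : Prop where
  var : ∀ r < 32, S.mem r = H.v r
  arr : ∀ f < 16, ∀ i < X, S.mem (16 * i + (64 + f)) = H.a f i
  vlt : ∀ r < 32, H.v r < 2 ^ w
  alt : ∀ f < 16, ∀ i < X, H.a f i < 2 ^ w
  emem : S.emem = H.e
  inp : S.input = H.inp
  out : S.output = H.out

/-- The machine with room for array entries below `X`. -/
def mach (w X : ℕ) : Machine := ⟨w, 64 + 16 * X, 2 * X⟩

section
variable {α : Type*} {w X : ℕ}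

def setm (w : ℕ) (S : State α) (k x : ℕ) : State α :=
  { S with mem := Function.update S.mem k (x % 2 ^ w) }

@[simp] theorem setm_mem (S : State α) (k x r : ℕ) :
    (setm w S k x).mem r = if r = k then x % 2 ^ w else S.mem r := by
  simp [setm, Function.update_apply]

theorem Sim.setm {S : State α} {H : HS α} (h : Sim w X S H) {k : ℕ} (hk : 32 ≤ k) (hk' : k < 64)
    (x : ℕ) : Sim w X (setm w S k x) H where
  var r hr := by rw [setm_mem, if_neg (by omega), h.var r hr]
  arr f hf i hi := by rw [setm_mem, if_neg (by omega), h.arr f hf i hi]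
  vlt := h.vlt
  alt := h.alt
  emem := h.emem
  inp := h.inp
  out := h.out

theorem Sim.tick {S : State α} {H : HS α} (h : Sim w X S H) : Sim w X S H.tick :=
  ⟨h.var, h.arr, h.vlt, h.alt, h.emem, h.inp, h.out⟩

theorem setW_mach (S : State α) {k : ℕ} (hk : k < 64 + 16 * X) (x : ℕ) :
    setW (mach w X) S k x = some (setm w S k x) := by
  simp [setW, mach, setm, hk]

theorem getW_mach (S : State α) {k : ℕ} (hk : k < 64 + 16 * X) :
    getW (mach w X) S k = some (S.mem k) := by
  simp [getW, mach, hk]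

theorem getE_mach (S : State α) {k : ℕ} (hk : k < 2 * X) :
    getE (mach w X) S k = S.emem k := by
  simp [getE, mach, hk]

theorem setE_mach (S : State α) {k : ℕ} (hk : k < 2 * X) (x : α) :
    setE (mach w X) S k x = some { S with emem := Function.update S.emem k (some x) } := by
  simp [setE, mach, hk]

variable [LinearOrder α]

theorem exec_const (S : State α) {k : ℕ} (hk : k < 64) (x : ℕ) :
    Exec (mach w X) (.instr (.const k x)) S (setm w S k x) 1 :=
  .instr (setW_mach S (by omega) x)

theorem exec_op (S : State α) (o : BinOp) {i j k : ℕ} (hi : i < 64) (hj : j < 64) (hk : k < 64) :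
    Exec (mach w X) (.instr (.op o i j k)) S (setm w S i (o.eval w (S.mem j) (S.mem k))) 1 :=
  .instr (by
    simp only [Instr.step]
    rw [getW_mach S (by omega), getW_mach S (by omega)]
    exact setW_mach S (by omega) _)

theorem exec_load (S : State α) {i j : ℕ} (hi : i < 64) (hj : j < 64)
    (ha : S.mem j < 64 + 16 * X) :
    Exec (mach w X) (.instr (.load i j)) S (setm w S i (S.mem (S.mem j))) 1 :=
  .instr (by
    simp only [Instr.step]
    rw [getW_mach S (by omega), Option.bind_some, getW_mach S ha]
    exact setW_mach S (by omega) _)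

theorem exec_store (S : State α) {i j : ℕ} (hi : i < 64) (hj : j < 64)
    (ha : S.mem i < 64 + 16 * X) :
    Exec (mach w X) (.instr (.store i j)) S (setm w S (S.mem i) (S.mem j)) 1 :=
  .instr (by
    simp only [Instr.step]
    rw [getW_mach S (by omega), Option.bind_some, getW_mach S (by omega)]
    exact setW_mach S ha _)

omit [LinearOrder α] in
theorem Expr.val_lt (h0 : 0 < w) {S : State α} {H : HS α} (h : Sim w X S H) (e : Expr)
    (hw : e.wf = true) (ho : e.ok w X H) : e.val w H < 2 ^ w := by
  induction e with
  | c k => exact ho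
  | v r => exact h.vlt r (by simpa [Expr.wf] using hw)
  | a f i ih =>
    simp only [Expr.wf, Bool.and_eq_true, decide_eq_true_eq] at hw
    exact h.alt f hw.1 _ ho.2
  | op o x y ihx ihy =>
    simp only [Expr.wf, Bool.and_eq_true] at hw
    have h1 : 0 < 2 ^ w := by positivity
    have h2 : ∀ p : Prop, [Decidable p] → (if p then 1 else 0) < 2 ^ w := by
      intro p _
      have := Nat.one_lt_two_pow h0.ne'
      split_ifs <;> omega
    cases o with
    | add => exact ho.2.2
    | sub => exact lt_of_le_of_lt (Nat.sub_le _ _) (ihx hw.1 ho.1)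
    | mul => exact Nat.mod_lt _ h1
    | div => exact lt_of_le_of_lt (Nat.div_le_self _ _) (ihx hw.1 ho.1)
    | mod => exact lt_of_le_of_lt (Nat.mod_le _ _) (ihx hw.1 ho.1)
    | and => exact lt_of_le_of_lt Nat.and_le_left (ihx hw.1 ho.1)
    | or => exact Nat.or_lt_two_pow (ihx hw.1 ho.1) (ihy hw.2 ho.2)
    | xor => exact Nat.xor_lt_two_pow (ihx hw.1 ho.1) (ihy hw.2 ho.2)
    | shl => exact ho.elim
    | shr =>
      refine lt_of_le_of_lt ?_ (ihx hw.1 ho.1)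
      change x.val w H >>> y.val w H ≤ x.val w H
      rw [Nat.shiftRight_eq_div_pow]
      exact Nat.div_le_self _ _
    | eq => exact h2 _
    | lt => exact h2 _

omit [LinearOrder α] in
-- The machine subtracts by adding `2 ^ w - y`; the surplus `2 ^ w` vanishes in the reduction, and
-- `ok` excludes every other wrap-around except that of products, which `val` itself reduces.
theorem Expr.eval_op (h0 : 0 < w) {S : State α} {H : HS α} (h : Sim w X S H) (o : BinOp)
    (x y : Expr) (hw : (Expr.op o x y).wf = true) (ho : (Expr.op o x y).ok w X H) :
    o.eval w (x.val w H) (y.val w H) % 2 ^ w = (Expr.op o x y).val w H := by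
  have hlt := Expr.val_lt h0 h _ hw ho
  simp only [Expr.wf, Bool.and_eq_true] at hw
  cases o with
  | sub =>
    have hx := x.val_lt h0 h hw.1 ho.1
    have hy := ho.2.2
    simp only [BinOp.eval, Expr.val]
    rw [show x.val w H + (2 ^ w - y.val w H) = (x.val w H - y.val w H) + 2 ^ w by omega,
      Nat.add_mod_right, Nat.mod_eq_of_lt (by omega)]
  | mul => rfl
  | _ => exact Nat.mod_eq_of_lt hlt

omit [LinearOrder α] in
theorem Expr.ok_args {H : HS α} {o : BinOp} {x y : Expr} (ho : (Expr.op o x y).ok w X H) :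
    x.ok w X H ∧ y.ok w X H := by
  cases o
  case shl => exact ho.elim
  case add => exact ⟨ho.1, ho.2.1⟩
  case sub => exact ⟨ho.1, ho.2.1⟩
  all_goals exact ho

/-- The right operand of an operation is evaluated from word `k + 1` on while the left value waits
in word `k`; the last conjunct, that words from 32 up to `k` survive, carries the induction. -/
theorem Expr.exec (h0 : 0 < w) (hX : 64 + 16 * X ≤ 2 ^ w) (e : Expr) :
    ∀ (k : ℕ) (S : State α) (H : HS α), Sim w X S H → e.wf = true → e.ok w X H → 32 ≤ k →
      k + e.depth ≤ 64 → ∃ S' t, Exec (mach w X) (e.comp k) S S' t ∧ Sim w X S' H ∧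
        t ≤ 5 * e.depth ∧ S'.mem k = e.val w H ∧ ∀ r, 32 ≤ r → r < k → S'.mem r = S.mem r := by
  induction e with
  | c x =>
    intro k S H h _ ho hk hk'
    simp only [Expr.depth] at hk' ⊢
    refine ⟨_, _, exec_const S (by omega) x, h.setm hk (by omega) x, by omega, ?_, ?_⟩
    · simp only [setm_mem, if_true]; exact Nat.mod_eq_of_lt ho
    · intro r _ hr; rw [setm_mem, if_neg (by omega)]
  | v r =>
    intro k S H h hw _ hk hk'
    simp only [Expr.depth, Expr.wf, decide_eq_true_eq] at hk' hw ⊢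
    refine ⟨_, _, exec_op S .or (by omega) (by omega) (by omega), h.setm hk (by omega) _,
      by omega, ?_, ?_⟩
    · simp only [setm_mem, if_true, BinOp.eval, Nat.or_self, Expr.val]
      rw [h.var r hw, Nat.mod_eq_of_lt (h.vlt r hw)]
    · intro r' _ hr; rw [setm_mem, if_neg (by omega)]
  | a f i ih =>
    intro k S H h hw ho hk hk'
    simp only [Expr.depth, Expr.wf, Bool.and_eq_true, decide_eq_true_eq] at hk' hw ⊢
    obtain ⟨S1, t1, e1, s1, ht1, v1, p1⟩ := ih k S H h hw.2 ho.1 hk (by omega)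
    have hi := ho.2
    have h16 : 16 < 2 ^ w := by omega
    have h64 : 64 + f < 2 ^ w := by omega
    refine ⟨_, _, .seq e1 (.seq (exec_const _ (by omega) _) (.seq
      (exec_op _ .mul (by omega) (by omega) (by omega)) (.seq (exec_const _ (by omega) _)
      (.seq (exec_op _ .add (by omega) (by omega) (by omega))
        (exec_load _ (by omega) (by omega) ?_))))), ?_, by omega, ?_, ?_⟩
    · simp [setm_mem, BinOp.eval, v1, Nat.mod_eq_of_lt h16]
      rw [Nat.mod_eq_of_lt (a := i.val w H * 16 + (64 + f)) (by omega)]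
      omega
    · refine Sim.setm (Sim.setm (Sim.setm (Sim.setm (Sim.setm s1 ?_ ?_ _) ?_ ?_ _) ?_ ?_ _) ?_ ?_ _)
        ?_ ?_ _ <;> omega
    · simp only [setm_mem, if_true, BinOp.eval, v1, Nat.mod_eq_of_lt h16, Nat.mod_eq_of_lt h64,
        show k ≠ k + 1 by omega, if_false,
        Nat.mod_eq_of_lt (show i.val w H * 16 < 2 ^ w by omega),
        Nat.mod_eq_of_lt (show i.val w H * 16 + (64 + f) < 2 ^ w by omega)]
      rw [if_neg (by omega), if_neg (by omega), if_neg (by omega), if_neg (by omega), mul_comm,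
        s1.arr f hw.1 _ hi]
      exact Nat.mod_eq_of_lt (h.alt f hw.1 _ hi)
    · intro r hr hr'
      simp only [setm_mem]
      rw [if_neg (by omega), if_neg (by omega), if_neg (by omega), if_neg (by omega),
        if_neg (by omega), p1 r hr hr']
  | op o x y ihx ihy =>
    intro k S H h hw ho hk hk'
    have ev := Expr.eval_op h0 h o x y hw ho
    have hxy := Expr.ok_args ho
    simp only [Expr.depth, Expr.wf, Bool.and_eq_true] at hk' hw ⊢
    obtain ⟨S1, t1, e1, s1, ht1, v1, p1⟩ := ihx k S H h hw.1 hxy.1 hk (by omega)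
    have hd : 1 ≤ x.depth := by cases x <;> simp [Expr.depth]
    obtain ⟨S2, t2, e2, s2, ht2, v2, p2⟩ := ihy (k + 1) S1 H s1 hw.2 hxy.2 (by omega) (by omega)
    refine ⟨_, _, .seq e1 (.seq e2 (exec_op _ o (by omega) (by omega) (by omega))),
      s2.setm hk (by omega) _, by omega, ?_, ?_⟩
    · simp only [setm_mem, if_true]
      rw [p2 k hk (by omega), v1, v2, ev]
    · intro r hr hr'
      rw [setm_mem, if_neg (by omega), p2 r hr (by omega), p1 r hr hr']

omit [LinearOrder α] in
theorem Sim.setV {S : State α} {H : HS α} (h : Sim w X S H) {r x : ℕ} (hr : r < 32)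
    (hx : x < 2 ^ w) : Sim w X (StreamRAM.setm w S r x) (H.setV r x) where
  var r' hr' := by rw [setm_mem, HS.setV_v, h.var r' hr', Nat.mod_eq_of_lt hx]
  arr f hf i hi := by rw [setm_mem, if_neg (by omega), h.arr f hf i hi]; rfl
  vlt r' hr' := by
    rw [HS.setV_v]; split_ifs
    · exact hx
    · exact h.vlt r' hr'
  alt := h.alt
  emem := h.emem
  inp := h.inp
  out := h.out

omit [LinearOrder α] in
theorem Sim.setA {S : State α} {H : HS α} (h : Sim w X S H) {f i x : ℕ} (hf : f < 16)
    (hx : x < 2 ^ w) :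
    Sim w X (StreamRAM.setm w S (16 * i + (64 + f)) x) (H.setA f i x) where
  var r' hr' := by rw [setm_mem, if_neg (by omega), h.var r' hr']; rfl
  arr f' hf' i' hi' := by
    rw [setm_mem, HS.setA_a, Nat.mod_eq_of_lt hx]
    by_cases h1 : f' = f
    · subst h1
      rw [if_pos rfl, Function.update_apply]
      by_cases h2 : i' = i
      · rw [if_pos (by omega), if_pos h2]
      · rw [if_neg (by omega), if_neg h2, h.arr f' hf' i' hi']
    · rw [if_neg (by omega), if_neg h1, h.arr f' hf' i' hi']
  vlt := h.vlt
  alt f' hf' i' hi' := by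
    rw [HS.setA_a]
    by_cases h1 : f' = f
    · subst h1
      rw [if_pos rfl, Function.update_apply]
      split_ifs
      · exact hx
      · exact h.alt f' hf' i' hi'
    · rw [if_neg h1]; exact h.alt f' hf' i' hi'
  emem := h.emem
  inp := h.inp
  out := h.out

omit [LinearOrder α] in
theorem Sim.setE {S : State α} {H : HS α} (h : Sim w X S H) (i : ℕ) (x : α) :
    Sim w X { S with emem := Function.update S.emem i (some x) } (H.setE i x) :=
  ⟨h.var, h.arr, h.vlt, h.alt, by simp [h.emem], h.inp, h.out⟩

/-- An upper bound on the number of units of time of a statement or test. -/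
def unitCost : ℕ := 400

/-- One tick of the abstract clock pays for at most two evaluations of expressions, of 150 units
each, and a few instructions, hence 400. The bound is stated as a difference of clocks so that it
adds up along sequences and loops. -/
theorem Stmt.exec (h0 : 0 < w) (hX : 64 + 16 * X ≤ 2 ^ w) (p : Stmt) (hp : p.wf = true) :
    ∀ (Q : HS α → Prop) (S : State α) (H : HS α), Sim w X S H → p.wp w X Q H →
      ∃ S' H' t, Exec (mach w X) p.comp S S' t ∧ Sim w X S' H' ∧ Q H' ∧
        t + unitCost * H.tm ≤ unitCost * H'.tm := by
  have h01 : ∀ p : Prop, [Decidable p] → (if p then 1 else 0) < 2 ^ w := by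
    intro p _
    have := Nat.one_lt_two_pow h0.ne'
    split_ifs <;> omega
  have one : ∀ (e : Expr) (k : ℕ) (S : State α) (H : HS α), Sim w X S H → e.small = true →
      e.ok w X H → 32 ≤ k → k ≤ 33 → ∃ S' t, Exec (mach w X) (e.comp k) S S' t ∧ Sim w X S' H ∧
        t ≤ 150 ∧ S'.mem k = e.val w H ∧ ∀ r, 32 ≤ r → r < k → S'.mem r = S.mem r := by
    intro e k S H h hs ho hk hk'
    simp only [Expr.small, Bool.and_eq_true, decide_eq_true_eq] at hs
    obtain ⟨S', t, h1, h2, h3, h4⟩ := e.exec h0 hX k S H h hs.1 ho hk (by omega)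
    exact ⟨S', t, h1, h2, by omega, h4⟩
  have wfe : ∀ e : Expr, e.small = true → e.wf = true := by
    intro e h
    simp only [Expr.small, Bool.and_eq_true] at h
    exact h.1
  unfold unitCost
  induction p with
  | skip =>
    intro Q S H h hw
    exact ⟨S, _, _, .skip S, h.tick, hw, by simp only [HS.tick_tm]; omega⟩
  | asg r e =>
    intro Q S H h hw
    simp only [Stmt.wf, Bool.and_eq_true, decide_eq_true_eq] at hp
    obtain ⟨S1, t1, e1, s1, ht1, v1, -⟩ := one e 32 S H h hp.2 hw.1 (by omega) (by omega)
    have hv := e.val_lt h0 h (wfe e hp.2) hw.1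
    refine ⟨_, _, _, .seq e1 (exec_op _ .or (by omega) (by omega) (by omega)), ?_, hw.2, ?_⟩
    · simp only [BinOp.eval, Nat.or_self, v1]
      exact s1.setV hp.1 hv
    · simp only [HS.setV_tm]; omega
  | ast f i e =>
    intro Q S H h hw
    simp only [Stmt.wf, Bool.and_eq_true, decide_eq_true_eq] at hp
    obtain ⟨ho1, ho2, hi, hw⟩ := hw
    obtain ⟨S1, t1, e1, s1, ht1, v1, -⟩ := one e 32 S H h hp.2 ho2 (by omega) (by omega)
    obtain ⟨S2, t2, e2, s2, ht2, v2, p2⟩ := one i 33 S1 H s1 hp.1.2 ho1 (by omega) (by omega)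
    have hv := e.val_lt h0 h (wfe e hp.2) ho2
    have h16 : 16 < 2 ^ w := by omega
    have h64 : 64 + f < 2 ^ w := by omega
    have ha : ∀ S' : State α, (setm w (setm w (setm w (setm w S2 34 16) 33
        (BinOp.eval w .mul ((setm w S2 34 16).mem 33) ((setm w S2 34 16).mem 34))) 34 (64 + f)) 33
        (BinOp.eval w .add ((setm w (setm w (setm w S2 34 16) 33
        (BinOp.eval w .mul ((setm w S2 34 16).mem 33) ((setm w S2 34 16).mem 34))) 34 (64 + f)).mem
        33) ((setm w (setm w (setm w S2 34 16) 33
        (BinOp.eval w .mul ((setm w S2 34 16).mem 33) ((setm w S2 34 16).mem 34))) 34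
          (64 + f)).mem 34))).mem 33 = 16 * i.val w H + (64 + f) := by
      intro _
      simp [setm_mem, BinOp.eval, v2, Nat.mod_eq_of_lt h16]
      rw [Nat.mod_eq_of_lt (by omega)]
      omega
    refine ⟨_, _, _, .seq e1 (.seq e2 (.seq (exec_const _ (by omega) _) (.seq
      (exec_op _ .mul (by omega) (by omega) (by omega)) (.seq (exec_const _ (by omega) _)
      (.seq (exec_op _ .add (by omega) (by omega) (by omega))
        (exec_store _ (by omega) (by omega) ?_)))))), ?_, hw, ?_⟩
    · rw [ha S]; omega
    · rw [ha S]
      simp only [setm_mem, Nat.reduceEqDiff, if_false]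
      rw [p2 32 (by omega) (by omega), v1]
      refine Sim.setA ?_ hp.1.1 hv
      refine Sim.setm (Sim.setm (Sim.setm (Sim.setm s2 ?_ ?_ _) ?_ ?_ _) ?_ ?_ _) ?_ ?_ _ <;> omega
    · simp only [HS.setA_tm]; omega
  | ele r i j =>
    intro Q S H h hw
    simp only [Stmt.wf, Bool.and_eq_true, decide_eq_true_eq] at hp
    obtain ⟨ho1, ho2, hi, hj, x, y, hx, hy, hw⟩ := hw
    obtain ⟨S1, t1, e1, s1, ht1, v1, -⟩ := one i 32 S H h hp.1.2 ho1 (by omega) (by omega)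
    obtain ⟨S2, t2, e2, s2, ht2, v2, p2⟩ := one j 33 S1 H s1 hp.2 ho2 (by omega) (by omega)
    refine ⟨setm w S2 r (if x ≤ y then 1 else 0), _, _, .seq e1 (.seq e2 (.instr ?_)),
      s2.setV hp.1.1 (h01 _), hw, ?_⟩
    · simp only [Instr.step]
      rw [getW_mach _ (by omega), getW_mach _ (by omega), Option.bind_some, Option.bind_some,
        p2 32 (by omega) (by omega), v1, v2, getE_mach _ hi, getE_mach _ hj, s2.emem, hx, hy]
      exact setW_mach _ (by omega) _
    · simp only [HS.setV_tm]; omega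
  | emv i j =>
    intro Q S H h hw
    simp only [Stmt.wf, Bool.and_eq_true] at hp
    obtain ⟨ho1, ho2, hi, hj, x, hx, hw⟩ := hw
    obtain ⟨S1, t1, e1, s1, ht1, v1, -⟩ := one i 32 S H h hp.1 ho1 (by omega) (by omega)
    obtain ⟨S2, t2, e2, s2, ht2, v2, p2⟩ := one j 33 S1 H s1 hp.2 ho2 (by omega) (by omega)
    refine ⟨_, _, _, .seq e1 (.seq e2 (.instr ?_)), s2.setE _ x, hw, ?_⟩
    · simp only [Instr.step]
      rw [getW_mach _ (by omega), getW_mach _ (by omega), Option.bind_some, Option.bind_some,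
        p2 32 (by omega) (by omega), v1, v2, getE_mach _ hj, s2.emem, hx, Option.bind_some,
        setE_mach _ hi, s2.emem]
    · simp only [HS.setE_tm]; omega
  | rd i r =>
    intro Q S H h hw
    simp only [Stmt.wf, Bool.and_eq_true, decide_eq_true_eq] at hp
    obtain ⟨ho1, hi, hw1, hw2⟩ := hw
    obtain ⟨S1, t1, e1, s1, ht1, v1, -⟩ := one i 32 S H h hp.2 ho1 (by omega) (by omega)
    rcases hl : H.inp with _ | ⟨x, l⟩
    · refine ⟨setm w S1 r 0, _, _, .seq e1 (.instr ?_), s1.setV hp.1 (by positivity), hw1 hl, ?_⟩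
      · simp only [Instr.step, s1.inp, hl]
        exact setW_mach _ (by omega) _
      · simp only [HS.setV_tm]; omega
    · have s2 : Sim w X { S1 with input := l } (H.setI l) :=
        ⟨s1.var, s1.arr, s1.vlt, s1.alt, s1.emem, rfl, s1.out⟩
      have s3 := (s2.setE (i.val w H) x).setV hp.1 (x := 1) (by simpa using h01 True)
      refine ⟨_, _, _, .seq e1 (.instr ?_), s3, hw2 x l hl, ?_⟩
      · simp only [Instr.step, s1.inp, hl]
        rw [getW_mach _ (by omega), Option.bind_some, v1, setE_mach _ hi, Option.bind_some]
        exact setW_mach _ (by omega) _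
      · simp only [HS.setV_tm, HS.setE_tm, HS.setI_tm]; omega
  | wr e =>
    intro Q S H h hw
    simp only [Stmt.wf] at hp
    obtain ⟨S1, t1, e1, s1, ht1, v1, -⟩ := one e 32 S H h hp hw.1 (by omega) (by omega)
    refine ⟨{ S1 with output := S1.output ++ [e.val w H] }, _, _, .seq e1 (.instr ?_), ?_,
      hw.2, ?_⟩
    · simp only [Instr.step]
      rw [getW_mach _ (by omega), Option.bind_some, v1]
    · exact ⟨s1.var, s1.arr, s1.vlt, s1.alt, s1.emem, s1.inp, by simp [s1.out]⟩
    · simp only [HS.app_tm]; omega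
  | seq p q ihp ihq =>
    intro Q S H h hw
    simp only [Stmt.wf, Bool.and_eq_true] at hp
    obtain ⟨S1, H1, t1, e1, s1, w1, ht1⟩ := ihp hp.1 _ S H h hw
    obtain ⟨S2, H2, t2, e2, s2, w2, ht2⟩ := ihq hp.2 _ S1 H1 s1 w1
    exact ⟨S2, H2, _, .seq e1 e2, s2, w2, by omega⟩
  | ite e p q ihp ihq =>
    intro Q S H h hw
    simp only [Stmt.wf, Bool.and_eq_true] at hp
    obtain ⟨S1, t1, e1, s1, ht1, v1, -⟩ := one e 32 S H h hp.1.1 hw.1 (by omega) (by omega)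
    have hg := getW_mach (w := w) (X := X) S1 (k := 32) (by omega)
    rw [v1] at hg
    by_cases hv : e.val w H = 0
    · obtain ⟨S2, H2, t2, e2, s2, w2, ht2⟩ := ihq hp.2 _ S1 _ s1.tick (hw.2.2 hv)
      simp only [HS.tick_tm] at ht2
      exact ⟨S2, H2, _, .seq e1 (.iteFalse (by rw [hg, hv]) e2), s2, w2, by omega⟩
    · obtain ⟨S2, H2, t2, e2, s2, w2, ht2⟩ := ihp hp.1.2 _ S1 _ s1.tick (hw.2.1 hv)
      simp only [HS.tick_tm] at ht2
      exact ⟨S2, H2, _, .seq e1 (.iteTrue hg hv e2), s2, w2, by omega⟩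
  | whl e p ih =>
    intro Q S H h hw
    simp only [Stmt.wf, Bool.and_eq_true] at hp
    -- The predicate put into the fixed point: the compiled loop halts whenever word 32 holds the
    -- value of the test. The 150 units prepay the first evaluation of the test, and `e.ok` stands
    -- apart because that evaluation needs it.
    have key := hw (fun H => ∀ S, Sim w X S H → e.ok w X H ∧ (S.mem 32 = e.val w H →
      ∃ S' H' t, Exec (mach w X) (.loop 32 (.seq p.comp (e.comp 32))) S S' t ∧ Sim w X S' H' ∧
        Q H' ∧ t + 150 + 400 * H.tm ≤ 400 * H'.tm)) ?_
    · obtain ⟨ho, -⟩ := key S h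
      obtain ⟨S1, t1, e1, s1, ht1, v1, -⟩ := one e 32 S H h hp.1 ho (by omega) (by omega)
      obtain ⟨S2, H2, t2, e2, s2, w2, ht2⟩ := (key S1 s1).2 v1
      exact ⟨S2, H2, _, .seq e1 e2, s2, w2, by omega⟩
    · intro H ho hw1 hw2 S h
      refine ⟨ho, fun hv => ?_⟩
      have hg := getW_mach (w := w) (X := X) S (k := 32) (by omega)
      rw [hv] at hg
      by_cases hz : e.val w H = 0
      · exact ⟨S, _, _, .loopFalse (by rw [hg, hz]), h.tick, hw2 hz, by
          simp only [HS.tick_tm]; omega⟩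
      · obtain ⟨S1, H1, t1, e1, s1, w1, ht1⟩ := ih hp.2 _ S _ h.tick (hw1 hz)
        obtain ⟨ho', -⟩ := w1 S1 s1
        obtain ⟨S2, t2, e2, s2, ht2, v2, -⟩ := one e 32 S1 H1 s1 hp.1 ho' (by omega) (by omega)
        obtain ⟨S3, H3, t3, e3, s3, w3, ht3⟩ := (w1 S2 s2).2 v2
        simp only [HS.tick_tm] at ht1
        exact ⟨S3, H3, _, .loopTrue hg hz (.seq e1 e2) e3, s3, w3, by omega⟩

end
end StreamRAM

namespace StreamRAM

/-! ### The program -/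

notation "xBase" => (0 : ℕ)
notation "xD" => (1 : ℕ)
notation "xNc" => (2 : ℕ)
notation "xM" => (3 : ℕ)
notation "xMore" => (4 : ℕ)
notation "xCont" => (5 : ℕ)
notation "xCnt" => (6 : ℕ)
notation "xJ" => (7 : ℕ)
notation "xB" => (8 : ℕ)
notation "xPrev" => (9 : ℕ)
notation "xC" => (10 : ℕ)
notation "xF" => (11 : ℕ)
notation "xG" => (12 : ℕ)
notation "xT" => (13 : ℕ)
notation "xX" => (14 : ℕ)
notation "xP" => (15 : ℕ)
notation "xY" => (16 : ℕ)
notation "xZ" => (17 : ℕ)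
notation "xCell" => (18 : ℕ)
notation "xR" => (19 : ℕ)
notation "xCur" => (20 : ℕ)
notation "xK" => (21 : ℕ)
notation "xU" => (22 : ℕ)

notation "aNxt" => (0 : ℕ)
notation "aDn" => (1 : ℕ)
notation "aCt" => (2 : ℕ)
notation "aSlot" => (3 : ℕ)
notation "aMn" => (4 : ℕ)
notation "aQhead" => (5 : ℕ)
notation "aQtail" => (6 : ℕ)
notation "aQw" => (7 : ℕ)
notation "aLen" => (8 : ℕ)
notation "aPos" => (9 : ℕ)
notation "aNp" => (10 : ℕ)
notation "aData" => (11 : ℕ)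
notation "aLink" => (12 : ℕ)

namespace Expr
abbrev add (x y : Expr) : Expr := .op .add x y
abbrev sub (x y : Expr) : Expr := .op .sub x y
abbrev mul (x y : Expr) : Expr := .op .mul x y
abbrev div (x y : Expr) : Expr := .op .div x y
abbrev mod (x y : Expr) : Expr := .op .mod x y
abbrev or (x y : Expr) : Expr := .op .or x y
abbrev lt (x y : Expr) : Expr := .op .lt x y
abbrev eq (x y : Expr) : Expr := .op .eq x y

variable {α : Type*} (w X : ℕ) (H : HS α) (x y : Expr)

@[simp] theorem val_c (k : ℕ) : (c k).val w H = k := rfl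
@[simp] theorem val_v (r : ℕ) : (v r).val w H = H.v r := rfl
@[simp] theorem val_a (f : ℕ) : (a f x).val w H = H.a f (x.val w H) := rfl
@[simp] theorem val_add : (op .add x y).val w H = x.val w H + y.val w H := rfl
@[simp] theorem val_sub : (op .sub x y).val w H = x.val w H - y.val w H := rfl
@[simp] theorem val_mul : (op .mul x y).val w H = x.val w H * y.val w H % 2 ^ w := rfl
@[simp] theorem val_div : (op .div x y).val w H = x.val w H / y.val w H := rfl
@[simp] theorem val_mod : (op .mod x y).val w H = x.val w H % y.val w H := rfl
@[simp] theorem val_or : (op .or x y).val w H = x.val w H ||| y.val w H := rfl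
@[simp] theorem val_lt' :
    (op .lt x y).val w H = if x.val w H < y.val w H then 1 else 0 := rfl
@[simp] theorem val_eq :
    (op .eq x y).val w H = if x.val w H = y.val w H then 1 else 0 := rfl
@[simp] theorem ok_c (k : ℕ) : (c k).ok w X H ↔ k < 2 ^ w := Iff.rfl
@[simp] theorem ok_v (r : ℕ) : (v r).ok w X H := trivial
@[simp] theorem ok_a (f : ℕ) : (a f x).ok w X H ↔ x.ok w X H ∧ x.val w H < X := Iff.rfl
@[simp] theorem ok_add : (op .add x y).ok w X H ↔
    x.ok w X H ∧ y.ok w X H ∧ x.val w H + y.val w H < 2 ^ w := Iff.rfl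
@[simp] theorem ok_sub : (op .sub x y).ok w X H ↔
    x.ok w X H ∧ y.ok w X H ∧ y.val w H ≤ x.val w H := Iff.rfl
@[simp] theorem ok_mul : (op .mul x y).ok w X H ↔ x.ok w X H ∧ y.ok w X H := Iff.rfl
@[simp] theorem ok_div : (op .div x y).ok w X H ↔ x.ok w X H ∧ y.ok w X H := Iff.rfl
@[simp] theorem ok_mod : (op .mod x y).ok w X H ↔ x.ok w X H ∧ y.ok w X H := Iff.rfl
@[simp] theorem ok_or : (op .or x y).ok w X H ↔ x.ok w X H ∧ y.ok w X H := Iff.rfl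
@[simp] theorem ok_lt : (op .lt x y).ok w X H ↔ x.ok w X H ∧ y.ok w X H := Iff.rfl
@[simp] theorem ok_eq : (op .eq x y).ok w X H ↔ x.ok w X H ∧ y.ok w X H := Iff.rfl
end Expr

open StreamRAM.Expr (add sub mul div mod or lt eq)

/-- Append bit `xZ` to the queue of main node `xC`. -/
def emitBit : Stmt := blk [
  .ast aData (.a aQtail (.v xC))
    (or (.a aData (.a aQtail (.v xC))) (mul (.v xZ) (.a aQw (.v xC)))),
  .ast aQw (.v xC) (mul (.c 2) (.a aQw (.v xC))),
  -- Weight `0` means that the word is full. The next cell is linked at once, even if no bit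
  -- follows, so a queue of length `L` has exactly `L / w + 1` cells.
  .ite (.a aQw (.v xC)) .skip (blk [
    .asg xNc (add (.v xNc) (.c 1)),
    .ast aData (.v xNc) (.c 0),
    .ast aLink (.a aQtail (.v xC)) (.v xNc),
    .ast aQtail (.v xC) (.v xNc),
    .ast aQw (.v xC) (.c 1)])]

/-- Append the code of the number `xY` to the queue of main node `xC`. -/
def emitNum : Stmt := blk [
  .whl (.v xY) (blk [
    .asg xZ (.c 1),
    emitBit,
    .asg xZ (mod (.v xY) (.c 2)),
    emitBit,
    .asg xY (div (.v xY) (.c 2))]),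
  .asg xZ (.c 0),
  emitBit]

/-- Append position `xP` to the positions of main node `xC`. -/
def appendPos : Stmt :=
  .ite (eq (.v xP) (.a aPos (.v xC)))
    (blk [
      .ast aLen (.v xC) (add (.a aLen (.v xC)) (.c 1)),
      .ast aPos (.v xC) (add (.v xP) (.c 1))])
    (blk [
      -- A run is put into the queue only when it is over, together with the gap after it; the
      -- current run lives in `aLen` and `aPos`.
      .asg xY (.a aLen (.v xC)),
      emitNum,
      .asg xY (sub (.v xP) (.a aPos (.v xC))),
      emitNum,
      .ast aNp (.v xC) (add (.a aNp (.v xC)) (.c 1)),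
      .ast aLen (.v xC) (.c 1),
      .ast aPos (.v xC) (add (.v xP) (.c 1))])

/-- Append the positions of the chain of `xB` to the positions of main node `xC`. -/
def drain : Stmt := blk [
  .asg xX (.v xB),
  .whl (.v xX) (blk [
    .asg xP (add (.v xBase) (.v xX)),
    appendPos,
    .asg xX (.a aDn (.v xX))])]

/-- Insert a new main node before `xC`. -/
def newMain : Stmt := blk [
  .asg xD (add (.v xD) (.c 1)),
  .emv (add (add (.v xD) (.v xD)) (.c 1)) (add (.v xB) (.v xB)),
  .ast aMn (.v xD) (.v xC),
  .ast aMn (.v xPrev) (.v xD),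
  .asg xC (.v xD),
  .asg xNc (add (.v xNc) (.c 1)),
  .ast aData (.v xNc) (.c 0),
  .ast aQhead (.v xD) (.v xNc),
  .ast aQtail (.v xD) (.v xNc),
  .ast aQw (.v xD) (.c 1),
  .ast aLen (.v xD) (.c 0),
  .ast aPos (.v xD) (.c 1),
  .ast aNp (.v xD) (.c 0)]

/-- Merge the sorted list `xB` of groups into the main list after node `xPrev`. -/
def mainMerge : Stmt :=
  .whl (.v xB) (blk [
    .asg xC (.a aMn (.v xPrev)),
    -- The default makes the end of the main list act as an infinite key. Likewise the default `0`
    -- of `xG` says that an absent node does not have the key of the group.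
    .asg xF (.c 1),
    .ite (.v xC) (.ele xF (add (.v xB) (.v xB)) (add (add (.v xC) (.v xC)) (.c 1))) .skip,
    .ite (.v xF)
      (blk [
        .asg xG (.c 0),
        .ite (.v xC) (.ele xG (add (add (.v xC) (.v xC)) (.c 1)) (add (.v xB) (.v xB))) .skip,
        .ite (.v xG) .skip newMain,
        drain,
        .asg xB (.a aNxt (.v xB))])
      (.asg xPrev (.v xC))])

/-- Merge the sorted list `xB` of groups into the sorted list of groups after node `xPrev`. -/
def groupMerge : Stmt :=
  .whl (.v xB) (blk [
    .asg xC (.a aNxt (.v xPrev)),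
    .asg xF (.c 1),
    .ite (.v xC) (.ele xF (add (.v xB) (.v xB)) (add (.v xC) (.v xC))) .skip,
    .ite (.v xF)
      (blk [
        .asg xG (.c 0),
        .ite (.v xC) (.ele xG (add (.v xC) (.v xC)) (add (.v xB) (.v xB))) .skip,
        .asg xT (.a aNxt (.v xB)),
        .ite (.v xG)
          (blk [
            -- Two chains of equal elements are joined in constant time through the tail pointer,
            -- the one of the earlier block first.
            .ast aDn (.a aCt (.v xC)) (.v xB),
            .ast aCt (.v xC) (.a aCt (.v xB))])
          (blk [
            .ast aNxt (.v xB) (.v xC),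
            .ast aNxt (.v xPrev) (.v xB),
            .asg xPrev (.v xB)]),
        .asg xB (.v xT)])
      (.asg xPrev (.v xC))])

/-- Merge adjacent lists. -/
def sortPass : Stmt := blk [
  -- An empty list behind the last slot is the partner of a list that would remain unpaired.
  .ast aSlot (.v xCnt) (.c 0),
  .asg xJ (.c 0),
  .whl (lt (add (.v xJ) (.v xJ)) (.v xCnt)) (blk [
    .ast aNxt (.c 0) (.a aSlot (add (.v xJ) (.v xJ))),
    .asg xPrev (.c 0),
    .asg xB (.a aSlot (add (add (.v xJ) (.v xJ)) (.c 1))),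
    groupMerge,
    .ast aSlot (.v xJ) (.a aNxt (.c 0)),
    .asg xJ (add (.v xJ) (.c 1))]),
  .asg xCnt (.v xJ)]

/-- Sort the lists of the first `xM` slots into slot `0`. -/
def sortBatch : Stmt := blk [
  .asg xCnt (.v xM),
  .ast aSlot (.v xCnt) (.c 0),
  .whl (lt (.c 1) (.v xCnt)) sortPass]

/-- Read up to `xD + 1` elements. -/
def readBatch : Stmt := blk [
  .asg xM (.c 0),
  .asg xCont (.c 1),
  .whl (.v xCont) (blk [
    -- Element `x = 1, 2, …` of a batch is kept in cell `2 * x`; the odd cells hold the keys of main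
    -- nodes.
    .rd (add (add (.v xM) (.v xM)) (.c 2)) xMore,
    .ite (.v xMore)
      (blk [
        .ast aSlot (.v xM) (add (.v xM) (.c 1)),
        .asg xM (add (.v xM) (.c 1)),
        .ast aNxt (.v xM) (.c 0),
        .ast aDn (.v xM) (.c 0),
        .ast aCt (.v xM) (.v xM),
        -- A batch has one element more than there are main nodes: it can pay for a walk along the
        -- main list, is never of capacity `0`, and keeps the buffer within `O(σ)`.
        .asg xCont (lt (.v xM) (add (.v xD) (.c 1)))])
      (.asg xCont (.c 0))])]

def batch : Stmt := blk [
  readBatch,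
  sortBatch,
  .asg xB (.a aSlot (.c 0)),
  .asg xPrev (.c 0),
  mainMerge,
  .asg xBase (add (.v xBase) (.v xM))]

/-- Take a bit off the queue that is read from bit `xR` of cell `xCell`. -/
def getBit : Stmt := blk [
  .asg xZ (mod (div (.a aData (.v xCell)) (.v xR)) (.c 2)),
  .asg xR (mul (.c 2) (.v xR)),
  .ite (.v xR) .skip (blk [
    .asg xCell (.a aLink (.v xCell)),
    .asg xR (.c 1)])]

/-- Digits arrive with the least significant one first, and `xU` is the weight of the next digit. -/
def getNum : Stmt := blk [
  .asg xY (.c 0),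
  .asg xU (.c 1),
  getBit,
  .whl (.v xZ) (blk [
    getBit,
    .asg xY (add (.v xY) (mul (.v xZ) (.v xU))),
    .asg xU (mul (.c 2) (.v xU)),
    getBit])]

/-- Write `xY` consecutive numbers from `xCur` on. -/
def writeRun : Stmt :=
  .whl (.v xY) (blk [
    .wr (.v xCur),
    .asg xCur (add (.v xCur) (.c 1)),
    .asg xY (sub (.v xY) (.c 1))])

def writeNode : Stmt := blk [
  .asg xCell (.a aQhead (.v xC)),
  .asg xR (.c 1),
  .asg xCur (.c 1),
  .asg xK (.a aNp (.v xC)),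
  .whl (.v xK) (blk [
    getNum,
    writeRun,
    -- The second number of a pair is the gap before the next run.
    getNum,
    .asg xCur (add (.v xCur) (.v xY)),
    .asg xK (sub (.v xK) (.c 1))]),
  .asg xY (.a aLen (.v xC)),
  writeRun]

def writeAll : Stmt := blk [
  .asg xC (.a aMn (.c 0)),
  .whl (.v xC) (blk [
    writeNode,
    .asg xC (.a aMn (.v xC))])]

def stableSort : Stmt := blk [
  .asg xMore (.c 1),
  .whl (.v xMore) batch,
  writeAll]

theorem stableSort_wf : stableSort.wf = true := by decide +kernel

/-! ### Frame conditions and bit queues -/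

/-- The states agree but for the given variables and arrays, and the time. -/
structure Frame {α : Type*} (vs fs : List ℕ) (H H' : HS α) : Prop where
  v : ∀ r, r ∉ vs → H'.v r = H.v r
  a : ∀ f, f ∉ fs → H'.a f = H.a f
  e : H'.e = H.e
  inp : H'.inp = H.inp
  out : H'.out = H.out

theorem Frame.trans {α : Type*} {vs fs vs' fs' vs'' fs'' : List ℕ} {H H' H'' : HS α}
    (h : Frame vs fs H H') (h' : Frame vs' fs' H' H'') (hv : vs ++ vs' ⊆ vs'')
    (hf : fs ++ fs' ⊆ fs'') : Frame vs'' fs'' H H'' where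
  v r hr := by
    rw [List.append_subset] at hv
    rw [h'.v r fun h => hr (hv.2 h), h.v r fun h => hr (hv.1 h)]
  a r hr := by
    rw [List.append_subset] at hf
    rw [h'.a r fun h => hr (hf.2 h), h.a r fun h => hr (hf.1 h)]
  e := h'.e.trans h.e
  inp := h'.inp.trans h.inp
  out := h'.out.trans h.out

variable {α : Type*} {w X : ℕ}

/-- The main nodes `1, …, d` have bit queues with contents `Bt`.  The `j`th cell of the queue of
node `i` is `cs i j`. -/
structure QInv (w : ℕ) (H : HS α) (cs : ℕ → ℕ → ℕ) (Bt : ℕ → List Bool) : Prop where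
  hd : ∀ i, 1 ≤ i → i ≤ H.v xD → H.a aQhead i = cs i 0
  tl : ∀ i, 1 ≤ i → i ≤ H.v xD → H.a aQtail i = cs i ((Bt i).length / w)
  qw : ∀ i, 1 ≤ i → i ≤ H.v xD → H.a aQw i = 2 ^ ((Bt i).length % w)
  lk : ∀ i, 1 ≤ i → i ≤ H.v xD → ∀ j < (Bt i).length / w, H.a aLink (cs i j) = cs i (j + 1)
  bit : ∀ i, 1 ≤ i → i ≤ H.v xD → ∀ j ≤ (Bt i).length / w, ∀ k < w,
    (H.a aData (cs i j)).testBit k = (Bt i).getD (j * w + k) false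
  rng : ∀ i, 1 ≤ i → i ≤ H.v xD → ∀ j ≤ (Bt i).length / w, 1 ≤ cs i j ∧ cs i j ≤ H.v xNc
  inj : ∀ i, 1 ≤ i → i ≤ H.v xD → ∀ j ≤ (Bt i).length / w, ∀ i', 1 ≤ i' → i' ≤ H.v xD →
    ∀ j' ≤ (Bt i').length / w, cs i j = cs i' j' → i = i' ∧ j = j'
  cnt : H.v xNc = ∑ i ∈ Finset.Icc 1 (H.v xD), ((Bt i).length / w + 1)

/-- The queue invariant depends on few variables and arrays only. -/
theorem QInv.congr {H H' : HS α} {cs : ℕ → ℕ → ℕ} {Bt : ℕ → List Bool} (h : QInv w H cs Bt)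
    (h1 : H'.v xD = H.v xD) (h2 : H'.v xNc = H.v xNc) (h3 : H'.a aQhead = H.a aQhead)
    (h4 : H'.a aQtail = H.a aQtail) (h5 : H'.a aQw = H.a aQw) (h6 : H'.a aLink = H.a aLink)
    (h7 : H'.a aData = H.a aData) : QInv w H' cs Bt := by
  constructor <;> simp only [h1, h2, h3, h4, h5, h6, h7]
  exacts [h.hd, h.tl, h.qw, h.lk, h.bit, h.rng, h.inj, h.cnt]

theorem sum_Icc_update (d c : ℕ) (h1 : 1 ≤ c) (h2 : c ≤ d) (f : List Bool → ℕ)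
    (Bt : ℕ → List Bool) (l : List Bool) :
    ∑ i ∈ Finset.Icc 1 d, f (Function.update Bt c l i) + f (Bt c) =
      ∑ i ∈ Finset.Icc 1 d, f (Bt i) + f l := by
  have hc : c ∈ Finset.Icc 1 d := Finset.mem_Icc.2 ⟨h1, h2⟩
  rw [← Finset.add_sum_erase _ _ hc, ← Finset.add_sum_erase _ (fun i => f (Bt i)) hc]
  have : ∑ x ∈ (Finset.Icc 1 d).erase c, f (Function.update Bt c l x) =
      ∑ x ∈ (Finset.Icc 1 d).erase c, f (Bt x) :=
    Finset.sum_congr rfl fun x hx => by rw [Function.update_of_ne (Finset.ne_of_mem_erase hx)]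
  simp only [Function.update_self]
  omega

/-- The number of cells of the queues. -/
def cells (w d : ℕ) (Bt : ℕ → List Bool) : ℕ :=
  ∑ i ∈ Finset.Icc 1 d, ((Bt i).length / w + 1)

theorem getD_concat (l : List Bool) (z : Bool) (n : ℕ) :
    (l ++ [z]).getD n false = if n = l.length then z else l.getD n false := by
  simp only [List.getD_eq_getElem?_getD]
  rcases lt_trichotomy n l.length with h | h | h
  · rw [List.getElem?_append_left h, if_neg h.ne]
  · subst h; simp
  · rw [if_neg h.ne', List.getElem?_eq_none (by simpa using h), List.getElem?_eq_none h.le]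

/-- The new bit goes to place `len % w` of cell `len / w`. The space hypothesis counts the cells
after the bit has been appended, and thus covers the fresh cell that is opened when a word fills up.
-/
theorem emitBit_wp [LinearOrder α] (h0 : 1 < w) (hX : 64 + 16 * X ≤ 2 ^ w) {H : HS α} {cs Bt}
    (hQ : QInv w H cs Bt) (h1 : 1 ≤ H.v xC) (h2 : H.v xC ≤ H.v xD) (hd : H.v xD < X) (z : Bool)
    (hz : H.v xZ = z.toNat)
    (hc : cells w (H.v xD) (Function.update Bt (H.v xC) (Bt (H.v xC) ++ [z])) < X) :
    emitBit.wp w X (fun H' => (∃ cs', QInv w H' cs'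
      (Function.update Bt (H.v xC) (Bt (H.v xC) ++ [z]))) ∧
      Frame [xNc] [aData, aQw, aQtail, aLink] H H' ∧ H'.tm ≤ H.tm + 8) H := by
  obtain ⟨c, hcdef⟩ : ∃ c, c = H.v xC := ⟨_, rfl⟩
  rw [← hcdef] at h1 h2 hc ⊢
  have hsum := sum_Icc_update (H.v xD) c h1 h2 (fun l => l.length / w + 1) Bt (Bt c ++ [z])
  have hcnt := hQ.cnt
  unfold cells at hc
  obtain ⟨n, hn⟩ : ∃ n, n = (Bt c).length := ⟨_, rfl⟩
  have hnw : (Bt c).length / w = n / w := by rw [hn]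
  have hw0 : 0 < w := by omega
  have hmod := Nat.mod_lt n hw0
  have hdm := Nat.div_add_mod n w
  have hlen : (Bt c ++ [z]).length = n + 1 := by simp [hn]
  have hqt := hQ.tl c h1 h2
  have hqw := hQ.qw c h1 h2
  have htr := hQ.rng c h1 h2 (n / w) hnw.ge
  rw [← hn] at hqt hqw
  have hp1 : 2 ^ (n % w) < 2 ^ w := Nat.pow_lt_pow_right (by norm_num) hmod
  have hzq : z.toNat * 2 ^ (n % w) % 2 ^ w = z.toNat * 2 ^ (n % w) := by
    apply Nat.mod_eq_of_lt; cases z <;> simp [hp1]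
  have hor : ∀ x k, (x ||| z.toNat * 2 ^ (n % w)).testBit k =
      (x.testBit k || (decide (k = n % w) && z)) := by
    intro x k
    rw [Nat.testBit_or]
    cases z
    · simp
    · simp [Nat.testBit_two_pow, eq_comm]
  -- A disjunction can only set bits; it writes `z` correctly because the invariant says that places
  -- beyond the end of the queue, where `getD` returns its default, are still `0`.
  have hbit : ∀ i, 1 ≤ i → i ≤ H.v xD → ∀ j ≤ (Bt i).length / w, ∀ k < w,
      (Function.update (H.a aData) (cs c (n / w))
        (H.a aData (cs c (n / w)) ||| z.toNat * 2 ^ (n % w)) (cs i j)).testBit k =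
      (Function.update Bt c (Bt c ++ [z]) i).getD (j * w + k) false := by
    intro i hi1 hi2 j hj k hk
    by_cases hic : i = c
    · subst hic
      rw [Function.update_self, getD_concat, ← hn]
      by_cases hjn : j = n / w
      · rw [hjn, Function.update_self, hor, hQ.bit i hi1 hi2 (n / w) hnw.ge k hk]
        have : (n / w * w + k = n) ↔ k = n % w := by rw [mul_comm]; omega
        by_cases hkn : k = n % w
        · rw [if_pos (this.2 hkn), this.2 hkn]; simp [hkn, hn]
        · rw [if_neg (by rw [this]; exact hkn)]; simp [hkn]
      · have hlt : j < n / w := lt_of_le_of_ne (hj.trans hnw.le) hjn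
        have : (j + 1) * w ≤ n / w * w := Nat.mul_le_mul_right _ hlt
        have h3 : n / w * w ≤ n := Nat.div_mul_le_self _ _
        rw [if_neg (by rw [add_mul, one_mul] at this; omega), Function.update_of_ne,
          hQ.bit i hi1 hi2 j hj k hk]
        intro h
        exact hjn (hQ.inj i hi1 hi2 j hj i hi1 hi2 _ hnw.ge h).2
    · rw [Function.update_of_ne hic, Function.update_of_ne, hQ.bit i hi1 hi2 j hj k hk]
      intro h
      exact hic (hQ.inj i hi1 hi2 j hj c h1 h2 _ hnw.ge h).1
  simp only [emitBit, blk, Stmt.wp, Expr.ok_a, Expr.ok_v, Expr.val_a, Expr.val_v, Expr.ok_or,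
    Expr.ok_mul, Expr.val_or, Expr.val_mul, Expr.ok_c, Expr.val_c, true_and, HS.setA_v,
    HS.setA_a, HS.setV_v, HS.setV_a, HS.tick_v, HS.tick_a, ← hcdef, hz, hqt, hqw, hzq,
    Nat.reduceEqDiff, if_true, if_false, Function.update_self, Expr.ok_add, Expr.val_add,
    show c < X by omega, show 2 < 2 ^ w by omega, show 1 < 2 ^ w by omega,
    show 0 < 2 ^ w by omega, and_self]
  by_cases hwrap : n % w + 1 = w
  · -- the cell is full
    have e1 : (n + 1) / w = n / w + 1 := by
      rw [show n + 1 = w * (n / w + 1) by rw [mul_add]; omega]; exact Nat.mul_div_cancel_left _ hw0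
    have e2 : (n + 1) % w = 0 := by
      rw [show n + 1 = w * (n / w + 1) by rw [mul_add]; omega]; exact Nat.mul_mod_right _ _
    have e3 : 2 * 2 ^ (n % w) % 2 ^ w = 0 := by rw [← pow_succ', hwrap, Nat.mod_self]
    rw [hlen, e1] at hsum
    have hnc : ∑ i ∈ Finset.Icc 1 (H.v xD), ((Function.update Bt c (Bt c ++ [z]) i).length / w + 1)
        = H.v xNc + 1 := by omega
    rw [hnc] at hc
    have hcs : ∀ i, 1 ≤ i → i ≤ H.v xD → ∀ j ≤ (Bt i).length / w, cs i j ≠ H.v xNc + 1 := by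
      intro i hi1 hi2 j hj
      have := (hQ.rng i hi1 hi2 j hj).2
      omega
    have hcs' : ∀ i, 1 ≤ i → i ≤ H.v xD →
        ∀ j ≤ (Function.update Bt c (Bt c ++ [z]) i).length / w,
        (i = c ∧ j = n / w + 1) ∨ (¬ (i = c ∧ j = n / w + 1) ∧ j ≤ (Bt i).length / w) := by
      intro i hi1 hi2 j hj
      by_cases hic : i = c
      · subst hic
        rw [Function.update_self, hlen, e1] at hj
        rw [← hn]; simp only [true_and]; omega
      · rw [Function.update_of_ne hic] at hj
        exact .inr ⟨fun h => hic h.1, hj⟩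
    -- The table of cells changes at one entry only, which lies beyond all cells in use so far.
    obtain ⟨cs', hsame, hnew⟩ : ∃ cs' : ℕ → ℕ → ℕ, (∀ i, 1 ≤ i → i ≤ H.v xD →
        ∀ j ≤ (Bt i).length / w, cs' i j = cs i j) ∧ cs' c (n / w + 1) = H.v xNc + 1 := by
      refine ⟨fun i j => if i = c ∧ j = n / w + 1 then H.v xNc + 1 else cs i j, ?_, by simp⟩
      intro i _ _ j hj
      dsimp only
      rw [if_neg]
      rintro ⟨rfl, rfl⟩
      rw [← hn] at hj
      omega
    rw [e3]
    refine ⟨⟨by omega, trivial⟩, by omega, fun h => absurd rfl h, fun _ =>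
      ⟨by omega, by omega, by omega,
        ⟨cs', ?_⟩, ?_, ?_⟩⟩
    · constructor <;> simp only [HS.tick_v, HS.tick_a, HS.setA_v, HS.setA_a, Nat.reduceEqDiff,
        if_true, if_false, HS.setV_v, HS.setV_a]
      · intro i hi1 hi2
        rw [hsame i hi1 hi2 0 (Nat.zero_le _), hQ.hd i hi1 hi2]
      · intro i hi1 hi2
        by_cases hic : i = c
        · subst hic; rw [Function.update_self, Function.update_self, hlen, e1, hnew]
        · rw [Function.update_of_ne hic, Function.update_of_ne hic, hsame i hi1 hi2 _ le_rfl,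
            hQ.tl i hi1 hi2]
      · intro i hi1 hi2
        by_cases hic : i = c
        · subst hic; rw [Function.update_self, Function.update_self, hlen, e2, pow_zero]
        · rw [Function.update_of_ne hic, Function.update_of_ne hic, Function.update_of_ne hic,
            hQ.qw i hi1 hi2]
      · intro i hi1 hi2 j hj
        by_cases hic : i = c
        · subst hic
          rw [Function.update_self, hlen, e1] at hj
          rw [hsame i hi1 hi2 j (by omega)]
          by_cases hjn : j = n / w
          · rw [hjn, Function.update_self, hnew]
          · rw [Function.update_of_ne, hsame i hi1 hi2 (j + 1) (by omega),
              hQ.lk i hi1 hi2 j (by omega)]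
            intro h
            exact hjn (hQ.inj i hi1 hi2 j (by omega) i hi1 hi2 _ hnw.ge h).2
        · rw [Function.update_of_ne hic] at hj
          rw [hsame i hi1 hi2 j (by omega), hsame i hi1 hi2 (j + 1) (by omega), Function.update_of_ne,
            hQ.lk i hi1 hi2 j hj]
          intro h
          exact hic (hQ.inj i hi1 hi2 j (by omega) c h1 h2 _ hnw.ge h).1
      · intro i hi1 hi2 j hj k hk
        rcases hcs' i hi1 hi2 j hj with ⟨rfl, rfl⟩ | ⟨hne, hj'⟩
        · rw [hnew, Function.update_self, Nat.zero_testBit, Function.update_self,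
            List.getD_eq_getElem?_getD, List.getElem?_eq_none]
          · rfl
          · rw [hlen, add_mul, one_mul, mul_comm]; omega
        · rw [hsame i hi1 hi2 j hj', Function.update_of_ne (hcs i hi1 hi2 j hj'), hbit i hi1 hi2 j hj' k hk]
      · intro i hi1 hi2 j hj
        rcases hcs' i hi1 hi2 j hj with ⟨rfl, rfl⟩ | ⟨hne, hj'⟩
        · rw [hnew]; omega
        · rw [hsame i hi1 hi2 j hj']
          have := hQ.rng i hi1 hi2 j hj'
          omega
      · intro i hi1 hi2 j hj i' hi1' hi2' j' hj' h
        rcases hcs' i hi1 hi2 j hj with ⟨h3, h4⟩ | ⟨hne, hj2⟩ <;>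
          rcases hcs' i' hi1' hi2' j' hj' with ⟨h3', h4'⟩ | ⟨hne', hj2'⟩
        · exact ⟨h3.trans h3'.symm, h4.trans h4'.symm⟩
        · rw [h3, h4, hnew, hsame i' hi1' hi2' j' hj2'] at h
          exact absurd h.symm (hcs i' hi1' hi2' j' hj2')
        · rw [h3', h4', hnew, hsame i hi1 hi2 j hj2] at h
          exact absurd h (hcs i hi1 hi2 j hj2)
        · rw [hsame i hi1 hi2 j hj2, hsame i' hi1' hi2' j' hj2'] at h
          exact hQ.inj i hi1 hi2 j hj2 i' hi1' hi2' j' hj2' h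
      · rw [hnc]
    · constructor <;> simp +contextual
    · simp
    
  · have e1 : (n + 1) / w = n / w := by
      rw [show n + 1 = w * (n / w) + (n % w + 1) by omega, Nat.mul_add_div hw0,
        Nat.div_eq_of_lt (show n % w + 1 < w by omega), add_zero]
    have e2 : (n + 1) % w = n % w + 1 := by
      rw [show n + 1 = w * (n / w) + (n % w + 1) by omega, Nat.mul_add_mod]
      exact Nat.mod_eq_of_lt (by omega)
    have e3 : 2 * 2 ^ (n % w) % 2 ^ w = 2 ^ (n % w + 1) := by
      rw [← pow_succ']; exact Nat.mod_eq_of_lt (Nat.pow_lt_pow_right (by norm_num) (by omega))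
    have hL : ∀ i, (Function.update Bt c (Bt c ++ [z]) i).length / w = (Bt i).length / w := by
      intro i
      by_cases hic : i = c
      · subst hic; rw [Function.update_self, hlen, e1, hnw]
      · rw [Function.update_of_ne hic]
    rw [hlen, e1] at hsum
    rw [e3]
    refine ⟨⟨by omega, trivial⟩, by omega, fun _ => ⟨⟨cs, ?_⟩, ?_, ?_⟩,
      fun h => absurd h (pow_pos two_pos _).ne'⟩
    · constructor <;> simp only [HS.tick_v, HS.tick_a, HS.setA_v, HS.setA_a, Nat.reduceEqDiff,
        if_true, if_false, hL]
      · exact hQ.hd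
      · exact hQ.tl
      · intro i hi1 hi2
        by_cases hic : i = c
        · subst hic; rw [Function.update_self, Function.update_self, hlen, e2]
        · rw [Function.update_of_ne hic, Function.update_of_ne hic, hQ.qw i hi1 hi2]
      · exact hQ.lk
      · exact hbit
      · exact hQ.rng
      · exact hQ.inj
      · exact hcnt
    · constructor <;> simp +contextual
    · simp
    

end StreamRAM

/-! ### The prefix code and the encoding of position lists -/

namespace StreamRAM
open StreamRAM.Expr (add sub mul div mod or lt eq)

variable {α : Type*} {w X : ℕ}

/-- A prefix code of the natural numbers: each binary digit is preceded by `true`, and the end is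
marked by `false`. -/
def code (n : ℕ) : List Bool :=
  if h : n = 0 then [false] else true :: decide (n % 2 = 1) :: code (n / 2)
termination_by n
decreasing_by omega

theorem code_zero : code 0 = [false] := by rw [code]; simp

theorem code_pos {n : ℕ} (h : n ≠ 0) : code n = true :: decide (n % 2 = 1) :: code (n / 2) := by
  rw [code, dif_neg h]

theorem code_length_pos (n : ℕ) : 0 < (code n).length := by
  rw [code]; split_ifs <;> simp

theorem cells_mono {d : ℕ} {Bt Bt' : ℕ → List Bool}
    (h : ∀ i, (Bt i).length ≤ (Bt' i).length) : cells w d Bt ≤ cells w d Bt' :=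
  Finset.sum_le_sum fun i _ => Nat.add_le_add_right (Nat.div_le_div_right (h i)) 1

theorem cells_update_mono {d c : ℕ} {Bt : ℕ → List Bool} {l l' : List Bool}
    (h : l.length ≤ l'.length) :
    cells w d (Function.update Bt c l) ≤ cells w d (Function.update Bt c l') :=
  cells_mono fun i => by
    by_cases hi : i = c
    · subst hi; simpa using h
    · rw [Function.update_of_ne hi, Function.update_of_ne hi]

/-- The loop halves `y`, as the recursion of `code` does. After the first round the remaining
statement is again `emitNum`, started with `y / 2` and a longer queue, so strong induction on `y`
applies. -/
theorem emitNum_wp [LinearOrder α] (h0 : 1 < w) (hX : 64 + 16 * X ≤ 2 ^ w) (y : ℕ) :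
    ∀ {H : HS α} {cs Bt}, QInv w H cs Bt → 1 ≤ H.v xC → H.v xC ≤ H.v xD → H.v xD < X →
      H.v xY = y → cells w (H.v xD) (Function.update Bt (H.v xC) (Bt (H.v xC) ++ code y)) < X →
      emitNum.wp w X (fun H' => (∃ cs', QInv w H' cs'
        (Function.update Bt (H.v xC) (Bt (H.v xC) ++ code y))) ∧
        Frame [xNc, xY, xZ] [aData, aQw, aQtail, aLink] H H' ∧
        H'.tm ≤ H.tm + 20 * (code y).length) H := by
  induction y using Nat.strong_induction_on with
  | _ y ih =>
  intro H cs Bt hQ h1 h2 hd hy hc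
  have h2w : 2 < 2 ^ w := by omega
  simp only [emitNum, blk, Stmt.wp_seq]
  refine Stmt.wp_whl (by simp) (fun hv => ?_) (fun hv => ?_)
  · simp only [Expr.val_v, hy] at hv
    rw [code_pos hv] at hc ⊢
    simp only [Stmt.wp_seq]
    refine ⟨by simp; omega, ?_⟩
    have f1 : Frame [xZ] [] H (H.tick.setV xZ 1) := by constructor <;> simp +contextual
    have q1 : QInv w (H.tick.setV xZ 1) cs Bt := hQ.congr (by simp) (by simp) rfl rfl rfl rfl rfl
    refine Stmt.wp_mono _ (emitBit_wp h0 hX q1 (by simpa) (by simpa) (by simpa) true (by simp)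
      ?_) ?_
    · simp
      refine lt_of_le_of_lt (cells_update_mono ?_) hc
      simp
    rintro H1 ⟨⟨cs1, hQ1⟩, hF1, ht1⟩
    replace hF1 := f1.trans hF1 (vs'' := [xNc, xZ]) (fs'' := [aData, aQw, aQtail, aLink])
      (by simp) (by simp)
    have hC1 := hF1.v xC (by simp)
    have hD1 := hF1.v xD (by simp)
    have hY1 := hF1.v xY (by simp)
    simp only [HS.setV_v, HS.tick_v, Nat.reduceEqDiff, if_false] at hQ1
    refine ⟨by simp; omega, ?_⟩
    have f2 : ∀ z, Frame [xZ] [] H1 (H1.setV xZ z) := by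
      intro z; constructor <;> simp +contextual
    have q2 : ∀ z, QInv w (H1.setV xZ z) cs1 _ := fun z =>
      hQ1.congr (by simp) (by simp) rfl rfl rfl rfl rfl
    refine Stmt.wp_mono _ (emitBit_wp h0 hX (q2 _) ?_ ?_ ?_ (decide (y % 2 = 1)) ?_ ?_) ?_
    · simpa [hC1]
    · simpa [hC1, hD1]
    · simpa [hD1]
    · rcases Nat.mod_two_eq_zero_or_one y with h | h <;> simp [hY1, hy, h]
    · simp [hC1, hD1]
      refine lt_of_le_of_lt (cells_update_mono ?_) hc
      simp
    rintro H2 ⟨⟨cs2, hQ2⟩, hF2, ht2⟩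
    replace hF2 := (hF1.trans (f2 _) (vs'' := [xNc, xZ])
      (fs'' := [aData, aQw, aQtail, aLink]) (by simp) (by simp)).trans hF2 (vs'' := [xNc, xZ])
      (fs'' := [aData, aQw, aQtail, aLink]) (by simp) (by simp)
    simp only [HS.setV_v, Nat.reduceEqDiff, if_false, hC1, Function.update_self,
      Function.update_idem, List.append_assoc, List.singleton_append] at hQ2
    refine ⟨by simp; omega, ?_⟩
    have hC2 := hF2.v xC (by simp)
    have hD2 := hF2.v xD (by simp)
    have hY2 := hF2.v xY (by simp)
    have f3 : ∀ z, Frame [xY] [] H2 (H2.setV xY z) := by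
      intro z; constructor <;> simp +contextual
    have q3 : ∀ z, QInv w (H2.setV xY z) cs2 _ := fun z =>
      hQ2.congr (by simp) (by simp) rfl rfl rfl rfl rfl
    have hrec := ih (y / 2) (by omega) (q3 (y / 2)) (by simpa [hC2]) (by simpa [hC2, hD2])
      (by simpa [hD2]) (by simp) (by simpa [hC2, hD2] using hc)
    -- The hypothesis about the whole of `emitNum` is split into its loop and its final bit, so that
    -- it fits the goal, where the loop has already been entered.
    rw [emitNum] at hrec
    simp only [blk, Stmt.wp_seq] at hrec
    simp only [Expr.val_div, Expr.val_v, Expr.val_c, hY2, hy]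
    refine Stmt.wp_mono _ hrec fun H3 h => ⟨h.1, Stmt.wp_mono _ h.2 ?_⟩
    rintro H3 ⟨hQ3, hF3, ht3⟩
    simp only [HS.setV_v, Nat.reduceEqDiff, if_false, hC2, Function.update_self,
      Function.update_idem, List.append_assoc, List.cons_append, List.nil_append] at hQ3
    refine ⟨hQ3, (hF2.trans (f3 _) (vs'' := [xNc, xY, xZ])
      (fs'' := [aData, aQw, aQtail, aLink]) (by simp) (by simp)).trans hF3 (by simp) (by simp), ?_⟩
    simp at ht1 ht2 ht3 ⊢
    omega
  · simp only [Expr.val_v, hy] at hv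
    subst hv
    rw [code_zero] at hc ⊢
    refine ⟨by simp, ?_⟩
    have f1 : Frame [xZ] [] H (H.tick.setV xZ 0) := by constructor <;> simp +contextual
    have q1 : QInv w (H.tick.setV xZ 0) cs Bt := hQ.congr (by simp) (by simp) rfl rfl rfl rfl rfl
    refine Stmt.wp_mono _ (emitBit_wp h0 hX q1 (by simpa) (by simpa) (by simpa) false (by simp)
      (by simpa)) ?_
    rintro H1 ⟨hQ1, hF1, ht1⟩
    simp only [HS.setV_v, HS.tick_v, Nat.reduceEqDiff, if_false] at hQ1
    refine ⟨hQ1, f1.trans hF1 (by simp) (by simp), ?_⟩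
    simp at ht1 ⊢
    omega

/-! ### The encoding of positions -/

/-- The encoding of an increasing sequence of positions: the lengths of the runs of consecutive
positions, each with the gap that follows it, the length of the last run, and the position after
it. -/
structure Enc where
  pairs : List (ℕ × ℕ)
  len : ℕ
  pos : ℕ

def Enc.step (s : Enc) (p : ℕ) : Enc :=
  if p = s.pos then ⟨s.pairs, s.len + 1, p + 1⟩ else ⟨s.pairs ++ [(s.len, p - s.pos)], 1, p + 1⟩

/-- The fold starts with an empty run that ends before position `1`; a first position `p > 1`
therefore closes the pair `(0, p - 1)`, and no separate case for the first run is needed. -/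
def encode (l : List ℕ) : Enc := l.foldl Enc.step ⟨[], 0, 1⟩

theorem encode_nil : encode [] = ⟨[], 0, 1⟩ := rfl

theorem encode_concat (l : List ℕ) (p : ℕ) : encode (l ++ [p]) = (encode l).step p := by
  simp [encode]

/-- The contents of the bit queue of an element with positions `l`. -/
def qbits (l : List ℕ) : List Bool :=
  (encode l).pairs.flatMap fun q => code q.1 ++ code q.2

theorem encode_pos_concat (l : List ℕ) (p : ℕ) : (encode (l ++ [p])).pos = p + 1 := by
  rw [encode_concat, Enc.step]; split_ifs <;> rfl

/-- After the last position `q` the expected position is `q + 1`. The leading `0` in the sorted list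
expresses that positions start at `1`, which settles the empty list. -/
theorem encode_pos_le {l : List ℕ} {p : ℕ} (h : (0 :: (l ++ [p])).Pairwise (· < ·)) :
    (encode l).pos ≤ p := by
  rcases List.eq_nil_or_concat l with rfl | ⟨l, q, rfl⟩
  · simp [encode_nil] at h ⊢; omega
  · rw [List.concat_eq_append, encode_pos_concat]
    simp [List.pairwise_append] at h
    exact h.2.2.1

theorem encode_len_le (l : List ℕ) : (encode l).len ≤ l.length ∧
    (encode l).pairs.length ≤ l.length := by
  induction l using List.reverseRecOn with
  | nil => simp [encode_nil]
  | append_singleton l p ih =>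
    rw [encode_concat, Enc.step]
    split_ifs <;> simp <;> omega

/-- Bits once written never change, since only closed runs are in the queue. This monotonicity is
why the final contents bound the space needed at any earlier time. -/
theorem qbits_prefix_concat (l : List ℕ) (p : ℕ) : qbits l <+: qbits (l ++ [p]) := by
  unfold qbits
  rw [encode_concat, Enc.step]
  split_ifs <;> simp

theorem qbits_length_le {l l' : List ℕ} (h : l <+: l') : (qbits l).length ≤ (qbits l').length := by
  obtain ⟨r, rfl⟩ := h
  induction r using List.reverseRecOn with
  | nil => simp
  | append_singleton r p ih =>
    rw [← List.append_assoc]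
    exact ih.trans (qbits_prefix_concat _ p).length_le

/-- The main nodes `1, …, d` have the positions `P`. -/
structure MInv (w : ℕ) (H : HS α) (cs : ℕ → ℕ → ℕ) (P : ℕ → List ℕ) : Prop where
  q : QInv w H cs fun i => qbits (P i)
  len : ∀ i, 1 ≤ i → i ≤ H.v xD → H.a aLen i = (encode (P i)).len
  pos : ∀ i, 1 ≤ i → i ≤ H.v xD → H.a aPos i = (encode (P i)).pos
  np : ∀ i, 1 ≤ i → i ≤ H.v xD → H.a aNp i = (encode (P i)).pairs.length

theorem MInv.congr {H H' : HS α} {cs : ℕ → ℕ → ℕ} {P : ℕ → List ℕ} (h : MInv w H cs P)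
    (h1 : H'.v xD = H.v xD) (h2 : H'.v xNc = H.v xNc)
    (ha : ∀ f, 5 ≤ f → f ≤ 12 → H'.a f = H.a f) : MInv w H' cs P where
  q := h.q.congr h1 h2 (ha 5 (by simp) (by simp)) (ha 6 (by simp) (by simp))
    (ha 7 (by simp) (by simp)) (ha 12 (by simp) (by simp)) (ha 11 (by simp) (by simp))
  len := by rw [h1, ha 8 (by simp) (by simp)]; exact h.len
  pos := by rw [h1, ha 9 (by simp) (by simp)]; exact h.pos
  np := by rw [h1, ha 10 (by simp) (by simp)]; exact h.np

theorem qbits_update (P : ℕ → List ℕ) (c : ℕ) (l : List ℕ) :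
    (fun i => qbits (Function.update P c l i)) =
      Function.update (fun i => qbits (P i)) c (qbits l) := by
  funext i
  by_cases h : i = c
  · subst h; simp
  · rw [Function.update_of_ne h, Function.update_of_ne h]

/-- Either the current run grows and no bit is written, or two numbers are emitted. All but a
constant is charged to the new bits at 20 units each; stated with queue lengths before and after,
the charges telescope over calls. -/
theorem appendPos_wp [LinearOrder α] (h0 : 1 < w) (hX : 64 + 16 * X ≤ 2 ^ w) {H : HS α} {cs P}
    (hM : MInv w H cs P) (h1 : 1 ≤ H.v xC) (h2 : H.v xC ≤ H.v xD) (hd : H.v xD < X)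
    (hp : (encode (P (H.v xC))).pos ≤ H.v xP) (hp' : H.v xP + 1 < 2 ^ w)
    (hl : (P (H.v xC)).length + 1 < 2 ^ w)
    (hc : cells w (H.v xD)
      (fun i => qbits (Function.update P (H.v xC) (P (H.v xC) ++ [H.v xP]) i)) < X) :
    appendPos.wp w X (fun H' => (∃ cs', MInv w H' cs'
        (Function.update P (H.v xC) (P (H.v xC) ++ [H.v xP]))) ∧
      Frame [xNc, xY, xZ] [aQtail, aQw, aLen, aPos, aNp, aData, aLink] H H' ∧
      H'.tm + 20 * (qbits (P (H.v xC))).length ≤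
        H.tm + 20 * (qbits (P (H.v xC) ++ [H.v xP])).length + 10) H := by
  obtain ⟨c, hcd⟩ : ∃ c, c = H.v xC := ⟨_, rfl⟩
  obtain ⟨p, hpd⟩ : ∃ p, p = H.v xP := ⟨_, rfl⟩
  obtain ⟨l, hld⟩ : ∃ l, l = P c := ⟨_, rfl⟩
  rw [← hcd] at h1 h2 hp hl hc ⊢
  rw [← hpd] at hp hp' hc ⊢
  rw [← hld] at hp hl hc ⊢
  have hpos := hM.pos c h1 h2
  have hlen := hM.len c h1 h2
  have hnp := hM.np c h1 h2
  rw [← hld] at hpos hlen hnp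
  have hel := encode_len_le l
  have h2w : 2 < 2 ^ w := by omega
  unfold appendPos
  simp only [blk, Stmt.wp]
  refine ⟨by simp [← hcd]; omega, fun hv => ?_, fun hv => ?_⟩
  · simp [← hcd, ← hpd, hpos] at hv
    have hst : encode (l ++ [p]) = ⟨(encode l).pairs, (encode l).len + 1, p + 1⟩ := by
      rw [encode_concat, Enc.step, if_pos hv]
    have hqb : qbits (l ++ [p]) = qbits l := by unfold qbits; rw [hst]
    simp [← hcd, ← hpd, hlen]
    refine ⟨by omega, by omega, by omega, by omega, ⟨cs, ?_⟩, ?_, ?_⟩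
    · constructor
      · rw [qbits_update, hqb, hld, Function.update_eq_self_iff.2 rfl]
        exact hM.q.congr (by simp) (by simp) rfl rfl rfl rfl rfl
      · intro i hi1 hi2
        simp at hi2 ⊢
        by_cases hic : i = c
        · subst hic; simp [hst]
        · simp [Function.update_of_ne hic, hM.len i hi1 hi2]
      · intro i hi1 hi2
        simp at hi2 ⊢
        by_cases hic : i = c
        · subst hic; simp [hst]
        · simp [Function.update_of_ne hic, hM.pos i hi1 hi2]
      · intro i hi1 hi2
        simp at hi2 ⊢
        by_cases hic : i = c
        · subst hic; simp [hst, hnp]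
        · simp [Function.update_of_ne hic, hM.np i hi1 hi2]
    · constructor <;> simp +contextual
    · rw [hqb]; omega
  · simp [← hcd, ← hpd, hpos] at hv
    have hst : encode (l ++ [p]) =
        ⟨(encode l).pairs ++ [((encode l).len, p - (encode l).pos)], 1, p + 1⟩ := by
      rw [encode_concat, Enc.step, if_neg hv]
    have hqb : qbits (l ++ [p]) =
        qbits l ++ (code (encode l).len ++ code (p - (encode l).pos)) := by
      unfold qbits; rw [hst]; simp
    rw [qbits_update, hqb] at hc
    refine ⟨by simp [← hcd]; omega, ?_⟩
    simp only [Expr.val_a, Expr.val_v, HS.tick_a, HS.tick_v, ← hcd, hlen]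
    have f1 : Frame [xY] [] H (H.tick.setV xY (encode l).len) := by
      constructor <;> simp +contextual
    have q1 : QInv w (H.tick.setV xY (encode l).len) cs _ :=
      hM.q.congr (by simp) (by simp) rfl rfl rfl rfl rfl
    refine Stmt.wp_mono _ (emitNum_wp h0 hX (encode l).len q1 (by simp; omega) (by simp; omega)
      (by simpa) (by simp) ?_) ?_
    · simp [← hcd, ← hld]
      refine lt_of_le_of_lt (cells_update_mono ?_) hc
      simp
    rintro H1 ⟨⟨cs1, hQ1⟩, hF1, ht1⟩
    replace hF1 := f1.trans hF1 (vs'' := [xNc, xY, xZ]) (fs'' := [aData, aQw, aQtail, aLink])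
      (by simp) (by simp)
    have hC1 := hF1.v xC (by simp)
    have hD1 := hF1.v xD (by simp)
    have hP1 := hF1.v xP (by simp)
    have hpos1 := hF1.a aPos (by simp)
    simp only [HS.setV_v, HS.tick_v, Nat.reduceEqDiff, if_false, ← hcd, ← hld] at hQ1
    refine ⟨by simp [hC1, hP1, hpos1, ← hcd, ← hpd, hpos]; omega, ?_⟩
    simp only [Expr.val_a, Expr.val_v, Expr.val_sub, hC1, hP1, hpos1, ← hcd, ← hpd, hpos]
    have f2 : Frame [xY] [] H1 (H1.setV xY (p - (encode l).pos)) := by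
      constructor <;> simp +contextual
    have q2 : QInv w (H1.setV xY (p - (encode l).pos)) cs1 _ :=
      hQ1.congr (by simp) (by simp) rfl rfl rfl rfl rfl
    refine Stmt.wp_mono _ (emitNum_wp h0 hX (p - (encode l).pos) q2 (by simp; omega)
      (by simp; omega) (by simp; omega) (by simp) ?_) ?_
    · simpa [hC1, hD1, ← hcd] using hc
    rintro H2 ⟨⟨cs2, hQ2⟩, hF2, ht2⟩
    replace hF2 := (hF1.trans f2 (vs'' := [xNc, xY, xZ])
      (fs'' := [aData, aQw, aQtail, aLink]) (by simp) (by simp)).trans hF2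
      (vs'' := [xNc, xY, xZ]) (fs'' := [aData, aQw, aQtail, aLink]) (by simp) (by simp)
    have hC2 := hF2.v xC (by simp)
    have hD2 := hF2.v xD (by simp)
    have hP2 := hF2.v xP (by simp)
    have hpos2 := hF2.a aPos (by simp)
    have hlen2 := hF2.a aLen (by simp)
    have hnp2 := hF2.a aNp (by simp)
    simp only [HS.setV_v, Nat.reduceEqDiff, if_false, hC1, ← hcd, Function.update_self,
      Function.update_idem, List.append_assoc] at hQ2
    simp [hC2, hP2, hnp2, ← hcd, ← hpd, hnp]
    refine ⟨by omega, by omega, by omega, by omega, by omega, by omega, ⟨cs2, ?_⟩, ?_, ?_⟩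
    · constructor
      · rw [qbits_update, hqb]
        exact hQ2.congr (by simp) (by simp) rfl rfl rfl rfl rfl
      · intro i hi1 hi2
        simp [hD2] at hi2 ⊢
        by_cases hic : i = c
        · subst hic; simp [hst]
        · simp [Function.update_of_ne hic, hlen2, hM.len i hi1 hi2]
      · intro i hi1 hi2
        simp [hD2] at hi2 ⊢
        by_cases hic : i = c
        · subst hic; simp [hst]
        · simp [Function.update_of_ne hic, hpos2, hM.pos i hi1 hi2]
      · intro i hi1 hi2
        simp [hD2] at hi2 ⊢
        by_cases hic : i = c
        · subst hic; simp [hst]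
        · simp [Function.update_of_ne hic, hnp2, hM.np i hi1 hi2]
    · refine hF2.trans (vs' := []) (fs' := [aLen, aPos, aNp]) ?_ (by simp) (by simp)
      constructor <;> simp +contextual
    · rw [hqb]
      simp at ht1 ht2 ⊢
      omega

end StreamRAM

namespace StreamRAM
open StreamRAM.Expr (add sub mul div mod or lt eq)

set_option linter.unusedSimpArgs false

variable {α : Type*} {w X : ℕ}

/-! ### Linked lists -/

/-- The linked list with head `h` and successor function `f` has the nodes `l`; `0` is nil. -/
def Lst (f : ℕ → ℕ) : ℕ → List ℕ → Prop
  | h, [] => h = 0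
  | h, x :: l => h = x ∧ x ≠ 0 ∧ Lst f (f x) l

theorem Lst.congr {f g : ℕ → ℕ} {h : ℕ} {l : List ℕ} (hl : Lst f h l)
    (hfg : ∀ x ∈ l, g x = f x) : Lst g h l := by
  induction l generalizing h with
  | nil => exact hl
  | cons x l ih =>
    refine ⟨hl.1, hl.2.1, ?_⟩
    rw [hfg x (by simp)]
    exact ih hl.2.2 fun y hy => hfg y (by simp [hy])

/-- The default `x` of `getLastD` plays the role of the head sentinel: with `D` empty, the pointer
to follow is that of `x` itself. -/
theorem Lst.tail {f : ℕ → ℕ} {x : ℕ} {D I : List ℕ} (hl : Lst f (f x) (D ++ I)) :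
    Lst f (f (D.getLastD x)) I := by
  induction D generalizing x with
  | nil => simpa using hl
  | cons y D ih =>
    rw [List.getLastD_cons]
    exact ih hl.2.2

theorem getLastD_mem (x : ℕ) (l : List ℕ) : l.getLastD x ∈ x :: l := by
  induction l generalizing x with
  | nil => simp
  | cons y l ih => rw [List.getLastD_cons]; exact List.mem_cons_of_mem _ (ih y)

/-- The two updates are the two assignments of a list insertion behind the last node of `D`, or
behind the sentinel `x`. Distinctness of the nodes guarantees that no other link is touched. -/
theorem Lst.insert {f : ℕ → ℕ} {x n : ℕ} {D I : List ℕ} (hl : Lst f (f x) (D ++ I))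
    (hn : n ≠ 0) (hnd : (n :: x :: (D ++ I)).Nodup) {g : ℕ → ℕ}
    (hg : g = Function.update (Function.update f n (f (D.getLastD x))) (D.getLastD x) n) :
    Lst g (g x) (D ++ n :: I) := by
  induction D generalizing x with
  | nil =>
    simp only [List.nil_append, List.getLastD_nil, List.nodup_cons, List.mem_cons, not_or] at *
    subst hg
    refine ⟨by simp, hn, ?_⟩
    rw [Function.update_of_ne hnd.1.1, Function.update_self]
    refine hl.congr fun y hy => ?_
    rw [Function.update_of_ne, Function.update_of_ne]
    · rintro rfl; exact hnd.1.2 hy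
    · rintro rfl; exact hnd.2.1 hy
  | cons y D ih =>
    rw [List.getLastD_cons] at hg
    have hm := getLastD_mem y D
    simp only [List.cons_append, List.nodup_cons, List.mem_cons, List.mem_append, not_or] at hnd hm
    have h1 : g x = f x := by
      rw [hg, Function.update_of_ne, Function.update_of_ne]
      · exact fun h => hnd.1.1 h.symm
      · intro h
        rw [← h] at hm
        rcases hm with hm | hm
        · exact hnd.2.1.1 hm
        · exact hnd.2.1.2.1 hm
    refine ⟨h1.trans hl.1, hl.2.1, ih hl.2.2 ?_ hg⟩
    simp only [List.nodup_cons, List.mem_cons, List.mem_append, not_or]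
    exact ⟨hnd.1.2, hnd.2.2⟩

/-! ### Appending a chain of positions -/

/-- Space is assumed for the contents after the whole chain has been appended; by monotonicity of
`qbits` this suffices for each single step. The hypothesis on sorted positions likewise passes to
every initial part. -/
theorem drainLoop_wp [LinearOrder α] (h0 : 1 < w) (hX : 64 + 16 * X ≤ 2 ^ w) (r : List ℕ) :
    ∀ {H : HS α} {cs P}, MInv w H cs P → 1 ≤ H.v xC → H.v xC ≤ H.v xD → H.v xD < X →
      Lst (H.a aDn) (H.v xX) r → (∀ x ∈ r, x < X ∧ H.v xBase + x + 1 < 2 ^ w) →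
      (0 :: (P (H.v xC) ++ r.map (H.v xBase + ·))).Pairwise (· < ·) →
      (P (H.v xC)).length + r.length < 2 ^ w →
      cells w (H.v xD) (fun i => qbits (Function.update P (H.v xC)
        (P (H.v xC) ++ r.map (H.v xBase + ·)) i)) < X →
      (Stmt.whl (.v xX) (blk [
        .asg xP (add (.v xBase) (.v xX)),
        appendPos,
        .asg xX (.a aDn (.v xX))])).wp w X (fun H' => (∃ cs', MInv w H' cs'
          (Function.update P (H.v xC) (P (H.v xC) ++ r.map (H.v xBase + ·)))) ∧
        Frame [xNc, xY, xZ, xX, xP] [aQtail, aQw, aLen, aPos, aNp, aData, aLink] H H' ∧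
        H'.tm + 20 * (qbits (P (H.v xC))).length ≤
          H.tm + 20 * (qbits (P (H.v xC) ++ r.map (H.v xBase + ·))).length +
            20 * r.length + 1) H := by
  induction r with
  | nil =>
    intro H cs P hM h1 h2 hd hx hr hs hl hc
    refine Stmt.wp_whl (by simp) (fun hv => absurd hx hv) (fun hv => ⟨⟨cs, ?_⟩, ?_, ?_⟩)
    · simp only [List.map_nil, List.append_nil, Function.update_eq_self_iff.2]
      exact hM.congr rfl rfl fun _ _ _ => rfl
    · constructor <;> simp
    · simp; omega
  | cons x r ih =>
    intro H cs P hM h1 h2 hd hx hr hs hl hc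
    have hx1 : H.v xX = x := hx.1
    have hrx := hr x (by simp)
    obtain ⟨c, hcd⟩ : ∃ c, c = H.v xC := ⟨_, rfl⟩
    obtain ⟨b, hb⟩ : ∃ b, b = H.v xBase := ⟨_, rfl⟩
    rw [← hcd] at h1 h2 hs hl hc ⊢
    rw [← hb] at hs hc hrx ⊢
    simp only [← hb] at hr
    rw [List.map_cons] at hs hc ⊢
    refine Stmt.wp_whl (by simp) (fun hv => ?_) (fun hv => absurd (hx1.symm.trans hv) hx.2.1)
    simp only [blk, Stmt.wp_seq]
    refine ⟨by simp [hx1, ← hb]; omega, ?_⟩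
    simp only [Expr.val_add, Expr.val_v, HS.tick_v, hx1, ← hb]
    have f1 : Frame [xP] [] H (H.tick.setV xP (b + x)) := by constructor <;> simp +contextual
    have m1 : MInv w (H.tick.setV xP (b + x)) cs P := hM.congr (by simp) (by simp) fun _ _ _ => rfl
    have hs' : (0 :: ((P c ++ [b + x]) ++ r.map (b + ·))).Pairwise (· < ·) := by simpa using hs
    have hle : (qbits (P c ++ [b + x])).length ≤
        (qbits (P c ++ (b + x) :: r.map (b + ·))).length := qbits_length_le ⟨r.map (b + ·), by simp⟩
    simp only [List.length_cons] at hl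
    refine Stmt.wp_mono _ (appendPos_wp h0 hX m1 (by simp; omega) (by simp; omega) (by simpa)
      ?_ ?_ ?_ ?_) ?_
    · simp [← hcd]
      refine encode_pos_le (List.Pairwise.sublist ?_ hs')
      exact (List.sublist_append_left _ _).cons_cons 0
    · simp; omega
    · simp [← hcd]; omega
    · simp [← hcd]
      refine lt_of_le_of_lt ?_ hc
      rw [qbits_update, qbits_update]
      exact cells_update_mono hle
    rintro H1 ⟨⟨cs1, hM1⟩, hF1, ht1⟩
    simp [← hcd] at hM1 ht1
    replace hF1 := f1.trans hF1 (vs'' := [xNc, xY, xZ, xP])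
      (fs'' := [aQtail, aQw, aLen, aPos, aNp, aData, aLink]) (by simp) (by simp)
    have hC1 := hF1.v xC (by simp)
    have hD1 := hF1.v xD (by simp)
    have hX1 := hF1.v xX (by simp)
    have hB1 := hF1.v xBase (by simp)
    have hdn1 := hF1.a aDn (by simp)
    refine ⟨by simp [hX1, hx1]; omega, ?_⟩
    simp only [Expr.val_a, Expr.val_v, hX1, hx1, hdn1]
    have f2 : Frame [xX] [] H1 (H1.setV xX (H.a aDn x)) := by constructor <;> simp +contextual
    have m2 : MInv w (H1.setV xX (H.a aDn x)) cs1 _ := hM1.congr (by simp) (by simp) fun _ _ _ => rfl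
    refine Stmt.wp_mono _ (ih m2 ?_ ?_ ?_ ?_ ?_ ?_ ?_ ?_) ?_
    · simpa [hC1, ← hcd]
    · simpa [hC1, ← hcd, hD1]
    · simpa [hD1]
    · simpa [hdn1] using hx.2.2
    · intro y hy
      simpa [hB1, ← hb] using hr y (by simp [hy])
    · simpa [hC1, ← hcd, hB1, ← hb] using hs
    · simp [hC1, ← hcd]; omega
    · simpa [hC1, ← hcd, hB1, ← hb, hD1] using hc
    rintro H2 ⟨hM2, hF2, ht2⟩
    simp only [HS.setV_v, Nat.reduceEqDiff, if_false, hC1, ← hcd, hB1, ← hb, Function.update_self,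
      Function.update_idem, List.append_assoc, List.singleton_append] at hM2 ht2
    refine ⟨hM2, (hF1.trans f2 (vs'' := [xNc, xY, xZ, xX, xP])
      (fs'' := [aQtail, aQw, aLen, aPos, aNp, aData, aLink]) (by simp) (by simp)).trans hF2
      (by simp) (by simp), ?_⟩
    simp only [HS.setV_tm, List.length_cons] at ht2 ⊢
    omega

/-! ### The main list -/

/-- The main nodes `1, …, d` have the distinct keys `mk` in `U`, and the positions `P`, which are
among the first ones of the positions `F` of their keys. -/
structure MainInv (w : ℕ) (U : Finset α) (F : α → List ℕ) (H : HS α) (cs : ℕ → ℕ → ℕ)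
    (P : ℕ → List ℕ) (mk : ℕ → α) : Prop where
  m : MInv w H cs P
  key : ∀ i, 1 ≤ i → i ≤ H.v xD → H.e (2 * i + 1) = some (mk i)
  mem : ∀ i, 1 ≤ i → i ≤ H.v xD → mk i ∈ U
  pre : ∀ i, 1 ≤ i → i ≤ H.v xD → P i <+: F (mk i)
  inj : ∀ i, 1 ≤ i → i ≤ H.v xD → ∀ j, 1 ≤ j → j ≤ H.v xD → mk i = mk j → i = j

theorem MainInv.congr {U : Finset α} {F : α → List ℕ} {H H' : HS α} {cs : ℕ → ℕ → ℕ}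
    {P : ℕ → List ℕ} {mk : ℕ → α} (h : MainInv w U F H cs P mk)
    (h1 : H'.v xD = H.v xD) (h2 : H'.v xNc = H.v xNc)
    (ha : ∀ f, 5 ≤ f → f ≤ 12 → H'.a f = H.a f)
    (he : ∀ i, H'.e (2 * i + 1) = H.e (2 * i + 1)) : MainInv w U F H' cs P mk where
  m := h.m.congr h1 h2 ha
  key := by simp only [h1, he]; exact h.key
  mem := by rw [h1]; exact h.mem
  pre := by rw [h1]; exact h.pre
  inj := by rw [h1]; exact h.inj

/-- The number of cells that suffice for the queues. -/
def room (w : ℕ) (U : Finset α) (F : α → List ℕ) : ℕ :=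
  ∑ a ∈ U, ((qbits (F a)).length / w + 1)

/-- Nodes have distinct keys, and each queue encodes an initial part of the final positions of its
key, so the cells in use inject into those reserved. -/
theorem cells_le_room {U : Finset α} {F : α → List ℕ} {d : ℕ} {P : ℕ → List ℕ} {mk : ℕ → α}
    (mem : ∀ i, 1 ≤ i → i ≤ d → mk i ∈ U) (pre : ∀ i, 1 ≤ i → i ≤ d → P i <+: F (mk i))
    (inj : ∀ i, 1 ≤ i → i ≤ d → ∀ j, 1 ≤ j → j ≤ d → mk i = mk j → i = j) :
    cells w d (fun i => qbits (P i)) ≤ room w U F := by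
  classical
  unfold cells room
  calc _ ≤ ∑ i ∈ Finset.Icc 1 d, ((qbits (F (mk i))).length / w + 1) :=
        Finset.sum_le_sum fun i hi => by
          rw [Finset.mem_Icc] at hi
          exact Nat.add_le_add_right
            (Nat.div_le_div_right (qbits_length_le (pre i hi.1 hi.2))) 1
    _ = ∑ a ∈ (Finset.Icc 1 d).image mk, ((qbits (F a)).length / w + 1) := by
        rw [Finset.sum_image]
        intro i hi j hj h
        simp only [Finset.coe_Icc, Set.mem_Icc] at hi hj
        exact inj i hi.1 hi.2 j hj.1 hj.2 h
    _ ≤ _ := by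
        refine Finset.sum_le_sum_of_subset ?_
        intro a ha
        obtain ⟨i, hi, rfl⟩ := Finset.mem_image.1 ha
        rw [Finset.mem_Icc] at hi
        exact mem i hi.1 hi.2

/-- Even an empty queue owns a cell. Hence a bound on the cells also bounds the numbers of the main
nodes. -/
theorem le_cells (d : ℕ) (Bt : ℕ → List Bool) : d ≤ cells w d Bt := by
  unfold cells
  calc d = ∑ i ∈ Finset.Icc 1 d, 1 := by simp
    _ ≤ _ := Finset.sum_le_sum fun i _ => Nat.le_add_left 1 _

/-- The positions of key `k` in a list of main nodes. -/
def lookM [DecidableEq α] (P : ℕ → List ℕ) (mk : ℕ → α) (l : List ℕ) (k : α) : List ℕ :=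
  l.flatMap fun i => if mk i = k then P i else []

/-- The indices of key `k` in a list of groups. -/
def lookB [DecidableEq α] (key : ℕ → α) (B : List (ℕ × List ℕ)) (k : α) : List ℕ :=
  B.flatMap fun g => if key g.1 = k then g.1 :: g.2 else []

theorem lookM_congr [DecidableEq α] {P P' : ℕ → List ℕ} {mk mk' : ℕ → α} {l : List ℕ} (k : α)
    (h : ∀ i ∈ l, P' i = P i ∧ mk' i = mk i) : lookM P' mk' l k = lookM P mk l k := by
  induction l with
  | nil => rfl
  | cons i l ih =>
    have h1 := h i (by simp)
    have h2 := ih fun j hj => h j (by simp [hj])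
    simp only [lookM, List.flatMap_cons] at h2 ⊢
    rw [h2, h1.1, h1.2]

theorem lookM_eq_nil [DecidableEq α] {P : ℕ → List ℕ} {mk : ℕ → α} {l : List ℕ} {k : α}
    (h : ∀ i ∈ l, mk i ≠ k) : lookM P mk l k = [] := by
  simp only [lookM, List.flatMap_eq_nil_iff]
  intro i hi
  rw [if_neg (h i hi)]

theorem lookM_append [DecidableEq α] (P : ℕ → List ℕ) (mk : ℕ → α) (l l' : List ℕ) (k : α) :
    lookM P mk (l ++ l') k = lookM P mk l k ++ lookM P mk l' k := by
  simp [lookM]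

theorem lookM_cons [DecidableEq α] (P : ℕ → List ℕ) (mk : ℕ → α) (i : ℕ) (l : List ℕ) (k : α) :
    lookM P mk (i :: l) k = (if mk i = k then P i else []) ++ lookM P mk l k := by
  simp [lookM]

theorem lookB_cons [DecidableEq α] (key : ℕ → α) (g : ℕ × List ℕ) (B : List (ℕ × List ℕ)) (k : α) :
    lookB key (g :: B) k = (if key g.1 = k then g.1 :: g.2 else []) ++ lookB key B k := by
  simp [lookB]

/-- The invariant of the merge of the list `B` of groups into the main list.  The nodes `D` are
done. -/
structure MergeInv [LinearOrder α] (w X : ℕ) (U : Finset α) (F : α → List ℕ) (key : ℕ → α)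
    (T : α → List ℕ) (H0 H : HS α) (cs : ℕ → ℕ → ℕ) (P : ℕ → List ℕ) (mk : ℕ → α) (D I : List ℕ)
    (B : List (ℕ × List ℕ)) : Prop where
  main : MainInv w U F H cs P mk
  path : Lst (H.a aMn) (H.a aMn 0) (D ++ I)
  prev : H.v xPrev = D.getLastD 0
  ids : ∀ i, i ∈ D ++ I ↔ 1 ≤ i ∧ i ≤ H.v xD
  srt : (D ++ I).Pairwise (fun i j => mk i < mk j)
  db : ∀ i ∈ D, ∀ g ∈ B, mk i < key g.1
  bl : Lst (H.a aNxt) (H.v xB) (B.map Prod.fst)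
  bc : ∀ g ∈ B, Lst (H.a aDn) (H.a aDn g.1) g.2
  bx : ∀ g ∈ B, ∀ x ∈ g.1 :: g.2, x < X ∧ H.v xBase + x + 1 < 2 ^ w
  be : ∀ g ∈ B, H.e (2 * g.1) = some (key g.1) ∧ key g.1 ∈ U
  bs : B.Pairwise (fun g g' => key g.1 < key g'.1)
  tgt : ∀ k, lookM P mk (D ++ I) k ++ (lookB key B k).map (H.v xBase + ·) = T k
  v : ∀ r, r ∉ [xD, xNc, xB, xPrev, xC, xF, xG, xX, xP, xY, xZ] → H.v r = H0.v r
  a : ∀ f, f ≤ 3 → H.a f = H0.a f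
  e : ∀ i, H.e (2 * i) = H0.e (2 * i)
  inp : H.inp = H0.inp
  out : H.out = H0.out

/-- The total length of the queues. -/
def tot (d : ℕ) (P : ℕ → List ℕ) : ℕ := ∑ i ∈ Finset.Icc 1 d, (qbits (P i)).length

theorem tot_update (d c : ℕ) (h1 : 1 ≤ c) (h2 : c ≤ d) (P : ℕ → List ℕ) (l : List ℕ) :
    tot d (Function.update P c l) + (qbits (P c)).length = tot d P + (qbits l).length := by
  have := sum_Icc_update d c h1 h2 List.length (fun i => qbits (P i)) (qbits l)
  rw [← qbits_update] at this
  exact this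

theorem nodup_of_pairwise_key [LinearOrder α] {l : List ℕ} {mk : ℕ → α}
    (h : l.Pairwise (fun i j => mk i < mk j)) : l.Nodup :=
  h.imp fun h => by rintro rfl; exact lt_irrefl _ h

/-- Insertion of a new main node. -/
theorem newMain_wp [LinearOrder α] (hX : 64 + 16 * X ≤ 2 ^ w) {U : Finset α}
    {F : α → List ℕ} (hU : room w U F < X) {key : ℕ → α} {T : α → List ℕ} {H0 H : HS α}
    {cs P mk} {D I B g} (h : MergeInv w X U F key T H0 H cs P mk D I (g :: B))
    (hc : H.v xC = H.a aMn (H.v xPrev)) (hgI : ∀ i ∈ I, key g.1 < mk i) :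
    newMain.wp w X (fun H' => ∃ cs' P' mk' c, MergeInv w X U F key T H0 H' cs' P' mk' D (c :: I)
      (g :: B) ∧ H'.v xC = c ∧ mk' c = key g.1 ∧ tot (H'.v xD) P' = tot (H.v xD) P ∧
      H'.tm ≤ H.tm + 13) H := by
  obtain ⟨d, hd⟩ : ∃ d, d = H.v xD := ⟨_, rfl⟩
  obtain ⟨nc, hnc⟩ : ∃ nc, nc = H.v xNc := ⟨_, rfl⟩
  have hbe := h.be g (by simp)
  have hbX := (h.bx g (by simp) g.1 (by simp)).1
  have hb : H.v xB = g.1 := h.bl.1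
  set P' := Function.update P (d + 1) [] with hP'
  set mk' := Function.update mk (d + 1) (key g.1) with hmk'
  set cs' := Function.update cs (d + 1) (fun _ => nc + 1) with hcs'
  have hpd : H.v xPrev ≤ d := by
    rw [h.prev]
    rcases List.mem_cons.1 (getLastD_mem 0 D) with h1 | h1
    · omega
    · rw [hd]; exact ((h.ids _).1 (List.mem_append_left _ h1)).2
  have hPo : ∀ i, i ≤ d → P' i = P i := fun i hi => Function.update_of_ne (by omega) _ _
  have hmo : ∀ i, i ≤ d → mk' i = mk i := fun i hi => Function.update_of_ne (by omega) _ _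
  have hco : ∀ i, i ≤ d → cs' i = cs i := fun i hi => Function.update_of_ne (by omega) _ _
  have hPn : P' (d + 1) = [] := Function.update_self ..
  have hmn : mk' (d + 1) = key g.1 := Function.update_self ..
  have hcn : cs' (d + 1) = fun _ => nc + 1 := Function.update_self ..
  have hne : ∀ i, 1 ≤ i → i ≤ d → mk i ≠ key g.1 := by
    intro i h1 h2 he
    rcases List.mem_append.1 ((h.ids i).2 ⟨h1, hd ▸ h2⟩) with hi | hi
    · exact (h.db i hi g (by simp)).ne he
    · exact (hgI i hi).ne' he
  have hmem : ∀ i, 1 ≤ i → i ≤ d + 1 → mk' i ∈ U := by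
    intro i h1 h2
    rcases Nat.lt_or_ge d i with h3 | h3
    · rw [show i = d + 1 by omega, hmn]; exact hbe.2
    · rw [hmo i h3]; exact h.main.mem i h1 (hd ▸ h3)
  have hpre : ∀ i, 1 ≤ i → i ≤ d + 1 → P' i <+: F (mk' i) := by
    intro i h1 h2
    rcases Nat.lt_or_ge d i with h3 | h3
    · rw [show i = d + 1 by omega, hPn]; exact List.nil_prefix
    · rw [hmo i h3, hPo i h3]; exact h.main.pre i h1 (hd ▸ h3)
  have hinj : ∀ i, 1 ≤ i → i ≤ d + 1 → ∀ j, 1 ≤ j → j ≤ d + 1 → mk' i = mk' j → i = j := by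
    intro i h1 h2 j h3 h4 he
    rcases Nat.lt_or_ge d i with h5 | h5 <;> rcases Nat.lt_or_ge d j with h6 | h6
    · omega
    · rw [show i = d + 1 by omega, hmn, hmo j h6] at he
      exact absurd he.symm (hne j h3 h6)
    · rw [show j = d + 1 by omega, hmn, hmo i h5] at he
      exact absurd he (hne i h1 h5)
    · rw [hmo i h5, hmo j h6] at he
      exact h.main.inj i h1 (hd ▸ h5) j h3 (hd ▸ h6) he
  -- The space bound is applied to the enlarged family, in which the new key has the empty list; it
  -- shows that both the new node `d + 1` and the new cell `nc + 1` are below `X`.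
  have hcell := cells_le_room (w := w) hmem hpre hinj
  have hq0 : qbits [] = [] := rfl
  have hcnt : cells w (d + 1) (fun i => qbits (P' i)) = nc + 1 := by
    unfold cells
    rw [Finset.sum_Icc_succ_top (by omega)]
    dsimp only
    rw [hPn, hq0, hnc, h.main.m.q.cnt, ← hd]
    simp only [List.length_nil, Nat.zero_div, zero_add]
    congr 1
    refine Finset.sum_congr rfl fun i hi => ?_
    rw [hPo i (Finset.mem_Icc.1 hi).2]
  have hdX : d + 1 < X := lt_of_le_of_lt (le_cells (w := w) (d + 1) (fun i => qbits (P' i)))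
    (by omega)
  have hncX : nc + 1 < X := by omega
  have htot : tot (d + 1) P' = tot d P := by
    unfold tot
    rw [Finset.sum_Icc_succ_top (by omega), hPn, hq0, List.length_nil, add_zero]
    refine Finset.sum_congr rfl fun i hi => ?_
    rw [hPo i (Finset.mem_Icc.1 hi).2]
  have hQ := h.main.m.q
  simp only [newMain, blk, Stmt.wp, Expr.ok_a, Expr.ok_v, Expr.val_a, Expr.val_v, Expr.ok_c,
    Expr.val_c, true_and, HS.setA_v, HS.setA_a, HS.setV_v, HS.setV_a, HS.setE_v, HS.setE_a,
    HS.setV_e, HS.setA_e, ← hd, hb, ← hnc,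
    Nat.reduceEqDiff, if_true, if_false, Function.update_self, Expr.ok_add, Expr.val_add,
    show g.1 + g.1 = 2 * g.1 by omega, hbe.1, show d + 1 + (d + 1) + 1 = 2 * (d + 1) + 1 by omega]
  refine ⟨by omega, by omega, by omega, by omega, by omega, key g.1, rfl, by omega, by omega,
    by omega, by omega, by omega, by omega, by omega, by omega, by omega, by omega, by omega,
    by omega, by omega, by omega, by omega, cs', P', mk', d + 1, ?_, rfl, hmn, ?_, ?_⟩
  · constructor
    · constructor
      · constructor
        · constructor <;> simp only [HS.setA_v, HS.setA_a, HS.setV_v, HS.setV_a, HS.setE_v,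
            HS.setE_a, Nat.reduceEqDiff, if_true, if_false, Function.update_apply]
          · intro i h1 h2
            by_cases hi : i = d + 1
            · rw [if_pos hi, hi, hcn]
            · rw [if_neg hi, hco i (by omega), hQ.hd i h1 (by omega)]
          · intro i h1 h2
            by_cases hi : i = d + 1
            · rw [if_pos hi, hi, hcn]
            · rw [if_neg hi, hco i (by omega), hPo i (by omega), hQ.tl i h1 (by omega)]
          · intro i h1 h2
            by_cases hi : i = d + 1
            · rw [if_pos hi, hi, hPn, hq0]; simp
            · rw [if_neg hi, hPo i (by omega), hQ.qw i h1 (by omega)]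
          · intro i h1 h2 j hj
            by_cases hi : i = d + 1
            · rw [hi, hPn, hq0] at hj; simp at hj
            · rw [hPo i (by omega)] at hj
              rw [hco i (by omega), hQ.lk i h1 (by omega) j hj]
          · intro i h1 h2 j hj k hk
            by_cases hi : i = d + 1
            · rw [hi, hcn, if_pos rfl, hPn, hq0]; simp
            · rw [hPo i (by omega)] at hj ⊢
              have := hQ.rng i h1 (by omega) j hj
              rw [hco i (by omega), if_neg (by omega), hQ.bit i h1 (by omega) j hj k hk]
          · intro i h1 h2 j hj
            by_cases hi : i = d + 1
            · rw [hi, hcn]; simp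
            · rw [hPo i (by omega)] at hj
              have := hQ.rng i h1 (by omega) j hj
              rw [hco i (by omega)]; omega
          · intro i h1 h2 j hj i' h1' h2' j' hj' he
            by_cases hi : i = d + 1 <;> by_cases hi' : i' = d + 1
            · rw [hi, hPn, hq0, List.length_nil, Nat.zero_div] at hj
              rw [hi', hPn, hq0, List.length_nil, Nat.zero_div] at hj'
              omega
            · rw [hPo i' (by omega)] at hj'
              have := hQ.rng i' h1' (by omega) j' hj'
              rw [hi, hcn, hco i' (by omega)] at he
              dsimp only at he
              omega
            · rw [hPo i (by omega)] at hj
              have := hQ.rng i h1 (by omega) j hj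
              rw [hi', hcn, hco i (by omega)] at he
              dsimp only at he
              omega
            · rw [hPo i (by omega)] at hj
              rw [hPo i' (by omega)] at hj'
              rw [hco i (by omega), hco i' (by omega)] at he
              exact hQ.inj i h1 (by omega) j hj i' h1' (by omega) j' hj' he
          · exact hcnt.symm
        · simp only [HS.setA_v, HS.setA_a, HS.setV_v, HS.setV_a, HS.setE_v,
            HS.setE_a, Nat.reduceEqDiff, if_true, if_false, Function.update_apply]
          intro i h1 h2
          by_cases hi : i = d + 1
          · rw [if_pos hi, hi, hPn]; rfl
          · rw [if_neg hi, hPo i (by omega), h.main.m.len i h1 (by omega)]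
        · simp only [HS.setA_v, HS.setA_a, HS.setV_v, HS.setV_a, HS.setE_v,
            HS.setE_a, Nat.reduceEqDiff, if_true, if_false, Function.update_apply]
          intro i h1 h2
          by_cases hi : i = d + 1
          · rw [if_pos hi, hi, hPn]; rfl
          · rw [if_neg hi, hPo i (by omega), h.main.m.pos i h1 (by omega)]
        · simp only [HS.setA_v, HS.setA_a, HS.setV_v, HS.setV_a, HS.setE_v,
            HS.setE_a, Nat.reduceEqDiff, if_true, if_false, Function.update_apply]
          intro i h1 h2
          by_cases hi : i = d + 1
          · rw [if_pos hi, hi, hPn]; rfl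
          · rw [if_neg hi, hPo i (by omega), h.main.m.np i h1 (by omega)]
      · intro i h1 h2
        simp at h2 ⊢
        by_cases hi : i = d + 1
        · rw [hi, Function.update_self, hmn]
        · rw [Function.update_of_ne (by omega), hmo i (by omega), h.main.key i h1 (by omega)]
      · simpa using hmem
      · simpa using hpre
      · simpa using hinj
    · simp
      -- The sentinel `0` is not a node, and `d + 1` is fresh, because the nodes of the list are
      -- exactly `1, …, d`.
      refine Lst.insert h.path (by omega) ?_ (by rw [← h.prev, hc])
      have hnd := nodup_of_pairwise_key h.srt
      refine List.nodup_cons.2 ⟨?_, List.nodup_cons.2 ⟨fun h0 => ?_, hnd⟩⟩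
      · intro hm
        rcases List.mem_cons.1 hm with hm | hm
        · omega
        · have := ((h.ids _).1 hm).2; omega
      · have := ((h.ids _).1 h0).1; omega
    · simpa using h.prev
    · intro i
      have := h.ids i
      simp only [List.mem_append, List.mem_cons] at this ⊢
      simp only [HS.setA_v, HS.setV_v, HS.setE_v, Nat.reduceEqDiff, if_true, if_false]
      rw [show (i ∈ D ∨ i = d + 1 ∨ i ∈ I) ↔ (i = d + 1 ∨ (i ∈ D ∨ i ∈ I)) by tauto, this, ← hd]
      omega
    · have hs := h.srt
      have hlt : ∀ i ∈ D ++ I, mk' i = mk i := fun i hi => hmo i (by rw [hd]; exact ((h.ids i).1 hi).2)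
      rw [List.pairwise_append] at hs ⊢
      refine ⟨hs.1.imp_of_mem fun {a b} ha hb hab => ?_, List.pairwise_cons.2 ⟨fun i hi => ?_,
        hs.2.1.imp_of_mem fun {a b} ha hb hab => ?_⟩, fun i hi j hj => ?_⟩
      · rwa [hlt a (by simp [ha]), hlt b (by simp [hb])]
      · rw [hmn, hlt i (by simp [hi])]; exact hgI i hi
      · rwa [hlt a (by simp [ha]), hlt b (by simp [hb])]
      · rw [hlt i (by simp [hi])]
        rcases List.mem_cons.1 hj with rfl | hj
        · rw [hmn]; exact h.db i hi g (by simp)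
        · rw [hlt j (by simp [hj])]; exact hs.2.2 i hi j hj
    · intro i hi g' hg'
      rw [hmo i (by rw [hd]; exact ((h.ids i).1 (by simp [hi])).2)]
      exact h.db i hi g' hg'
    · simpa using h.bl
    · simpa using h.bc
    · simpa using h.bx
    · intro g' hg'
      have := h.be g' hg'
      simp only [HS.setA_e, HS.setV_e, HS.setE_e]
      rw [Function.update_of_ne (by omega)]
      exact this
    · exact h.bs
    · intro k
      have hlt : ∀ i ∈ D ++ I, P' i = P i ∧ mk' i = mk i := fun i hi =>
        ⟨hPo i (by rw [hd]; exact ((h.ids i).1 hi).2), hmo i (by rw [hd]; exact ((h.ids i).1 hi).2)⟩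
      have := h.tgt k
      simp only [lookM_append, lookM_cons, hPn, ite_self, List.nil_append] at this ⊢
      rw [lookM_congr k fun i hi => hlt i (by simp [hi]), lookM_congr k fun i hi => hlt i (by simp [hi])]
      simpa using this
    · intro r hr
      have := h.v r hr
      simp at hr ⊢
      simp [hr, this]
    · intro f hf
      have := h.a f hf
      simp only [HS.setA_a, HS.setV_a, HS.setE_a]
      repeat rw [if_neg (by omega)]
      exact this
    · intro i
      simp only [HS.setA_e, HS.setV_e, HS.setE_e]
      rw [Function.update_of_ne (by omega)]
      exact h.e i
    · exact h.inp
    · exact h.out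
  · simp [htot]
  · simp

theorem nodup_prefix_bound {l : List ℕ} {F : List ℕ} (h : l <+: F)
    (hF : (0 :: F).Pairwise (· < ·)) : (0 :: l).Pairwise (· < ·) :=
  hF.sublist (h.sublist.cons_cons 0)

/-- Keys increase strictly along the list, so `c` is the only node with its key and the added
positions come last among those of that key. -/
theorem lookM_update [LinearOrder α] {P : ℕ → List ℕ} {mk : ℕ → α} {l : List ℕ} {c : ℕ}
    (hs : l.Pairwise (fun i j => mk i < mk j)) (hc : c ∈ l) (Q : List ℕ) (k : α) :
    lookM (Function.update P c (P c ++ Q)) mk l k =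
      lookM P mk l k ++ (if mk c = k then Q else []) := by
  induction l with
  | nil => simp at hc
  | cons i l ih =>
    rw [List.pairwise_cons] at hs
    rw [lookM_cons, lookM_cons]
    by_cases hi : i = c
    · subst hi
      have h1 : ∀ j ∈ l, j ≠ i := by
        rintro j hj rfl
        exact lt_irrefl _ (hs.1 j hj)
      rw [Function.update_self, lookM_congr (P := P) (mk := mk) k fun j hj =>
        ⟨Function.update_of_ne (h1 j hj) _ _, rfl⟩]
      split_ifs with hk
      · rw [lookM_eq_nil fun j hj => ?_]
        · simp
        · rw [← hk]; exact (hs.1 j hj).ne'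
      · simp
    · have hc' : c ∈ l := by
        rcases List.mem_cons.1 hc with h | h
        · exact absurd h.symm hi
        · exact h
      rw [Function.update_of_ne hi, ih hs.2 hc', List.append_assoc]

theorem lookM_self [LinearOrder α] {P : ℕ → List ℕ} {mk : ℕ → α} {l : List ℕ} {c : ℕ}
    (hs : l.Pairwise (fun i j => mk i < mk j)) (hc : c ∈ l) : lookM P mk l (mk c) = P c := by
  induction l with
  | nil => simp at hc
  | cons i l ih =>
    rw [List.pairwise_cons] at hs
    rw [lookM_cons]
    rcases List.mem_cons.1 hc with rfl | hc
    · rw [if_pos rfl, lookM_eq_nil fun j hj => (hs.1 j hj).ne']; simp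
    · rw [if_neg (hs.1 c hc).ne, ih hs.2 hc]; rfl

theorem lookB_eq_nil [DecidableEq α] {key : ℕ → α} {B : List (ℕ × List ℕ)} {k : α}
    (h : ∀ g ∈ B, key g.1 ≠ k) : lookB key B k = [] := by
  simp only [lookB, List.flatMap_eq_nil_iff]
  intro i hi
  rw [if_neg (h i hi)]

/-- The number of indices in a list of groups. -/
def size (B : List (ℕ × List ℕ)) : ℕ := (B.map fun g => g.2.length + 1).sum

/-- Draining the first group into the main node with the same key. -/
theorem drain_wp [LinearOrder α] (h0 : 1 < w) (hX : 64 + 16 * X ≤ 2 ^ w) {U : Finset α}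
    {F : α → List ℕ} (hU : room w U F < X) (hF : ∀ k, (0 :: F k).Pairwise (· < ·))
    (hF' : ∀ k, (F k).length < 2 ^ w) {key : ℕ → α} {T : α → List ℕ} (hT : ∀ k, T k <+: F k)
    {H0 H : HS α} {cs P mk} {D I B c g}
    (h : MergeInv w X U F key T H0 H cs P mk D (c :: I) (g :: B)) (hc : H.v xC = c)
    (hg : mk c = key g.1) :
    (blk [drain, .asg xB (.a aNxt (.v xB))]).wp w X (fun H' => ∃ cs' P',
      MergeInv w X U F key T H0 H' cs' P' mk D (c :: I) B ∧
      H'.tm + 20 * tot (H.v xD) P ≤ H.tm + 20 * tot (H'.v xD) P' + 20 * (g.2.length + 1) + 3) H := by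
  have hcm : c ∈ D ++ c :: I := by simp
  have hc1 := (h.ids c).1 hcm
  have hb : H.v xB = g.1 := h.bl.1
  have hbX := (h.bx g (by simp) g.1 (by simp)).1
  have hdX : H.v xD < X := lt_of_le_of_lt (le_cells (w := w) _ _)
    (lt_of_le_of_lt (cells_le_room h.main.mem h.main.pre h.main.inj) hU)
  set L := (g.1 :: g.2).map (H.v xBase + ·) with hL
  -- By the invariant at this key, the positions of the node followed by those of all pending groups
  -- form the target. The first group comes first, so appending it still gives an initial part of
  -- the target, which provides order and space.
  have hTc : P c ++ L <+: T (key g.1) := by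
    have h1 := h.tgt (key g.1)
    rw [← hg, lookM_self h.srt hcm, hg, lookB_cons, if_pos rfl, List.map_append,
      ← List.append_assoc] at h1
    exact ⟨_, h1⟩
  have hFc := hTc.trans (hT _)
  have hpre : ∀ i, 1 ≤ i → i ≤ H.v xD → Function.update P c (P c ++ L) i <+: F (mk i) := by
    intro i h1 h2
    by_cases hi : i = c
    · subst hi; rw [Function.update_self, hg]; exact hFc
    · rw [Function.update_of_ne hi]; exact h.main.pre i h1 h2
  have hcells := cells_le_room (w := w) h.main.mem hpre h.main.inj
  simp only [drain, blk, Stmt.wp_seq]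
  refine ⟨by simp, ?_⟩
  simp only [Expr.val_v, hb]
  have m1 : MInv w (H.setV xX g.1) cs P := h.main.m.congr (by simp) (by simp) fun _ _ _ => rfl
  refine Stmt.wp_mono _ (drainLoop_wp h0 hX (g.1 :: g.2) m1 ?_ ?_ ?_ ?_ ?_ ?_ ?_ ?_) ?_
  · simp [hc, hc1.1]
  · simp [hc, hc1.2]
  · simpa
  · simp only [HS.setV_a, HS.setV_v, if_true]
    exact ⟨rfl, h.bl.2.1, h.bc g (by simp)⟩
  · intro x hx
    simpa using h.bx g (by simp) x hx
  · simp only [HS.setV_v, Nat.reduceEqDiff, if_false, hc, ← hL]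
    exact nodup_prefix_bound hFc (hF _)
  · have h1 := hFc.length_le
    have h2 := hF' (key g.1)
    rw [List.length_append, hL, List.length_map] at h1
    simp only [HS.setV_v, Nat.reduceEqDiff, if_false, hc]
    omega
  · simp only [HS.setV_v, Nat.reduceEqDiff, if_false, hc, ← hL]
    exact lt_of_le_of_lt hcells hU
  rintro H1 ⟨⟨cs1, hM1⟩, hF1, ht1⟩
  have f1 : Frame [xX] [] H (H.setV xX g.1) := by constructor <;> simp +contextual
  replace hF1 := f1.trans hF1 (vs'' := [xNc, xY, xZ, xX, xP])
      (fs'' := [aQtail, aQw, aLen, aPos, aNp, aData, aLink]) (by simp) (by simp)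
  simp only [HS.setV_v, Nat.reduceEqDiff, if_false, hc, ← hL] at hM1 ht1
  have hB1 := hF1.v xB (by simp)
  have hD1 := hF1.v xD (by simp)
  have hBase1 := hF1.v xBase (by simp)
  have hn1 := hF1.a aNxt (by simp)
  refine ⟨by simp [hB1, hb, hbX], cs1, _, ⟨⟨hM1.congr (by simp) (by simp) fun _ _ _ => rfl,
    ?_, ?_, ?_, ?_⟩, ?_, ?_, ?_, h.srt, ?_, ?_, ?_, ?_, ?_, ?_, ?_, ?_, ?_, ?_, ?_, ?_⟩, ?_⟩
  · simp [hD1, hF1.e]; exact h.main.key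
  · simp [hD1]; exact h.main.mem
  · simp [hD1]; exact hpre
  · simp [hD1]; exact h.main.inj
  · simpa [hF1.a aMn (by simp)] using h.path
  · simpa [hF1.v xPrev (by simp)] using h.prev
  · simpa [hD1] using h.ids
  · exact fun i hi g' hg' => h.db i hi g' (by simp [hg'])
  · simpa [hn1, hB1, hb] using h.bl.2.2
  · intro g' hg'
    simpa [hF1.a aDn (by simp)] using h.bc g' (by simp [hg'])
  · intro g' hg' x hx
    simpa [hBase1] using h.bx g' (by simp [hg']) x hx
  · intro g' hg'
    simpa [hF1.e] using h.be g' (by simp [hg'])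
  · exact h.bs.of_cons
  · intro k
    have h1 := h.tgt k
    rw [lookB_cons, List.map_append, ← List.append_assoc] at h1
    simp only [HS.setV_v, Nat.reduceEqDiff, if_false, hBase1]
    rw [lookM_update h.srt hcm, hg, ← h1]
    congr 2
    split_ifs
    · rw [hL]
    · rfl
  · intro r hr
    rw [← h.v r hr]
    simp at hr
    simp only [HS.setV_v, hr, if_false]
    exact hF1.v r (by simp [hr])
  · intro f hf
    rw [← h.a f hf]
    exact hF1.a f (by simp; omega)
  · intro i
    simpa [hF1.e] using h.e i
  · simpa [hF1.inp] using h.inp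
  · simpa [hF1.out] using h.out
  · have := tot_update (H.v xD) c hc1.1 hc1.2 P (P c ++ L)
    simp [hD1] at ht1 ⊢
    omega

/-- A round either passes a main node or uses up a group, inserting at most one node; the weight 2
of groups makes the measure `I.length + 2 * B.length` drop in both cases. A node that has just
received a group stays in `I`; it is passed later if groups remain, since their keys are larger. -/
theorem mainMerge_wp [LinearOrder α] (h0 : 1 < w) (hX : 64 + 16 * X ≤ 2 ^ w) {U : Finset α}
    {F : α → List ℕ} (hU : room w U F < X) (hF : ∀ k, (0 :: F k).Pairwise (· < ·))
    (hF' : ∀ k, (F k).length < 2 ^ w) {key : ℕ → α} {T : α → List ℕ} (hT : ∀ k, T k <+: F k)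
    {H0 : HS α} (n : ℕ) :
    ∀ {H : HS α} {cs P mk} {D I B}, MergeInv w X U F key T H0 H cs P mk D I B →
      I.length + 2 * B.length = n →
      mainMerge.wp w X (fun H' => ∃ cs' P' mk' D' I',
        MergeInv w X U F key T H0 H' cs' P' mk' D' I' [] ∧
        H'.tm + 20 * tot (H.v xD) P ≤
          H.tm + 20 * tot (H'.v xD) P' + 60 * n + 20 * size B + 1) H := by
  induction n using Nat.strong_induction_on with
  | _ n ih =>
  intro H cs P mk D I B h hn
  have hdX : H.v xD < X := lt_of_le_of_lt (le_cells (w := w) _ _)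
    (lt_of_le_of_lt (cells_le_room h.main.mem h.main.pre h.main.inj) hU)
  have hpd : H.v xPrev ≤ H.v xD := by
    rw [h.prev]
    rcases List.mem_cons.1 (getLastD_mem 0 D) with h1 | h1
    · omega
    · exact ((h.ids _).1 (List.mem_append_left _ h1)).2
  have hI : Lst (H.a aMn) (H.a aMn (H.v xPrev)) I := by rw [h.prev]; exact h.path.tail
  rcases B with _ | ⟨g, B⟩
  · refine Stmt.wp_whl (by simp) (fun hv => absurd h.bl hv) fun hv =>
      ⟨cs, P, mk, D, I, ⟨h.main.congr rfl rfl (fun _ _ _ => rfl) fun _ => rfl, h.path, h.prev, h.ids,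
        h.srt, h.db, h.bl, h.bc, h.bx, h.be, h.bs, h.tgt, h.v, h.a, h.e, h.inp, h.out⟩, ?_⟩
    simp only [HS.tick_tm, HS.tick_v]
    omega
  have hb : H.v xB = g.1 := h.bl.1
  have hbX := (h.bx g (by simp) g.1 (by simp)).1
  have hbe := h.be g (by simp)
  refine Stmt.wp_whl (by simp) (fun hv => ?_) fun hv => absurd (hb.symm.trans hv) h.bl.2.1
  simp only [blk, Stmt.wp_seq]
  refine ⟨by simp; omega, by simp; omega, ?_⟩
  -- changes of temporary variables
  have hInv : ∀ (H1 : HS α), (∀ r, r ∉ [xC, xF, xG] → H1.v r = H.v r) → H1.a = H.a → H1.e = H.e →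
      H1.inp = H.inp → H1.out = H.out → MergeInv w X U F key T H0 H1 cs P mk D I (g :: B) := by
    intro H1 hv ha he hi ho
    have hv' : ∀ r, r ∉ [xC, xF, xG] → H1.v r = H.v r := hv
    exact ⟨h.main.congr (hv _ (by simp)) (hv _ (by simp)) (fun _ _ _ => by rw [ha])
      fun _ => by rw [he], by rw [ha]; exact h.path, by rw [hv _ (by simp)]; exact h.prev,
      by rw [hv _ (by simp)]; exact h.ids, h.srt, h.db, by rw [ha, hv _ (by simp)]; exact h.bl,
      by rw [ha]; exact h.bc, by rw [hv _ (by simp)]; exact h.bx, by rw [he]; exact h.be, h.bs,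
      by rw [hv _ (by simp)]; exact h.tgt, fun r hr => by
        rw [hv r (by simp at hr ⊢; tauto)]; exact h.v r hr, by rw [ha]; exact h.a,
      by rw [he]; exact h.e, by rw [hi]; exact h.inp, by rw [ho]; exact h.out⟩
  -- the key of `g` is new, and less than the remaining ones
  have hnew : ∀ H1 : HS α, (∀ r, r ∉ [xC, xF, xG] → H1.v r = H.v r) → H1.a = H.a → H1.e = H.e →
      H1.inp = H.inp → H1.out = H.out → H1.v xC = H.a aMn (H.v xPrev) → H1.tm ≤ H.tm + 20 →
      (∀ i ∈ I, key g.1 < mk i) →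
      newMain.wp w X ((blk [drain, .asg xB (.a aNxt (.v xB))]).wp w X (mainMerge.wp w X fun H' =>
        ∃ cs' P' mk' D' I', MergeInv w X U F key T H0 H' cs' P' mk' D' I' [] ∧
        H'.tm + 20 * tot (H.v xD) P ≤
          H.tm + 20 * tot (H'.v xD) P' + 60 * n + 20 * size (g :: B) + 1)) H1 := by
    intro H1 hv ha he hi ho hc ht hg
    refine Stmt.wp_mono _ (newMain_wp hX hU (hInv H1 hv ha he hi ho)
      (by rw [hc, ha, hv _ (by simp)]) hg) ?_
    rintro H2 ⟨cs2, P2, mk2, c2, h2, hc2, hk2, ht2, htm2⟩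
    refine Stmt.wp_mono _ (drain_wp h0 hX hU hF hF' hT h2 hc2 hk2) ?_
    rintro H3 ⟨cs3, P3, h3, ht3⟩
    simp only [List.length_cons] at hn
    refine Stmt.wp_mono _ (ih _ (by simp; omega) h3 rfl) ?_
    rintro H4 ⟨cs4, P4, mk4, D4, I4, h4, ht4⟩
    refine ⟨cs4, P4, mk4, D4, I4, h4, ?_⟩
    rw [hv xD (by simp)] at ht2
    simp only [List.length_cons, size, List.map_cons, List.sum_cons] at ht4 ⊢
    omega
  have h12 : 1 < 2 ^ w := by omega
  -- At the end of the main list the defaults of `xF` and `xG` lead to the insertion of a new node;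
  -- otherwise two comparisons decide between equal, smaller and larger.
  rcases I with _ | ⟨i, I⟩
  · have hc0 : H.a aMn (H.v xPrev) = 0 := hI
    refine ⟨by simp, fun hv => absurd (by simpa using hc0) hv, fun _ => ⟨by simp, fun _ => ?_,
      fun hv => absurd hv (by simp)⟩⟩
    refine ⟨by simp, by simp, fun hv => absurd (by simpa using hc0) hv, fun _ => ?_⟩
    refine ⟨by simp, fun hv => absurd (by simp) hv, fun _ => ?_⟩
    refine hnew _ ?_ rfl rfl rfl rfl ?_ ?_ (by simp)
    · intro r hr; simp at hr; simp [hr]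
    · simp
    · simp
  · have hc0 : H.a aMn (H.v xPrev) = i := hI.1
    have hi0 : i ≠ 0 := hI.2.1
    have hi1 := (h.ids i).1 (by simp)
    have hki := h.main.key i hi1.1 hi1.2
    refine ⟨by simp, fun _ => ?_, fun hv => absurd (by simpa using hv) (by rw [hc0]; exact hi0)⟩
    refine ⟨by simp [hb]; omega, by simp [hc0]; omega, by simp [hb]; omega, by simp [hc0]; omega,
      key g.1, mk i, by simp [hb, ← two_mul, hbe.1], by simp [hc0, ← two_mul, hki], ?_⟩
    refine ⟨by simp, fun hv => ?_, fun hv => ?_⟩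
    · have hle : key g.1 ≤ mk i := by
        by_contra hcon
        exact hv (by simp [hcon])
      refine ⟨by simp, by simp, fun _ => ?_,
        fun hv => absurd (by simpa using hv) (by rw [hc0]; exact hi0)⟩
      refine ⟨by simp [hc0]; omega, by simp [hb]; omega, by simp [hc0]; omega, by simp [hb]; omega,
        mk i, key g.1, by simp [hc0, ← two_mul, hki], by simp [hb, ← two_mul, hbe.1], ?_⟩
      refine ⟨by simp, fun hv' => ?_, fun hv' => ?_⟩
      · have hge : mk i ≤ key g.1 := by
          by_contra hcon
          exact hv' (by simp [hcon])
        refine Stmt.wp_mono (blk [drain, .asg xB (.a aNxt (.v xB))]) (drain_wp (c := i) h0 hX hU hF hF' hT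
          (hInv _ ?_ rfl rfl rfl rfl) (by simp [hc0]) (le_antisymm hge hle)) ?_
        · intro r hr; simp at hr; simp [hr]
        rintro H3 ⟨cs3, P3, h3, ht3⟩
        simp only [List.length_cons] at hn
        refine Stmt.wp_mono _ (ih _ (by simp; omega) h3 rfl) ?_
        rintro H4 ⟨cs4, P4, mk4, D4, I4, h4, ht4⟩
        refine ⟨cs4, P4, mk4, D4, I4, h4, ?_⟩
        simp at ht3
        simp only [List.length_cons, size, List.map_cons, List.sum_cons] at ht4 ⊢
        omega
      · have hlt : key g.1 < mk i := by
          by_contra hcon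
          simp [not_lt.1 hcon] at hv'
        refine hnew _ ?_ rfl rfl rfl rfl ?_ ?_ ?_
        · intro r hr; simp at hr; simp [hr]
        · simp
        · simp
        · intro j hj
          rcases List.mem_cons.1 hj with rfl | hj
          · exact hlt
          · have hs := (List.pairwise_append.1 h.srt).2.1
            exact hlt.trans ((List.pairwise_cons.1 hs).1 j hj)
    · have hlt : mk i < key g.1 := by
        by_contra hcon
        simp [not_lt.1 hcon] at hv
      refine ⟨by simp, ?_⟩
      have h1 : ∀ H1 : HS α, (∀ r, r ∉ [xC, xF, xG, xPrev] → H1.v r = H.v r) → H1.a = H.a →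
          H1.e = H.e → H1.inp = H.inp → H1.out = H.out → H1.v xPrev = i →
          MergeInv w X U F key T H0 H1 cs P mk (D ++ [i]) I (g :: B) := by
        intro H1 hv ha he hi ho hp
        have happ : D ++ [i] ++ I = D ++ i :: I := by simp
        refine ⟨h.main.congr (hv _ (by simp)) (hv _ (by simp)) (fun _ _ _ => by rw [ha])
          fun _ => by rw [he], by rw [ha, happ]; exact h.path, by simpa using hp,
          by rw [hv _ (by simp), happ]; exact h.ids, by rw [happ]; exact h.srt, ?_,
          by rw [ha, hv _ (by simp)]; exact h.bl,
          by rw [ha]; exact h.bc, by rw [hv _ (by simp)]; exact h.bx, by rw [he]; exact h.be, h.bs,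
          by rw [hv _ (by simp), happ]; exact h.tgt, fun r hr => by
            rw [hv r (by simp at hr ⊢; tauto)]; exact h.v r hr, by rw [ha]; exact h.a,
          by rw [he]; exact h.e, by rw [hi]; exact h.inp, by rw [ho]; exact h.out⟩
        intro j hj g' hg'
        rcases List.mem_append.1 hj with hj | hj
        · exact h.db j hj g' hg'
        · rw [List.mem_singleton.1 hj]
          rcases List.mem_cons.1 hg' with rfl | hg'
          · exact hlt
          · exact hlt.trans ((List.pairwise_cons.1 h.bs).1 g' hg')
      simp only [List.length_cons] at hn
      refine Stmt.wp_mono _ (ih (I.length + 2 * (g :: B).length) (by simp; omega)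
        (h1 _ ?_ rfl rfl rfl rfl ?_) rfl) ?_
      · intro r hr; simp at hr; simp [hr]
      · simp [hc0]
      rintro H4 ⟨cs4, P4, mk4, D4, I4, h4, ht4⟩
      refine ⟨cs4, P4, mk4, D4, I4, h4, ?_⟩
      simp [size] at ht4 ⊢
      omega

end StreamRAM

/-! ### Merging two sorted lists of groups -/

namespace StreamRAM
open StreamRAM.Expr (add sub mul div mod or lt eq)

set_option linter.unusedSimpArgs false

variable {α : Type*} {w X : ℕ}

/-- The link of the last node of the first chain, which is the head `i` if nothing follows it, is
redirected to `y`. As this node lies outside the second chain, that chain stays intact. -/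
theorem Lst.concat {f : ℕ → ℕ} {i y : ℕ} {is ys : List ℕ} (h1 : Lst f (f i) is)
    (h2 : Lst f (f y) ys) (hy : y ≠ 0) (hnd : (i :: is).Nodup) (hn : is.getLastD i ∉ y :: ys) :
    Lst (Function.update f (is.getLastD i) y) (Function.update f (is.getLastD i) y i)
      (is ++ y :: ys) := by
  induction is generalizing i with
  | nil =>
    rw [List.getLastD_nil] at hn ⊢
    rw [Function.update_self]
    simp only [List.mem_cons, not_or] at hn
    refine ⟨rfl, hy, ?_⟩
    rw [Function.update_of_ne (Ne.symm hn.1)]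
    exact h2.congr fun x hx => Function.update_of_ne (by rintro rfl; exact hn.2 hx) _ _
  | cons j is ih =>
    rw [List.getLastD_cons] at hn ⊢
    have hm := getLastD_mem j is
    rw [List.nodup_cons] at hnd
    rw [Function.update_of_ne (by rintro rfl; exact hnd.1 hm)]
    exact ⟨h1.1, h1.2.1, ih h1.2.2 hnd.2 hn⟩

/-- All indices in a list of groups. -/
def nodes (L : List (ℕ × List ℕ)) : List ℕ := L.flatMap fun g => g.1 :: g.2

@[simp] theorem nodes_nil : nodes [] = [] := rfl
@[simp] theorem nodes_cons (g : ℕ × List ℕ) (L : List (ℕ × List ℕ)) :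
    nodes (g :: L) = g.1 :: g.2 ++ nodes L := by simp [nodes]
@[simp] theorem nodes_append (L L' : List (ℕ × List ℕ)) :
    nodes (L ++ L') = nodes L ++ nodes L' := by simp [nodes]

theorem mem_nodes {L : List (ℕ × List ℕ)} {g : ℕ × List ℕ} (hg : g ∈ L) {x : ℕ}
    (hx : x ∈ g.1 :: g.2) : x ∈ nodes L := List.mem_flatMap.2 ⟨g, hg, hx⟩

theorem map_fst_sublist (L : List (ℕ × List ℕ)) : (L.map Prod.fst).Sublist (nodes L) := by
  induction L with
  | nil => simp
  | cons g L ih =>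
    rw [List.map_cons, nodes_cons, List.cons_append]
    exact (ih.trans (List.sublist_append_right _ _)).cons_cons _

theorem lookB_append [DecidableEq α] (key : ℕ → α) (B B' : List (ℕ × List ℕ)) (k : α) :
    lookB key (B ++ B') k = lookB key B k ++ lookB key B' k := by
  simp [lookB]

/-- The chain of a group is represented in memory. -/
structure Grp (H : HS α) (g : ℕ × List ℕ) : Prop where
  dn : Lst (H.a aDn) (H.a aDn g.1) g.2
  ct : H.a aCt g.1 = g.2.getLastD g.1

theorem Grp.congr {H H' : HS α} {g : ℕ × List ℕ} (h : Grp H g)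
    (hd : ∀ x ∈ g.1 :: g.2, H'.a aDn x = H.a aDn x) (hc : H'.a aCt g.1 = H.a aCt g.1) :
    Grp H' g where
  dn := by
    rw [hd g.1 (by simp)]
    exact h.dn.congr fun x hx => hd x (by simp [hx])
  ct := hc.trans h.ct

/-- The invariant of the merge of the list `B` of groups into another one.  The groups `D` are
done, and the groups `A` of the other list are left. -/
structure GMergeInv [LinearOrder α] (X : ℕ) (key : ℕ → α) (T : α → List ℕ) (N : List ℕ)
    (H0 H : HS α) (D A B : List (ℕ × List ℕ)) : Prop where
  path : Lst (H.a aNxt) (H.a aNxt 0) ((D ++ A).map Prod.fst)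
  prev : H.v xPrev = (D.map Prod.fst).getLastD 0
  agrp : ∀ g ∈ D ++ A, Grp H g
  bl : Lst (H.a aNxt) (H.v xB) (B.map Prod.fst)
  bgrp : ∀ g ∈ B, Grp H g
  perm : (nodes (D ++ A) ++ nodes B).Perm N
  same : ∀ g ∈ D ++ A ++ B, ∀ x ∈ g.2, key x = key g.1
  srt : (D ++ A).Pairwise (fun g g' => key g.1 < key g'.1)
  bs : B.Pairwise (fun g g' => key g.1 < key g'.1)
  db : ∀ g ∈ D, ∀ g' ∈ B, key g.1 < key g'.1
  tgt : ∀ k, lookB key (D ++ A) k ++ lookB key B k = T k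
  v : ∀ r, r ∉ [xB, xPrev, xC, xF, xG, xT] → H.v r = H0.v r
  a : ∀ f, 3 ≤ f → H.a f = H0.a f
  a' : ∀ f x, x ∉ 0 :: N → H.a f x = H0.a f x
  e : H.e = H0.e
  inp : H.inp = H0.inp
  out : H.out = H0.out

/-- A round passes a group of `A`, inserts the first group of `B` before `A`, or appends its chain
to the first group of `A`, which stays in place; each lowers `A.length + B.length` by one. Thus the
cost depends on the numbers of groups, not of elements. -/
theorem groupMerge_wp [LinearOrder α] (hX : 64 + 16 * X ≤ 2 ^ w) {key : ℕ → α} {T : α → List ℕ}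
    {N : List ℕ} (hN : N.Nodup) (hN0 : ∀ x ∈ N, x ≠ 0 ∧ x < X) {H0 : HS α}
    (he : ∀ x ∈ N, H0.e (2 * x) = some (key x)) (n : ℕ) :
    ∀ {H : HS α} {D A B}, GMergeInv X key T N H0 H D A B → A.length + B.length = n →
      groupMerge.wp w X (fun H' => ∃ D A, GMergeInv X key T N H0 H' D A [] ∧
        H'.tm ≤ H.tm + 20 * n + 1) H := by
  induction n using Nat.strong_induction_on with
  | _ n ih =>
  intro H D A B h hn
  have hmemN : ∀ {x}, x ∈ nodes (D ++ A) ++ nodes B → x ∈ N := fun hx => h.perm.mem_iff.1 hx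
  rcases B with _ | ⟨⟨y, ys⟩, B⟩
  · refine Stmt.wp_whl (by simp) (fun hv => absurd h.bl hv) fun hv => ⟨D, A,
      ⟨h.path, h.prev, fun g hg => ⟨(h.agrp g hg).1, (h.agrp g hg).2⟩, h.bl,
        fun g hg => ⟨(h.bgrp g hg).1, (h.bgrp g hg).2⟩, h.perm, h.same, h.srt, h.bs, h.db, h.tgt,
        h.v, h.a, h.a', h.e, h.inp, h.out⟩, ?_⟩
    simp only [HS.tick_tm]
    omega
  have hb : H.v xB = y := h.bl.1
  have hy0 : y ≠ 0 := h.bl.2.1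
  have hyN : y ∈ N := hmemN (by simp)
  have hyX := (hN0 y hyN).2
  have hye : H.e (2 * y) = some (key y) := by rw [h.e]; exact he y hyN
  have hygrp := h.bgrp (y, ys) (by simp)
  have hpN : H.v xPrev ∈ 0 :: N := by
    rw [h.prev]
    rcases List.mem_cons.1 (getLastD_mem 0 (D.map Prod.fst)) with h1 | h1
    · rw [h1]; simp
    · refine List.mem_cons_of_mem _ (hmemN ?_)
      rw [nodes_append, List.append_assoc]
      exact List.mem_append_left _ ((map_fst_sublist D).subset h1)
  have hpX : H.v xPrev < X := by
    rcases List.mem_cons.1 hpN with h1 | h1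
    · omega
    · exact (hN0 _ h1).2
  have hA : Lst (H.a aNxt) (H.a aNxt (H.v xPrev)) (A.map Prod.fst) := by
    rw [h.prev]
    have := h.path
    rw [List.map_append] at this
    exact this.tail
  have h12 : 1 < 2 ^ w := by omega
  -- insertion of the first group of `B`
  have hins : ∀ H1 : HS α, (∀ r, r ∉ [xC, xF, xG, xT] → H1.v r = H.v r) → H1.a = H.a → H1.e = H.e →
      H1.inp = H.inp → H1.out = H.out → H1.v xC = H.a aNxt (H.v xPrev) → H1.v xT = H.a aNxt y →
      H1.tm ≤ H.tm + 12 → (∀ g ∈ A, key y < key g.1) →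
      (blk [.ast aNxt (.v xB) (.v xC), .ast aNxt (.v xPrev) (.v xB), .asg xPrev (.v xB),
        .asg xB (.v xT)]).wp w X (groupMerge.wp w X fun H' => ∃ D A,
          GMergeInv X key T N H0 H' D A [] ∧ H'.tm ≤ H.tm + 20 * n + 1) H1 := by
    intro H1 hv ha he1 hi ho hc ht htm hlt
    simp only [blk, Stmt.wp_seq]
    have hb1 : H1.v xB = y := by rw [hv _ (by simp), hb]
    have hp1 : H1.v xPrev = H.v xPrev := hv _ (by simp)
    refine ⟨by simp, by simp, by simp [hb1, hyX], by simp, by simp, by simp [hp1, hpX], by simp,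
      by simp, ?_⟩
    simp only [List.length_cons] at hn
    have hnd : (y :: (ys ++ (nodes D ++ (nodes A ++ nodes B)))).Nodup := by
      refine (List.Perm.nodup_iff ?_).2 hN
      -- Permutations of concatenations are compared by counting occurrences, which leaves linear
      -- arithmetic.
      refine List.Perm.trans (List.perm_iff_count.2 fun a => ?_) h.perm
      simp [List.count_cons]; omega
    have hfst : ∀ {L : List (ℕ × List ℕ)} {x}, x ∈ L.map Prod.fst → x ∈ nodes L :=
      fun hx => (map_fst_sublist _).subset hx
    have hdb : ∀ g ∈ D, key g.1 < key y := fun g hg => h.db g hg (y, ys) (by simp)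
    have hyB : ∀ g ∈ B, key y < key g.1 := (List.pairwise_cons.1 h.bs).1
    have hpne : ∀ x, x ∈ nodes A ++ nodes B → x ≠ H.v xPrev := by
      rintro x hx rfl
      rw [h.prev] at hx
      rcases List.mem_cons.1 (getLastD_mem 0 (D.map Prod.fst)) with h1 | h1
      · rw [h1] at hx
        refine (hN0 0 (hmemN ?_)).1 rfl
        simp at hx ⊢; tauto
      · have h2 := hfst h1
        simp only [List.nodup_cons, List.nodup_append] at hnd
        exact hnd.2.2.1.2.2 _ h2 _ hx rfl
    have hgrp : ∀ g, Grp H g → Grp ((((H1.setA aNxt y (H.a aNxt (H.v xPrev))).setA aNxt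
        (H.v xPrev) y).setV xPrev y).setV xB (H.a aNxt y)) g := fun g hg => by
      refine hg.congr ?_ ?_ <;> simp [ha]
    simp only [Expr.val_v, HS.setA_v, HS.setA_a, HS.setV_v, HS.setV_a, hb1, hp1, hc, ht, 
      Nat.reduceEqDiff, if_true, if_false]
    refine Stmt.wp_mono _ (ih (A.length + B.length) (by omega) (D := D ++ [(y, ys)]) (A := A)
      (B := B) ⟨?_, ?_, ?_, ?_, ?_, ?_, ?_, ?_, h.bs.of_cons, ?_, ?_, ?_, ?_, ?_, ?_, ?_, ?_⟩ rfl) ?_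
    · have hp := h.path
      rw [List.map_append] at hp
      simp only [HS.setA_a, HS.setV_a, ha, if_true, List.map_append, List.map_cons, List.map_nil,
        List.append_assoc, List.singleton_append]
      refine Lst.insert hp hy0 ?_ (by rw [← h.prev])
      rw [← List.map_append]
      have hDA : (nodes (D ++ A)).Nodup := by
        rw [nodes_append]
        exact hnd.sublist (by
          refine (List.Sublist.trans ?_ (List.sublist_append_right ys _)).cons y
          exact (List.sublist_append_left _ _).append_left _)
      refine List.nodup_cons.2 ⟨fun hm => ?_, List.nodup_cons.2 ⟨fun hm => ?_,
        hDA.sublist (map_fst_sublist _)⟩⟩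
      · rcases List.mem_cons.1 hm with hm | hm
        · exact hy0 hm
        · have := hfst hm
          simp only [nodes_append, List.mem_append] at this
          simp only [List.nodup_cons, List.mem_append, not_or] at hnd
          tauto
      · exact (hN0 0 (hmemN (List.mem_append_left _ (hfst hm)))).1 rfl
    · simp
    · intro g hg
      rw [List.append_assoc, List.mem_append, List.singleton_append, List.mem_cons] at hg
      rcases hg with hg | rfl | hg
      · exact hgrp g (h.agrp g (by simp [hg]))
      · exact hgrp _ hygrp
      · exact hgrp g (h.agrp g (by simp [hg]))
    · have h2 := h.bl.2.2
      simp only [HS.setA_a, HS.setV_a, HS.setV_v, ha, if_true]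
      refine h2.congr fun x hx => ?_
      have hx' := hfst hx
      rw [Function.update_of_ne (hpne x (by simp [hx'])), Function.update_of_ne]
      rintro rfl
      simp only [List.nodup_cons, List.mem_append, not_or] at hnd
      exact hnd.1.2.2.2 hx'
    · exact fun g hg => hgrp g (h.bgrp g (by simp [hg]))
    · refine List.Perm.trans (List.perm_iff_count.2 fun a => ?_) h.perm
      simp [List.count_cons]; omega
    · intro g hg
      refine h.same g ?_
      simp at hg ⊢; tauto
    · have hs := List.pairwise_append.1 h.srt
      rw [List.append_assoc, List.singleton_append, List.pairwise_append, List.pairwise_cons]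
      refine ⟨hs.1, ⟨hlt, hs.2.1⟩, fun g hg g' hg' => ?_⟩
      rcases List.mem_cons.1 hg' with rfl | hg'
      · exact hdb g hg
      · exact hs.2.2 g hg g' hg'
    · intro g hg g' hg'
      rcases List.mem_append.1 hg with hg | hg
      · exact h.db g hg g' (by simp [hg'])
      · rw [List.mem_singleton.1 hg]; exact hyB g' hg'
    · intro k
      have h1 := h.tgt k
      rw [← h1]
      simp only [lookB_append, lookB_cons, List.append_assoc, List.append_cancel_left_eq]
      by_cases hk : key y = k
      · rw [if_pos hk]
        have : lookB key A k = [] := lookB_eq_nil fun g hg => by rw [← hk]; exact (hlt g hg).ne'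
        rw [this]; simp [lookB]
      · simp [hk, lookB]
    · intro r hr
      rw [← h.v r hr]
      simp at hr
      simp only [HS.setV_v, HS.setA_v, hr, if_false]
      exact hv r (by simp [hr])
    · intro f hf
      rw [← h.a f hf]
      simp only [HS.setV_a, HS.setA_a, if_neg (show ¬ f = 0 by omega), ha]
    · intro f x hx
      rw [← h.a' f x hx]
      by_cases hf : f = 0
      · subst hf
        simp only [HS.setV_a, HS.setA_a, if_true, ha]
        rw [Function.update_of_ne (by rintro rfl; exact hx hpN),
          Function.update_of_ne (by rintro rfl; exact hx (by simp [hyN]))]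
      · simp only [HS.setV_a, HS.setA_a, if_neg hf, ha]
    · exact he1.trans h.e
    · exact hi.trans h.inp
    · exact ho.trans h.out
    · rintro H2 ⟨D2, A2, h2, ht2⟩
      refine ⟨D2, A2, h2, ?_⟩
      simp at ht2
      omega
  -- the first groups of `A` and `B` have the same key
  have heq : ∀ (i : ℕ) (is : List ℕ) (A' : List (ℕ × List ℕ)), A = (i, is) :: A' → key i = key y →
      ∀ H1 : HS α, (∀ r, r ∉ [xC, xF, xG, xT] → H1.v r = H.v r) → H1.a = H.a → H1.e = H.e →
      H1.inp = H.inp → H1.out = H.out → H1.v xC = i → H1.v xT = H.a aNxt y →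
      H1.tm ≤ H.tm + 12 →
      (blk [.ast aDn (.a aCt (.v xC)) (.v xB), .ast aCt (.v xC) (.a aCt (.v xB)),
        .asg xB (.v xT)]).wp w X (groupMerge.wp w X fun H' => ∃ D A,
          GMergeInv X key T N H0 H' D A [] ∧ H'.tm ≤ H.tm + 20 * n + 1) H1 := by
    intro i is A' hA' hk H1 hv ha he1 hi ho hc ht htm
    subst hA'
    have hb1 : H1.v xB = y := by rw [hv _ (by simp), hb]
    have higrp := h.agrp (i, is) (by simp)
    have hiN : i ∈ N := hmemN (by simp)
    have hiX := (hN0 i hiN).2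
    have hlN : is.getLastD i ∈ N := by
      refine hmemN ?_
      have := getLastD_mem i is
      simp only [nodes_append, nodes_cons, List.cons_append, List.mem_append, List.mem_cons] at this ⊢
      tauto
    have hlX := (hN0 _ hlN).2
    have hct : H1.a aCt i = is.getLastD i := by rw [ha]; exact higrp.ct
    have hcy : H1.a aCt y = ys.getLastD y := by rw [ha]; exact hygrp.ct
    have hnd : ((i :: is) ++ ((y :: ys) ++ (nodes D ++ (nodes A' ++ nodes B)))).Nodup := by
      refine (List.Perm.nodup_iff ?_).2 hN
      refine List.Perm.trans (List.perm_iff_count.2 fun a => ?_) h.perm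
      simp [List.count_cons]; omega
    have hnd2 := List.nodup_append.1 hnd
    have hyi : y ≠ i := by
      rintro rfl
      exact hnd2.2.2 y (by simp) y (by simp) rfl
    -- Two entries change, the last link of the chain of `i` and its tail pointer, and no node of
    -- another group is concerned.
    have hmoved : ∀ x, x ∈ (y :: ys) ++ (nodes D ++ (nodes A' ++ nodes B)) →
        x ≠ is.getLastD i ∧ x ≠ i := by
      intro x hx
      refine ⟨?_, ?_⟩
      · rintro rfl
        exact hnd2.2.2 _ (getLastD_mem i is) _ hx rfl
      · rintro rfl
        exact hnd2.2.2 x (by simp) _ hx rfl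
    obtain ⟨H2, hH2⟩ : ∃ H2, H2 = ((H1.setA aDn (is.getLastD i) y).setA aCt i
      (ys.getLastD y)).setV xB (H.a aNxt y) := ⟨_, rfl⟩
    have hgrp : ∀ g, Grp H g → (∀ x ∈ g.1 :: g.2,
        x ∈ (y :: ys) ++ (nodes D ++ (nodes A' ++ nodes B))) → Grp H2 g := by
      intro g hg hx
      refine hg.congr (fun x hx' => ?_) ?_
      · have := hmoved x (hx x hx')
        simp [hH2, ha, this.1, -List.getLastD_eq_getLast?]
      · have := hmoved g.1 (hx g.1 (by simp))
        simp [hH2, ha, this.2]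
    have hsame : ∀ g ∈ D ++ (i, is) :: A' ++ (y, ys) :: B, ∀ x ∈ g.2, key x = key g.1 := h.same
    -- The chain of `y` is appended after that of `i`, in agreement with the order in the target:
    -- indices from the old list precede those from `B`.
    have hfin : GMergeInv X key T N H0 H2 D ((i, is ++ y :: ys) :: A') B := by
      refine ⟨?_, ?_, ?_, ?_, ?_, ?_, ?_, ?_, h.bs.of_cons, ?_, ?_, ?_, ?_, ?_, ?_, ?_, ?_⟩
      · have := h.path
        simpa [hH2, ha] using this
      · rw [← h.prev, hH2]; simp [hv xPrev]
      · intro g hg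
        rw [List.mem_append, List.mem_cons] at hg
        rcases hg with hg | rfl | hg
        · refine hgrp g (h.agrp g (by simp [hg])) fun x hx => ?_
          have := mem_nodes hg hx
          simp [this]
        · constructor
          · have h1 := Lst.concat (y := y) (ys := ys) higrp.dn hygrp.dn hy0 hnd2.1 (fun hm =>
              (hmoved _ (List.mem_append_left _ hm)).1 rfl)
            simpa [hH2, ha] using h1
          · simp only [hH2, HS.setV_a, HS.setA_a, if_true, Function.update_self]
            rw [List.getLastD_eq_getLast?, List.getLastD_eq_getLast?,
              List.getLast?_append_of_ne_nil _ (by simp), List.getLast?_cons]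
            simp
        · refine hgrp g (h.agrp g (by simp [hg])) fun x hx => ?_
          have := mem_nodes hg hx
          simp [this]
      · have h2 := h.bl.2.2
        simpa [hH2, ha] using h2
      · intro g hg
        refine hgrp g (h.bgrp g (by simp [hg])) fun x hx => ?_
        have := mem_nodes hg hx
        simp [this]
      · refine List.Perm.trans (List.perm_iff_count.2 fun a => ?_) h.perm
        simp [List.count_cons]; omega
      · intro g hg
        simp only [List.append_assoc, List.cons_append, List.mem_append, List.mem_cons] at hg
        rcases hg with hg | rfl | hg
        · exact hsame g (by simp [hg])
        · intro x hx
          rcases List.mem_append.1 hx with hx | hx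
          · exact hsame (i, is) (by simp) x hx
          · rcases List.mem_cons.1 hx with rfl | hx
            · exact hk.symm
            · exact (hsame (y, ys) (by simp) x hx).trans hk.symm
        · exact hsame g (by simp; tauto)
      · have hs := h.srt
        rw [List.pairwise_append, List.pairwise_cons] at hs ⊢
        refine ⟨hs.1, ⟨hs.2.1.1, hs.2.1.2⟩, fun g hg g' hg' => ?_⟩
        rcases List.mem_cons.1 hg' with rfl | hg'
        · exact hs.2.2 g hg (i, is) (by simp)
        · exact hs.2.2 g hg g' (by simp [hg'])
      · exact fun g hg g' hg' => h.db g hg g' (by simp [hg'])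
      · intro k
        rw [← h.tgt k]
        simp only [lookB_append, lookB_cons, List.append_assoc, List.append_cancel_left_eq, hk]
        by_cases hky : key y = k
        · have hs := (List.pairwise_append.1 h.srt).2.1
          have : lookB key A' k = [] := lookB_eq_nil fun g hg => by
            rw [← hky, ← hk]; exact ((List.pairwise_cons.1 hs).1 g hg).ne'
          simp [hky, this]
        · simp [hky]
      · intro r hr
        rw [← h.v r hr, hH2]
        simp at hr
        simp only [HS.setV_v, HS.setA_v, hr, if_false]
        exact hv r (by simp [hr])
      · intro f hf
        rw [← h.a f hf, hH2]
        simp only [HS.setV_a, HS.setA_a, if_neg (show ¬ f = 1 by omega),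
          if_neg (show ¬ f = 2 by omega), ha]
      · intro f x hx
        rw [← h.a' f x hx, hH2]
        have h1 : x ≠ i := by rintro rfl; exact hx (by simp [hiN])
        have h2 : x ≠ is.getLastD i := by rintro rfl; exact hx (List.mem_cons_of_mem _ hlN)
        simp only [HS.setV_a, HS.setA_a, ha]
        rcases eq_or_ne f 1 with rfl | h3
        · rw [if_neg (by decide), if_pos rfl, Function.update_of_ne h2]
        · rcases eq_or_ne f 2 with rfl | h4
          · rw [if_pos rfl, Function.update_of_ne h1, if_neg (by decide)]
          · rw [if_neg h4, if_neg h3]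
      · rw [hH2]; exact he1.trans h.e
      · rw [hH2]; exact hi.trans h.inp
      · rw [hH2]; exact ho.trans h.out
    simp only [blk, Stmt.wp_seq]
    refine ⟨by simp [hc, hiX], by simp, by simp [hc, hct, hlX, -List.getLastD_eq_getLast?], by simp [hb1, hyX], by simp [hb1, hyX],
      by simp [hc, hiX], by simp, ?_⟩
    simp only [Expr.val_v, Expr.val_a, HS.setA_v, HS.setA_a, HS.setV_v, HS.setV_a, hb1, hc, ht, hct,
      Nat.reduceEqDiff, if_true, if_false, hcy]
    rw [← hH2]
    simp only [List.length_cons] at hn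
    refine Stmt.wp_mono _ (ih (A'.length + 1 + B.length) (by omega) hfin (by simp)) ?_
    rintro H3 ⟨D3, A3, h3, ht3⟩
    refine ⟨D3, A3, h3, ?_⟩
    rw [hH2] at ht3
    simp at ht3
    omega
  refine Stmt.wp_whl (by simp) (fun hv => ?_) fun hv => absurd (hb.symm.trans hv) hy0
  simp only [blk, Stmt.wp_seq]
  refine ⟨by simp; omega, show 1 < 2 ^ w by omega, ?_⟩
  rcases A with _ | ⟨⟨i, is⟩, A⟩
  · have hc0 : H.a aNxt (H.v xPrev) = 0 := hA
    refine ⟨by simp, fun hv => absurd (by simpa using hc0) hv, fun _ => ⟨by simp, fun _ => ?_,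
      fun hv => absurd hv (by simp)⟩⟩
    refine ⟨by simp, by simp, fun hv => absurd (by simpa using hc0) hv, fun _ => ?_⟩
    refine ⟨by simp [hb, hyX], by simp, fun hv => absurd (by simp) hv, fun _ => ?_⟩
    refine hins _ ?_ rfl rfl rfl rfl ?_ ?_ (by simp) (by simp)
    · intro r hr; simp at hr; simp [hr]
    · simp
    · simp [hb]
  · have hc0 : H.a aNxt (H.v xPrev) = i := hA.1
    have hi0 : i ≠ 0 := hA.2.1
    have hiN : i ∈ N := hmemN (by simp)
    have hiX := (hN0 i hiN).2
    have hie : H.e (2 * i) = some (key i) := by rw [h.e]; exact he i hiN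
    refine ⟨by simp, fun _ => ?_, fun hv => absurd (by simpa using hv) (by rw [hc0]; exact hi0)⟩
    refine ⟨by simp [hb]; omega, by simp [hc0]; omega, by simp [hb]; omega, by simp [hc0]; omega,
      key y, key i, by simp [hb, ← two_mul, hye], by simp [hc0, ← two_mul, hie], ?_⟩
    refine ⟨by simp, fun hv => ?_, fun hv => ?_⟩
    · have hle : key y ≤ key i := by
        by_contra hcon
        exact hv (by simp [hcon])
      refine ⟨by simp, by simp, fun _ => ?_,
        fun hv => absurd (by simpa using hv) (by rw [hc0]; exact hi0)⟩
      refine ⟨by simp [hc0]; omega, by simp [hb]; omega, by simp [hc0]; omega, by simp [hb]; omega,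
        key i, key y, by simp [hc0, ← two_mul, hie], by simp [hb, ← two_mul, hye], ?_⟩
      refine ⟨by simp [hb, hyX], by simp, fun hv' => ?_, fun hv' => ?_⟩
      · have hge : key i ≤ key y := by
          by_contra hcon
          exact hv' (by simp [hcon])
        refine heq i is A rfl (le_antisymm hge hle) _ ?_ rfl rfl rfl rfl ?_ ?_ ?_
        · intro r hr; simp at hr; simp [hr]
        · simp [hc0]
        · simp [hb]
        · simp
      · have hlt : key y < key i := by
          by_contra hcon
          simp [not_lt.1 hcon] at hv'
        refine hins _ ?_ rfl rfl rfl rfl ?_ ?_ ?_ ?_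
        · intro r hr; simp at hr; simp [hr]
        · simp
        · simp [hb]
        · simp
        · intro g hg
          rcases List.mem_cons.1 hg with rfl | hg
          · exact hlt
          · have hs := (List.pairwise_append.1 h.srt).2.1
            exact hlt.trans ((List.pairwise_cons.1 hs).1 g hg)
    · have hlt : key i < key y := by
        by_contra hcon
        simp [not_lt.1 hcon] at hv
      refine ⟨by simp, ?_⟩
      have happ : D ++ [(i, is)] ++ A = D ++ (i, is) :: A := by simp
      simp only [List.length_cons] at hn
      refine Stmt.wp_mono _ (ih (A.length + ((y, ys) :: B).length) (by simp; omega)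
        (D := D ++ [(i, is)]) (A := A) (B := (y, ys) :: B)
        ⟨by rw [happ]; exact h.path, ?_, by rw [happ]; exact fun g hg => ⟨(h.agrp g hg).1,
          (h.agrp g hg).2⟩, ?_, fun g hg => ⟨(h.bgrp g hg).1, (h.bgrp g hg).2⟩,
          by rw [happ]; exact h.perm, by rw [happ]; exact h.same, by rw [happ]; exact h.srt, h.bs, ?_,
          by rw [happ]; exact h.tgt, ?_, h.a, h.a', h.e, h.inp, h.out⟩ rfl) ?_
      · simp [hc0]
      · simpa using h.bl
      · intro g hg g' hg'
        rcases List.mem_append.1 hg with hg | hg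
        · exact h.db g hg g' hg'
        · rw [List.mem_singleton.1 hg]
          rcases List.mem_cons.1 hg' with rfl | hg'
          · exact hlt
          · exact hlt.trans ((List.pairwise_cons.1 h.bs).1 g' hg')
      · intro r hr
        rw [← h.v r hr]
        simp at hr
        simp [hr]
      · rintro H2 ⟨D2, A2, h2, ht2⟩
        refine ⟨D2, A2, h2, ?_⟩
        simp at ht2
        omega

end StreamRAM

namespace StreamRAM

open StreamRAM.Expr (add sub mul div mod or lt eq)
set_option linter.unusedSimpArgs false

variable {α : Type*} {w X : ℕ}

/-! ### Sorting a batch -/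

/-- The list of groups `L` that starts at `h` is the sorted form of the list of indices `b`. -/
structure SortedAs [LinearOrder α] (key : ℕ → α) (H : HS α) (b : List ℕ) (h : ℕ)
    (L : List (ℕ × List ℕ)) : Prop where
  lst : Lst (H.a aNxt) h (L.map Prod.fst)
  grp : ∀ g ∈ L, Grp H g
  perm : (nodes L).Perm b
  same : ∀ g ∈ L, ∀ x ∈ g.2, key x = key g.1
  srt : L.Pairwise (fun g g' => key g.1 < key g'.1)
  look : ∀ k, lookB key L k = b.filter (fun x => key x = k)

theorem SortedAs.nil [LinearOrder α] (key : ℕ → α) (H : HS α) : SortedAs key H [] 0 [] :=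
  ⟨rfl, by simp, by simp, by simp, by simp, by simp [lookB]⟩

theorem SortedAs.congr [LinearOrder α] {key : ℕ → α} {H H' : HS α} {b : List ℕ} {h : ℕ}
    {L : List (ℕ × List ℕ)} (hL : SortedAs key H b h L) (ha : ∀ f < 3, ∀ x ∈ b, H'.a f x = H.a f x) :
    SortedAs key H' b h L where
  lst := hL.lst.congr fun x hx => ha _ (by decide) x
    (hL.perm.mem_iff.1 ((map_fst_sublist L).subset hx))
  grp := fun g hg => (hL.grp g hg).congr
    (fun x hx => ha _ (by decide) x (hL.perm.mem_iff.1 (mem_nodes hg hx)))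
    (ha _ (by decide) _ (hL.perm.mem_iff.1 (mem_nodes hg (by simp))))
  perm := hL.perm
  same := hL.same
  srt := hL.srt
  look := hL.look

/-- The number of distinct keys of a list of indices. -/
def nd [DecidableEq α] (key : ℕ → α) (b : List ℕ) : ℕ := (b.map key).toFinset.card

/-- Keys are distinct between groups and constant within a group, so groups correspond to distinct
keys. This turns the running time of a merge into a quantity that depends on the blocks alone. -/
theorem SortedAs.length [LinearOrder α] {key : ℕ → α} {H : HS α} {b : List ℕ} {h : ℕ}
    {L : List (ℕ × List ℕ)} (hL : SortedAs key H b h L) : L.length = nd key b := by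
  have h1 : (L.map fun g => key g.1).Nodup := by
    rw [List.Nodup, List.pairwise_map]
    exact hL.srt.imp fun h => h.ne
  have h2 : (b.map key).toFinset = (L.map fun g => key g.1).toFinset := by
    ext k
    simp only [List.mem_toFinset, List.mem_map]
    constructor
    · rintro ⟨x, hx, rfl⟩
      obtain ⟨g, hg, hx'⟩ := List.mem_flatMap.1 (hL.perm.mem_iff.2 hx)
      refine ⟨g, hg, ?_⟩
      rcases List.mem_cons.1 hx' with rfl | hx'
      · rfl
      · exact (hL.same g hg x hx').symm
    · rintro ⟨g, hg, rfl⟩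
      exact ⟨g.1, hL.perm.mem_iff.1 (mem_nodes hg (by simp)), rfl⟩
  rw [nd, h2, List.toFinset_card_of_nodup h1, List.length_map]

/-- The list heads at slots `o, o + 1, …` represent the blocks. -/
def SlotsAt [LinearOrder α] (key : ℕ → α) (H : HS α) : ℕ → List (List ℕ) → Prop
  | _, [] => True
  | o, b :: Bs => (∃ L, SortedAs key H b (H.a aSlot o) L) ∧ SlotsAt key H (o + 1) Bs

theorem SlotsAt.congr [LinearOrder α] {key : ℕ → α} {H H' : HS α} {Bs : List (List ℕ)} {o : ℕ}
    (h : SlotsAt key H o Bs) (ha : ∀ f < 3, ∀ x ∈ Bs.flatten, H'.a f x = H.a f x)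
    (hs : ∀ i, o ≤ i → i < o + Bs.length → H'.a aSlot i = H.a aSlot i) :
    SlotsAt key H' o Bs := by
  induction Bs generalizing o with
  | nil => trivial
  | cons b Bs ih =>
    obtain ⟨⟨L, hL⟩, h2⟩ := h
    refine ⟨⟨L, ?_⟩, ih h2 (fun f hf x hx => ha f hf x (by
      rw [List.flatten_cons]; exact List.mem_append_right _ hx)) fun i h1 h3 => hs i (by omega) ?_⟩
    · rw [hs o le_rfl (by simp)]
      exact hL.congr fun f hf x hx => ha f hf x (by simp [hx])
    · rw [List.length_cons]; omega

theorem slotsAt_concat [LinearOrder α] {key : ℕ → α} {H : HS α} {Bs : List (List ℕ)} {b : List ℕ}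
    {o : ℕ} : SlotsAt key H o (Bs ++ [b]) ↔
      SlotsAt key H o Bs ∧ ∃ L, SortedAs key H b (H.a aSlot (o + Bs.length)) L := by
  induction Bs generalizing o with
  | nil => simp [SlotsAt]
  | cons c Bs ih =>
    simp only [List.cons_append, SlotsAt, ih, List.length_cons, and_assoc]
    rw [show o + 1 + Bs.length = o + (Bs.length + 1) by omega]

/-- Concatenate adjacent blocks. -/
def pairUp : List (List ℕ) → List (List ℕ)
  | a :: b :: R => (a ++ b) :: pairUp R
  | R => R

theorem flatten_pairUp : ∀ Bs, (pairUp Bs).flatten = Bs.flatten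
  | [] => rfl
  | [_] => rfl
  | a :: b :: R => by simp [pairUp, flatten_pairUp R]

theorem length_pairUp : ∀ Bs, (pairUp Bs).length = (Bs.length + 1) / 2
  | [] => rfl
  | [_] => by simp [pairUp]
  | a :: b :: R => by
    have := length_pairUp R
    simp only [pairUp, List.length_cons, this]; omega

/-- Lets a pass treat an odd number of blocks as an even one; it matches the empty list that
`sortPass` puts behind the last slot. -/
theorem pairUp_concat_nil : ∀ Bs, Bs.length % 2 = 1 → pairUp (Bs ++ [[]]) = pairUp Bs
  | [], h => by simp at h
  | [a], _ => by simp [pairUp]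
  | a :: b :: R, h => by
    simp only [List.cons_append, pairUp]
    rw [pairUp_concat_nil R (by simp only [List.length_cons] at h; omega)]

/-- The variables that sorting a batch changes. -/
def sortVars : List ℕ := [xCnt, xJ, xB, xPrev, xC, xF, xG, xT]

structure SortFrame (H0 H : HS α) : Prop where
  v : ∀ r, r ∉ sortVars → H.v r = H0.v r
  a : ∀ f, 4 ≤ f → H.a f = H0.a f
  e : H.e = H0.e
  inp : H.inp = H0.inp
  out : H.out = H0.out

/-- The merge starts with nothing done, and with the indices of each key in the order of `b ++ b'`
as target; this is the stability of the merge. -/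
theorem groupMerge_pair_wp [LinearOrder α] (hX : 64 + 16 * X ≤ 2 ^ w) {key : ℕ → α} {H : HS α}
    {b b' : List ℕ} {L L' : List (ℕ × List ℕ)} (h1 : SortedAs key H b (H.a aNxt 0) L)
    (h2 : SortedAs key H b' (H.v xB) L') (hp : H.v xPrev = 0) (hN : (b ++ b').Nodup)
    (hN0 : ∀ x ∈ b ++ b', x ≠ 0 ∧ x < X) (he : ∀ x ∈ b ++ b', H.e (2 * x) = some (key x)) :
    groupMerge.wp w X (fun H' => (∃ L, SortedAs key H' (b ++ b') (H'.a aNxt 0) L) ∧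
      (∀ r, r ∉ [xB, xPrev, xC, xF, xG, xT] → H'.v r = H.v r) ∧
      (∀ f, 3 ≤ f → H'.a f = H.a f) ∧ (∀ f x, x ∉ 0 :: (b ++ b') → H'.a f x = H.a f x) ∧
      H'.e = H.e ∧ H'.inp = H.inp ∧ H'.out = H.out ∧
      H'.tm ≤ H.tm + 20 * (nd key b + nd key b') + 1) H := by
  have hinv : GMergeInv X key (fun k => (b ++ b').filter (fun x => key x = k)) (b ++ b') H H
      [] L L' := by
    refine ⟨h1.lst, by simp [hp], h1.grp, h2.lst, h2.grp, h1.perm.append h2.perm, ?_, h1.srt,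
      h2.srt, by simp, ?_, fun _ _ => rfl, fun _ _ => rfl, fun _ _ _ => rfl, rfl, rfl, rfl⟩
    · intro g hg
      rcases List.mem_append.1 hg with hg | hg
      · exact h1.same g hg
      · exact h2.same g hg
    · intro k
      rw [List.filter_append, List.nil_append, h1.look, h2.look]
  refine Stmt.wp_mono _ (groupMerge_wp hX hN hN0 he _ hinv rfl) ?_
  rintro H' ⟨D, A, h, ht⟩
  refine ⟨⟨D ++ A, h.path, h.agrp, by simpa using h.perm, by simpa using h.same, h.srt, fun k => ?_⟩,
    h.v, h.a, h.a', h.e, h.inp, h.out, by rw [h1.length, h2.length] at ht; exact ht⟩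
  rw [← h.tgt k]; simp [lookB]

/-- Slots are overwritten in place: merged blocks `Ds` occupy the first slots and unread blocks `Rs`
start at twice their number, so writing never catches up with reading. The slack of one in the
bounds on `c` accounts for the padding block. -/
theorem sortPassLoop_wp [LinearOrder α] (hX : 64 + 16 * X ≤ 2 ^ w) {key : ℕ → α} {H0 : HS α}
    {c : ℕ} (hc : c < X) (hc0 : H0.v xCnt = c) (n : ℕ) :
    ∀ {H : HS α} {Ds Rs : List (List ℕ)}, SortFrame H0 H → H.v xCnt = c → H.v xJ = Ds.length →
      SlotsAt key H 0 Ds → SlotsAt key H (2 * Ds.length) Rs → Rs.length = 2 * n →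
      c ≤ 2 * Ds.length + Rs.length → 2 * Ds.length + Rs.length ≤ c + 1 →
      (Ds ++ Rs).flatten.Nodup → (∀ x ∈ (Ds ++ Rs).flatten, x ≠ 0 ∧ x < X) →
      (∀ x ∈ (Ds ++ Rs).flatten, H.e (2 * x) = some (key x)) →
      (Stmt.whl (lt (add (.v xJ) (.v xJ)) (.v xCnt)) (blk [
        .ast aNxt (.c 0) (.a aSlot (add (.v xJ) (.v xJ))),
        .asg xPrev (.c 0),
        .asg xB (.a aSlot (add (add (.v xJ) (.v xJ)) (.c 1))),
        groupMerge,
        .ast aSlot (.v xJ) (.a aNxt (.c 0)),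
        .asg xJ (add (.v xJ) (.c 1))])).wp w X (fun H' => SortFrame H0 H' ∧ H'.v xCnt = c ∧
          H'.v xJ = (Ds ++ pairUp Rs).length ∧ SlotsAt key H' 0 (Ds ++ pairUp Rs) ∧
          H'.tm ≤ H.tm + 20 * (Rs.map (nd key)).sum + 10 * n + 1) H := by
  induction n with
  | zero =>
    intro H Ds Rs hf hcv hj hD hR hl h1 h2 hnd hb he
    obtain rfl : Rs = [] := List.length_eq_zero_iff.1 (by omega)
    refine Stmt.wp_whl (by simp; simp at h2; omega) (fun hv => ?_) fun hv => ?_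
    · simp [hcv, hj] at hv; simp at h1; omega
    · refine ⟨⟨hf.v, hf.a, hf.e, hf.inp, hf.out⟩, hcv, by simpa [pairUp] using hj, ?_, by simp⟩
      simp only [pairUp, List.append_nil]
      exact hD.congr (fun _ _ _ _ => rfl) fun _ _ _ => rfl
  | succ n ih =>
    intro H Ds Rs hf hcv hj hD hR hl h1 h2 hnd hb he
    rcases Rs with _ | ⟨a, _ | ⟨b, R⟩⟩
    · simp at hl
    · simp at hl; omega
    simp only [List.length_cons] at hl h1 h2
    have hw0 : w ≠ 0 := by rintro rfl; simp at hX; omega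
    obtain ⟨⟨La, hLa⟩, ⟨Lb, hLb⟩, hR⟩ := hR
    refine Stmt.wp_whl (by simp; omega) (fun _ => ?_) fun hv => ?_
    swap
    · exfalso; simp [hcv, hj] at hv; omega
    have hnd' : ((a ++ b) ++ (Ds.flatten ++ R.flatten)).Nodup := by
      refine (List.Perm.nodup_iff ?_).1 hnd
      simp only [List.flatten_append, List.flatten_cons]
      refine List.perm_iff_count.2 fun x => ?_
      simp; omega
    have hnd2 := List.nodup_append.1 hnd'
    have hne : ∀ x ∈ Ds.flatten ++ R.flatten, x ∉ 0 :: (a ++ b) := by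
      intro x hx hx'
      rcases List.mem_cons.1 hx' with rfl | hx'
      · exact (hb 0 (by rw [List.mem_append] at hx; simp only [List.flatten_append, List.flatten_cons, List.mem_append]; tauto)).1 rfl
      · exact hnd2.2.2 x hx' x hx rfl
    have hab : ∀ x ∈ a ++ b, x ∈ (Ds ++ a :: b :: R).flatten := by
      intro x hx; simp at hx ⊢; tauto
    have hstep : ∀ H1 : HS α, H1.v xPrev = 0 → H1.v xJ = Ds.length →
        H1.v xB = H.a aSlot (2 * Ds.length + 1) →
        H1.a aNxt 0 = H.a aSlot (2 * Ds.length) →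
        (∀ r, r ≠ xPrev → r ≠ xB → H1.v r = H.v r) → (∀ f x, x ≠ 0 → H1.a f x = H.a f x) →
        (∀ f, f ≠ 0 → H1.a f = H.a f) → H1.e = H.e → H1.inp = H.inp → H1.out = H.out →
        H1.tm = H.tm + 4 →
        (blk [groupMerge,
        .ast aSlot (.v xJ) (.a aNxt (.c 0)),
        .asg xJ (add (.v xJ) (.c 1))]).wp w X ((Stmt.whl (lt (add (.v xJ) (.v xJ)) (.v xCnt)) (blk [
        .ast aNxt (.c 0) (.a aSlot (add (.v xJ) (.v xJ))),
        .asg xPrev (.c 0),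
        .asg xB (.a aSlot (add (add (.v xJ) (.v xJ)) (.c 1))),
        groupMerge,
        .ast aSlot (.v xJ) (.a aNxt (.c 0)),
        .asg xJ (add (.v xJ) (.c 1))])).wp w X (fun H' => SortFrame H0 H' ∧ H'.v xCnt = c ∧
          H'.v xJ = (Ds ++ pairUp (a :: b :: R)).length ∧
          SlotsAt key H' 0 (Ds ++ pairUp (a :: b :: R)) ∧
          H'.tm ≤ H.tm + 20 * ((a :: b :: R).map (nd key)).sum + 10 * (n + 1) + 1)) H1 := by
      intro H1 hp1 hj1 hb1 hn1 hv1 ha1 ha1' he1 hi1 ho1 ht1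
      simp only [blk, Stmt.wp_seq]
      have hz : ∀ x ∈ a ++ b, x ≠ 0 := fun x hx => (hb x (hab x hx)).1
      refine Stmt.wp_mono _ (groupMerge_pair_wp hX (L := La) (L' := Lb)
        (by rw [hn1]; exact hLa.congr fun f _ x hx => ha1 f x (hz x (by simp [hx])))
        (by rw [hb1]; exact hLb.congr fun f _ x hx => ha1 f x (hz x (by simp [hx])))
        hp1 hnd2.1 (fun x hx => hb x (hab x hx))
        (fun x hx => by rw [he1]; exact he x (hab x hx))) ?_
      rintro H2 ⟨⟨L, hL⟩, hv2, ha2, ha2', he2, hi2, ho2, ht2⟩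
      have hj2 : H2.v xJ = Ds.length := by rw [hv2 _ (by simp), hj1]
      have hc2 : H2.v xCnt = c := by rw [hv2 _ (by simp), hv1 _ (by simp) (by simp), hcv]
      have hs2 : H2.a aSlot = H.a aSlot := by rw [ha2 _ (by simp), ha1' _ (by simp)]
      refine ⟨by simp, by simp; omega, by simp [hj2]; omega, by simp [hj2, hw0]; omega, ?_⟩
      obtain ⟨H3, hH3⟩ : ∃ H3, H3 = (H2.setA aSlot Ds.length (H2.a aNxt 0)).setV xJ
        (Ds.length + 1) := ⟨_, rfl⟩
      simp only [Expr.val_v, Expr.val_a, Expr.val_c, Expr.val_add, HS.setA_v, hj2]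
      rw [← hH3]
      have ha3 : ∀ f < 3, H3.a f = H2.a f := fun f hf => by
        rw [hH3]; simp only [HS.setV_a, HS.setA_a, if_neg (show ¬ f = 3 by omega)]
      have hrest : ∀ f < 3, ∀ x ∈ Ds.flatten ++ R.flatten, H3.a f x = H.a f x := fun f hf x hx => by
        have h0 := hne x hx
        rw [ha3 f hf, ha2' f x h0, ha1 f x fun h => h0 (by simp [h])]
      have hs3 : ∀ i, i ≠ Ds.length → H3.a aSlot i = H.a aSlot i := fun i hi => by
        rw [hH3]; simp only [HS.setV_a, HS.setA_a, if_true]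
        rw [Function.update_of_ne hi, hs2]
      have hlen : (Ds ++ [a ++ b]).length = Ds.length + 1 := by simp
      refine Stmt.wp_mono _ (ih (Ds := Ds ++ [a ++ b]) (Rs := R) ?_ ?_ ?_ ?_ ?_ ?_ ?_ ?_ ?_ ?_ ?_) ?_
      · refine ⟨fun r hr => ?_, fun f hf4 => ?_, ?_, ?_, ?_⟩
        · simp only [sortVars, List.mem_cons, not_or] at hr
          rw [← hf.v r (by simp [sortVars, hr]), hH3]
          simp only [HS.setV_v, HS.setA_v, hr, if_false]
          rw [hv2 r (by simp [hr]), hv1 r (by simp [hr]) (by simp [hr])]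
        · rw [← hf.a f hf4, hH3]
          simp only [HS.setV_a, HS.setA_a, if_neg (show ¬ f = 3 by omega)]
          rw [ha2 f (by omega), ha1' f (by omega)]
        · rw [hH3, ← hf.e]; exact he2.trans he1
        · rw [hH3, ← hf.inp]; exact hi2.trans hi1
        · rw [hH3, ← hf.out]; exact ho2.trans ho1
      · rw [hH3]; simpa using hc2
      · rw [hH3, hlen]; simp
      · refine slotsAt_concat.2 ⟨hD.congr (fun f hf x hx => hrest f hf x (List.mem_append_left _ hx))
          fun i _ hi => hs3 i (by omega), L, ?_⟩
        have : H3.a aSlot (0 + Ds.length) = H2.a aNxt 0 := by rw [hH3]; simp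
        rw [this]
        exact hL.congr fun f hf x _ => by rw [ha3 f hf]
      · rw [hlen, show 2 * (Ds.length + 1) = 2 * Ds.length + 1 + 1 by ring]
        exact hR.congr (fun f hf x hx => hrest f hf x (List.mem_append_right _ hx))
          fun i hi _ => hs3 i (by omega)
      · omega
      · rw [hlen]; omega
      · rw [hlen]; omega
      · simpa using hnd
      · simpa using hb
      · have : H3.e = H.e := by rw [hH3]; exact he2.trans he1
        rw [this]; simpa using he
      · rintro H4 ⟨h4, h4c, h4j, h4s, h4t⟩
        refine ⟨h4, h4c, by simpa [pairUp] using h4j, by simpa [pairUp] using h4s, ?_⟩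
        rw [hH3] at h4t
        simp only [HS.setV_tm, HS.setA_tm] at h4t
        simp only [List.map_cons, List.sum_cons]
        omega
    simp only [blk, Stmt.wp_seq]
    refine ⟨by simp, by simp [hj]; omega, by simp; omega, by simp,
      by simp [hj, hw0]; omega, ?_⟩
    refine hstep _ ?_ ?_ ?_ ?_ ?_ ?_ ?_ ?_ ?_ ?_ ?_
    · simp
    · simp [hj]
    · simp [hj, two_mul]
    · simp [hj, two_mul]
    · intro r h1 h2; simp [h1, h2]
    · intro f x hx
      rcases eq_or_ne f 0 with rfl | h <;> simp [*]
    · intro f hf; simp [hf]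
    · simp
    · simp
    · simp
    · simp

theorem one_le_nd [DecidableEq α] (key : ℕ → α) {b : List ℕ} (hb : b ≠ []) : 1 ≤ nd key b := by
  obtain ⟨x, hx⟩ := List.exists_mem_of_ne_nil b hb
  exact Finset.card_pos.2 ⟨key x, by simpa using ⟨x, hx, rfl⟩⟩

theorem length_le_sum_nd [DecidableEq α] (key : ℕ → α) {Bs : List (List ℕ)}
    (h : ∀ b ∈ Bs, b ≠ []) : Bs.length ≤ (Bs.map (nd key)).sum := by
  induction Bs with
  | nil => simp
  | cons b Bs ih =>
    have h1 := one_le_nd key (h b (by simp))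
    have h2 := ih fun b hb => h b (by simp [hb])
    simp only [List.length_cons, List.map_cons, List.sum_cons]
    omega

theorem pairUp_ne_nil : ∀ {Bs : List (List ℕ)}, (∀ b ∈ Bs, b ≠ []) → ∀ b ∈ pairUp Bs, b ≠ []
  | [], h => h
  | [_], h => h
  | a :: b :: R, h => by
    intro c hc
    rcases List.mem_cons.1 hc with rfl | hc
    · simp [h a (by simp)]
    · exact pairUp_ne_nil (fun d hd => h d (by simp [hd])) c hc

theorem sortPass_wp [LinearOrder α] (hX : 64 + 16 * X ≤ 2 ^ w) {key : ℕ → α} {H : HS α}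
    {Bs : List (List ℕ)} (hc : H.v xCnt = Bs.length) (hl : 1 < Bs.length) (hlX : Bs.length < X)
    (hs : SlotsAt key H 0 Bs) (hne : ∀ b ∈ Bs, b ≠ []) (hnd : Bs.flatten.Nodup)
    (hb : ∀ x ∈ Bs.flatten, x ≠ 0 ∧ x < X)
    (he : ∀ x ∈ Bs.flatten, H.e (2 * x) = some (key x)) :
    sortPass.wp w X (fun H' => SortFrame H H' ∧ H'.v xCnt = (pairUp Bs).length ∧
      SlotsAt key H' 0 (pairUp Bs) ∧ H'.tm ≤ H.tm + 40 * (Bs.map (nd key)).sum) H := by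
  have hw0 : w ≠ 0 := by rintro rfl; simp at hX; omega
  have hsum := length_le_sum_nd key hne
  -- `Rs` is `Bs`, padded by an empty block if its length is odd. The padding has no keys and so
  -- adds nothing to the cost.
  obtain ⟨Rs, n, hRp, hRl, hRn, hRf, hRnd, hRs⟩ : ∃ Rs n, pairUp Rs = pairUp Bs ∧
      Rs.length = 2 * n ∧ (Rs.length = Bs.length ∨ Rs.length = Bs.length + 1) ∧
      Rs.flatten = Bs.flatten ∧ (Rs.map (nd key)).sum = (Bs.map (nd key)).sum ∧
      ∀ H' : HS α, SlotsAt key H' 0 Bs → H'.a aSlot Bs.length = 0 → SlotsAt key H' 0 Rs := by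
    rcases Nat.even_or_odd' Bs.length with ⟨n, hn | hn⟩
    · exact ⟨Bs, n, rfl, hn, Or.inl rfl, rfl, rfl, fun _ h _ => h⟩
    · refine ⟨Bs ++ [[]], n + 1, pairUp_concat_nil Bs (by omega), by simp; omega,
        Or.inr (by simp), by simp, by simp [nd], fun H' h h0 => slotsAt_concat.2 ⟨h, [], ?_⟩⟩
      rw [zero_add, h0]
      exact SortedAs.nil _ _
  simp only [sortPass, blk, Stmt.wp_seq]
  refine ⟨by simp, by simp, by simp [hc]; omega, by simp, ?_⟩
  obtain ⟨H1, hH1⟩ : ∃ H1, H1 = (H.setA aSlot Bs.length 0).setV xJ 0 := ⟨_, rfl⟩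
  simp only [Expr.val_v, Expr.val_c, hc]
  rw [← hH1]
  have hs1 : SlotsAt key H1 0 Rs := by
    refine hRs H1 (hs.congr (fun f hf x _ => ?_) fun i _ hi => ?_) ?_
    · rw [hH1]; simp only [HS.setV_a, HS.setA_a, if_neg (show ¬ f = 3 by omega)]
    · rw [hH1]; simp only [HS.setV_a, HS.setA_a, if_true]
      rw [Function.update_of_ne (by omega)]
    · rw [hH1]; simp
  have hc1 : H1.v xCnt = Bs.length := by rw [hH1]; simpa using hc
  refine Stmt.wp_mono _ (sortPassLoop_wp hX hlX hc n (H0 := H) (Ds := []) (Rs := Rs) ?_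
    hc1 ?_ trivial hs1 hRl ?_ ?_ ?_ ?_ ?_) ?_
  · refine ⟨fun r hr => ?_, fun f hf4 => ?_, ?_, ?_, ?_⟩
    · simp only [sortVars, List.mem_cons, not_or] at hr
      rw [hH1]
      simp only [HS.setV_v, HS.setA_v, hr, if_false]
    · rw [hH1]
      simp only [HS.setV_a, HS.setA_a, if_neg (show ¬ f = 3 by omega)]
    all_goals rw [hH1]; rfl
  · rw [hH1]; simp
  · simp; omega
  · simp; omega
  · simpa [hRf] using hnd
  · simpa [hRf] using hb
  · have : H1.e = H.e := by rw [hH1]; rfl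
    rw [this]
    simpa [hRf] using he
  · rintro H2 ⟨h2, h2c, h2j, h2s, h2t⟩
    refine ⟨by simp, ⟨fun r hr => ?_, h2.a, h2.e, h2.inp, h2.out⟩, ?_, ?_, ?_⟩
    · rw [← h2.v r hr]
      simp only [sortVars, List.mem_cons, not_or] at hr
      simp only [HS.setV_v, hr, if_false]
    · simp [h2j, hRp]
    · simp only [List.nil_append, hRp] at h2s
      exact h2s.congr (fun _ _ _ _ => rfl) fun _ _ _ => rfl
    · rw [hH1] at h2t
      simp at h2t ⊢
      omega

theorem length_pairUp_lt {Bs : List (List ℕ)} (h : 1 < Bs.length) :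
    (pairUp Bs).length < Bs.length := by
  rw [length_pairUp]; omega

/-- The number of groups that are looked at when the blocks are merged into one. -/
def sortCost [DecidableEq α] (key : ℕ → α) (Bs : List (List ℕ)) : ℕ :=
  if _h : 1 < Bs.length then (Bs.map (nd key)).sum + sortCost key (pairUp Bs) else 0
termination_by Bs.length
decreasing_by exact length_pairUp_lt _h

theorem SortFrame.trans {H H' H'' : HS α} (h : SortFrame H H') (h' : SortFrame H' H'') :
    SortFrame H H'' :=
  ⟨fun r hr => (h'.v r hr).trans (h.v r hr), fun f hf => (h'.a f hf).trans (h.a f hf),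
    h'.e.trans h.e, h'.inp.trans h.inp, h'.out.trans h.out⟩

theorem sortLoop_wp [LinearOrder α] (hX : 64 + 16 * X ≤ 2 ^ w) {key : ℕ → α} (n : ℕ) :
    ∀ {H : HS α} {Bs : List (List ℕ)}, Bs.length = n → 0 < n → n < X → H.v xCnt = n →
    SlotsAt key H 0 Bs → (∀ b ∈ Bs, b ≠ []) → Bs.flatten.Nodup →
    (∀ x ∈ Bs.flatten, x ≠ 0 ∧ x < X) → (∀ x ∈ Bs.flatten, H.e (2 * x) = some (key x)) →
    (Stmt.whl (lt (.c 1) (.v xCnt)) sortPass).wp w X (fun H' => SortFrame H H' ∧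
      (∃ L, SortedAs key H' Bs.flatten (H'.a aSlot 0) L) ∧
      H'.tm ≤ H.tm + 41 * sortCost key Bs + 1) H := by
  induction n using Nat.strong_induction_on with
  | _ n ih =>
  intro H Bs hl h0 hlX hc hs hne hnd hb he
  have hw0 : w ≠ 0 := by rintro rfl; simp at hX; omega
  refine Stmt.wp_whl (by simp [hw0]) (fun hv => ?_) fun hv => ?_
  · have h1 : 1 < Bs.length := by
      rw [hl]; by_contra hcon; simp [hc, hcon] at hv
    -- Blocks are nonempty, so the overhead per block, and here the test of the loop, is absorbed by
    -- the number of groups.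
    have hsum := length_le_sum_nd key hne
    have hlt := length_pairUp_lt h1
    refine Stmt.wp_mono _ (sortPass_wp hX (H := H.tick) (by simpa [hl] using hc) h1 (by omega)
      (hs.congr (fun _ _ _ _ => rfl) fun _ _ _ => rfl) hne hnd hb he) ?_
    rintro H1 ⟨hf1, hc1, hs1, ht1⟩
    refine Stmt.wp_mono _ (ih _ (by omega) rfl (by rw [length_pairUp]; omega) (by omega) hc1 hs1
      (pairUp_ne_nil hne) (by rwa [flatten_pairUp]) (by rwa [flatten_pairUp]) ?_) ?_
    · rw [flatten_pairUp, hf1.e]; exact he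
    · rintro H2 ⟨hf2, hL, ht2⟩
      rw [flatten_pairUp] at hL
      refine ⟨SortFrame.trans (H' := H1) ⟨hf1.v, hf1.a, hf1.e, hf1.inp, hf1.out⟩ hf2, hL, ?_⟩
      rw [sortCost, dif_pos h1]
      simp at ht1
      omega
  · have h1 : ¬ 1 < Bs.length := by
      rw [hl]; intro hcon; simp [hc, hcon] at hv
    obtain ⟨b, rfl⟩ := List.length_eq_one_iff.1 (show Bs.length = 1 by omega)
    refine ⟨⟨fun _ _ => rfl, fun _ _ => rfl, rfl, rfl, rfl⟩, ?_, by simp⟩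
    obtain ⟨⟨L, hL⟩, -⟩ := hs
    have h2 := hL.congr (H' := H.tick) fun _ _ _ _ => rfl
    exact ⟨L, by simpa using h2⟩

theorem sortBatch_wp [LinearOrder α] (hX : 64 + 16 * X ≤ 2 ^ w) {key : ℕ → α} {H : HS α}
    {Bs : List (List ℕ)} (hlX : Bs.length < X) (hc : H.v xM = Bs.length)
    (hs : SlotsAt key H 0 Bs) (hne : ∀ b ∈ Bs, b ≠ []) (hnd : Bs.flatten.Nodup)
    (hb : ∀ x ∈ Bs.flatten, x ≠ 0 ∧ x < X)
    (he : ∀ x ∈ Bs.flatten, H.e (2 * x) = some (key x)) :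
    sortBatch.wp w X (fun H' => SortFrame H H' ∧
      (∃ L, SortedAs key H' Bs.flatten (H'.a aSlot 0) L) ∧
      H'.tm ≤ H.tm + 41 * sortCost key Bs + 3) H := by
  have hw0 : w ≠ 0 := by rintro rfl; simp at hX; omega
  simp only [sortBatch, blk, Stmt.wp_seq]
  refine ⟨by simp, by simp, by simp, by simp [hc]; omega, ?_⟩
  obtain ⟨H1, hH1⟩ : ∃ H1, H1 = (H.setV xCnt Bs.length).setA aSlot Bs.length 0 := ⟨_, rfl⟩
  simp only [Expr.val_v, Expr.val_c, hc, HS.setV_v, if_true]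
  rw [← hH1]
  have hf1 : SortFrame H H1 := by
    refine ⟨fun r hr => ?_, fun f hf4 => ?_, ?_, ?_, ?_⟩
    · simp only [sortVars, List.mem_cons, not_or] at hr
      rw [hH1]
      simp only [HS.setV_v, HS.setA_v, hr, if_false]
    · rw [hH1]
      simp only [HS.setV_a, HS.setA_a, if_neg (show ¬ f = 3 by omega)]
    all_goals rw [hH1]; rfl
  have hc1 : H1.v xCnt = Bs.length := by rw [hH1]; simp
  rcases Nat.eq_zero_or_pos Bs.length with h0 | h0
  · obtain rfl := List.length_eq_zero_iff.1 h0
    refine Stmt.wp_whl (by simp [hw0]) (fun hv => absurd hv (by simp [hc1])) fun _ => ?_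
    refine ⟨⟨hf1.v, hf1.a, hf1.e, hf1.inp, hf1.out⟩, ⟨[], ?_⟩, ?_⟩
    · have : H1.tick.a aSlot 0 = 0 := by rw [hH1]; simp
      rw [this]; exact SortedAs.nil _ _
    · rw [hH1]; simp
  · have hs1 : SlotsAt key H1 0 Bs := by
      refine hs.congr (fun f hf x _ => ?_) fun i _ hi => ?_
      · rw [hH1]; simp only [HS.setV_a, HS.setA_a, if_neg (show ¬ f = 3 by omega)]
      · rw [hH1]; simp only [HS.setV_a, HS.setA_a, if_true]
        rw [Function.update_of_ne (by omega)]
    refine Stmt.wp_mono _ (sortLoop_wp hX _ rfl h0 hlX hc1 hs1 hne hnd hb (by rwa [hf1.e])) ?_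
    rintro H2 ⟨hf2, hL, ht⟩
    refine ⟨hf1.trans hf2, hL, ?_⟩
    rw [hH1] at ht
    simp at ht
    omega

end StreamRAM

namespace StreamRAM

open StreamRAM.Expr (add sub mul div mod or lt eq)
set_option linter.unusedSimpArgs false

variable {α : Type*} {w X : ℕ}

/-! ### Reading a batch -/

/-- The blocks `[1], …, [m]`. -/
def singles (m : ℕ) : List (List ℕ) := (List.range' 1 m).map fun x => [x]

theorem singles_succ (m : ℕ) : singles (m + 1) = singles m ++ [[m + 1]] := by
  simp [singles, List.range'_concat, add_comm]

theorem length_singles (m : ℕ) : (singles m).length = m := by simp [singles]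

theorem flatten_singles (m : ℕ) : (singles m).flatten = List.range' 1 m := by
  induction m with
  | zero => rfl
  | succ m ih => rw [singles_succ, List.flatten_append, ih]; simp [List.range'_concat, add_comm]

/-- The first `m` elements of a batch, which starts after the first `b` elements of `s`, have been
read. -/
structure ReadInv [LinearOrder α] (s : List α) (b : ℕ) (key : ℕ → α) (H0 H : HS α) (m : ℕ) :
    Prop where
  xm : H.v xM = m
  le : b + m ≤ s.length
  inp : H.inp = s.drop (b + m)
  slots : SlotsAt key H 0 (singles m)
  e : ∀ x, 1 ≤ x → x ≤ m → H.e (2 * x) = some (key x)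
  eo : ∀ x, H.e (2 * x + 1) = H0.e (2 * x + 1)
  v : ∀ r, r ∉ [xM, xMore, xCont] → H.v r = H0.v r
  a : ∀ f, 4 ≤ f → H.a f = H0.a f
  out : H.out = H0.out

/-- The parameter `n` counts the elements still wanted. A full batch ends with `xMore = 1` even if
the tape happens to be exhausted; in that case an empty batch follows. -/
theorem readLoop_wp [LinearOrder α] (hX : 64 + 16 * X ≤ 2 ^ w) {s : List α} {b : ℕ} {key : ℕ → α}
    (hkey : ∀ x, 1 ≤ x → b + x ≤ s.length → s[b + x - 1]? = some (key x)) {H0 : HS α} {d : ℕ}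
    (hd : H0.v xD = d) (hdX : d + 1 < X) (n : ℕ) :
    ∀ {H : HS α} {m : ℕ}, ReadInv s b key H0 H m → m + n = d + 1 →
      H.v xCont = (if n = 0 then 0 else 1) → (n = 0 → H.v xMore = 1) →
      (Stmt.whl (.v xCont) (blk [
        .rd (add (add (.v xM) (.v xM)) (.c 2)) xMore,
        .ite (.v xMore)
          (blk [
            .ast aSlot (.v xM) (add (.v xM) (.c 1)),
            .asg xM (add (.v xM) (.c 1)),
            .ast aNxt (.v xM) (.c 0),
            .ast aDn (.v xM) (.c 0),
            .ast aCt (.v xM) (.v xM),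
            .asg xCont (lt (.v xM) (add (.v xD) (.c 1)))])
          (.asg xCont (.c 0))])).wp w X (fun H' => ∃ m', ReadInv s b key H0 H' m' ∧ m' ≤ d + 1 ∧
            (H'.v xMore = 1 ∧ m' = d + 1 ∨ H'.v xMore = 0 ∧ b + m' = s.length) ∧
            H'.tm + 12 * m ≤ H.tm + 12 * m' + 12) H := by
  have hw0 : w ≠ 0 := by rintro rfl; simp at hX; omega
  induction n with
  | zero =>
    intro H m h hm hc hmore
    refine Stmt.wp_whl (by simp) (fun hv => absurd hv (by simp [hc])) fun _ => ?_
    exact ⟨m, ⟨h.xm, h.le, h.inp, h.slots.congr (fun _ _ _ _ => rfl) fun _ _ _ => rfl, h.e, h.eo,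
      h.v, h.a, h.out⟩, by omega, Or.inl ⟨hmore rfl, by omega⟩, by simp; omega⟩
  | succ n ih =>
    intro H m h hm hc _
    rw [if_neg (by omega)] at hc
    refine Stmt.wp_whl (by simp) (fun _ => ?_) fun hv => absurd hv (by simp [hc])
    simp only [blk, Stmt.wp_seq]
    refine ⟨by simp [h.xm]; omega, by simp [h.xm]; omega, fun hi => ?_, fun x l hi => ?_⟩
    · have hlen : b + m = s.length := by
        have h1 : H.inp = [] := hi
        rw [h.inp, List.drop_eq_nil_iff] at h1
        exact le_antisymm h.le h1
      refine ⟨by simp, fun hv => absurd hv (by simp), fun _ => ⟨by simp, ?_⟩⟩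
      refine Stmt.wp_whl (by simp) (fun hv => absurd hv (by simp)) fun _ => ?_
      refine ⟨m, ⟨by simp [h.xm], h.le, by simpa using h.inp,
        h.slots.congr (fun _ _ _ _ => rfl) fun _ _ _ => rfl, by simpa using h.e, by simpa using h.eo,
        fun r hr => ?_, by simpa using h.a, by simpa using h.out⟩, by omega,
        Or.inr ⟨by simp, hlen⟩, by simp; omega⟩
      rw [← h.v r hr]
      simp at hr
      simp [hr]
    · have h1 : H.inp = x :: l := hi
      rw [h.inp] at h1
      have hlt : b + m < s.length := by
        by_contra hcon
        rw [List.drop_eq_nil_of_le (by omega)] at h1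
        simp at h1
      rw [List.drop_eq_getElem_cons hlt] at h1
      obtain ⟨hx, hl⟩ := List.cons.inj h1
      have hxk : x = key (m + 1) := by
        have h2 := hkey (m + 1) (by omega) (by omega)
        rw [show b + (m + 1) - 1 = b + m by omega, List.getElem?_eq_getElem hlt, hx] at h2
        exact Option.some.inj h2
      refine ⟨by simp, fun _ => ?_, fun hv => absurd hv (by simp)⟩
      refine ⟨by simp, by simp [h.xm, hw0]; omega, by simp [h.xm]; omega, by simp [h.xm, hw0]; omega,
        by simp, by simp, by simp [h.xm]; omega, by simp, by simp, by simp [h.xm]; omega,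
        by simp, by simp, by simp [h.xm]; omega, ?_, ?_⟩
      · simp [h.xm, hw0, h.v xD (by simp), hd]; omega
      have hstep : ∀ H1 : HS α, ReadInv s b key H0 H1 (m + 1) →
          H1.v xCont = (if n = 0 then 0 else 1) → H1.v xMore = 1 → H1.tm ≤ H.tm + 12 →
          (Stmt.whl (.v xCont) (blk [
        .rd (add (add (.v xM) (.v xM)) (.c 2)) xMore,
        .ite (.v xMore)
          (blk [
            .ast aSlot (.v xM) (add (.v xM) (.c 1)),
            .asg xM (add (.v xM) (.c 1)),
            .ast aNxt (.v xM) (.c 0),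
            .ast aDn (.v xM) (.c 0),
            .ast aCt (.v xM) (.v xM),
            .asg xCont (lt (.v xM) (add (.v xD) (.c 1)))])
          (.asg xCont (.c 0))])).wp w X (fun H' => ∃ m', ReadInv s b key H0 H' m' ∧ m' ≤ d + 1 ∧
            (H'.v xMore = 1 ∧ m' = d + 1 ∨ H'.v xMore = 0 ∧ b + m' = s.length) ∧
            H'.tm + 12 * m ≤ H.tm + 12 * m' + 12) H1 := by
        intro H1 hr hc1 hm1 ht1
        refine Stmt.wp_mono _ (ih hr (by omega) hc1 fun _ => hm1) ?_
        rintro H2 ⟨m', h2, h3, h4, h5⟩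
        exact ⟨m', h2, h3, h4, by omega⟩
      refine hstep _ ?_ ?_ ?_ ?_
      · have hsl : ∀ H1 : HS α, (∀ f < 3, ∀ y, y ≠ m + 1 → H1.a f y = H.a f y) →
            (∀ y, y ≠ m → H1.a aSlot y = H.a aSlot y) → H1.a aSlot m = m + 1 →
            H1.a aNxt (m + 1) = 0 → H1.a aDn (m + 1) = 0 → H1.a aCt (m + 1) = m + 1 →
            SlotsAt key H1 0 (singles (m + 1)) := by
          intro H1 ha hs hsm hn hdn hct
          rw [singles_succ, slotsAt_concat, length_singles, zero_add, hsm]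
          refine ⟨h.slots.congr (fun f hf y hy => ha f hf y ?_) fun i _ hi => hs i ?_,
            [(m + 1, [])], ⟨⟨rfl, by simp, hn⟩, ?_, by simp, by simp, by simp, ?_⟩⟩
          · rw [flatten_singles, List.mem_range'_1] at hy; omega
          · rw [length_singles] at hi; omega
          · intro g hg
            obtain rfl := List.mem_singleton.1 hg
            exact ⟨hdn, hct⟩
          · intro k
            simp only [lookB, List.flatMap_cons, List.flatMap_nil, List.append_nil, List.filter_cons,
              List.filter_nil, decide_eq_true_eq]
        refine ⟨by simp [h.xm], by omega, ?_, hsl _ ?_ ?_ ?_ ?_ ?_ ?_, ?_, ?_, ?_, ?_, ?_⟩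
        · simp [← hl, add_assoc]
        · intro f hf y hy
          have : f = 0 ∨ f = 1 ∨ f = 2 := by omega
          rcases this with rfl | rfl | rfl <;> simp [h.xm, hy]
        · intro y hy; simp [h.xm, hy]
        · simp [h.xm]
        · simp [h.xm]
        · simp [h.xm]
        · simp [h.xm]
        · intro y h1 h2
          rcases eq_or_ne y (m + 1) with rfl | h3
          · simp [h.xm, hxk, show m + m + 2 = 2 * (m + 1) by ring]
          · have := h.e y h1 (by omega)
            simp only [HS.setV_e, HS.setA_e, HS.setE_e, HS.setI_e, Expr.val_add, Expr.val_v,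
              Expr.val_c, HS.tick_e, HS.tick_v, h.xm]
            rw [Function.update_of_ne (by omega), this]
        · intro y
          rw [← h.eo y]
          simp only [HS.setV_e, HS.setA_e, HS.setE_e, HS.setI_e, Expr.val_add, Expr.val_v,
            Expr.val_c, HS.tick_e, HS.tick_v, h.xm]
          rw [Function.update_of_ne (by omega)]
        · intro r hr
          rw [← h.v r hr]
          simp at hr
          simp [hr]
        · intro f hf
          rw [← h.a f hf]
          simp only [HS.setV_a, HS.setA_a, HS.setE_a, HS.setI_a, if_neg (show ¬ f = 0 by omega),
            if_neg (show ¬ f = 1 by omega), if_neg (show ¬ f = 2 by omega),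
            if_neg (show ¬ f = 3 by omega), HS.tick_a]
        · simpa using h.out
      · simp [h.xm, h.v xD (by simp), hd]
        split_ifs <;> omega
      · simp
      · simp

/-! ### Positions and the invariant between batches -/

/-- The positions, counted from `1`, of `k` among the first `b` elements of `s`. -/
def positions [DecidableEq α] (s : List α) (k : α) (b : ℕ) : List ℕ :=
  (List.range' 1 b).filter fun p => s[p - 1]? = some k

theorem positions_prefix [DecidableEq α] (s : List α) (k : α) {b b' : ℕ} (h : b ≤ b') :
    positions s k b <+: positions s k b' := by
  obtain ⟨m, rfl⟩ := Nat.exists_eq_add_of_le h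
  refine List.IsPrefix.filter _ ⟨List.range' (1 + b) m, ?_⟩
  simp

/-- Index `x` in a batch that starts after `b` elements stands for position `b + x`, which is beyond
all positions recorded before. -/
theorem positions_add [DecidableEq α] {s : List α} {b m : ℕ} {key : ℕ → α}
    (hkey : ∀ x, 1 ≤ x → b + x ≤ s.length → s[b + x - 1]? = some (key x))
    (hb : b + m ≤ s.length) (k : α) :
    positions s k (b + m) = positions s k b ++
      ((List.range' 1 m).filter fun x => key x = k).map (b + ·) := by
  have h1 : List.range' 1 (b + m) = List.range' 1 b ++ (List.range' 1 m).map (b + ·) := by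
    rw [List.map_add_range', add_comm b 1]; simp
  rw [positions, h1, List.filter_append, positions, List.append_cancel_left_eq, List.filter_map]
  congr 1
  refine List.filter_congr fun x hx => ?_
  rw [List.mem_range'_1] at hx
  simp only [Function.comp, hkey x hx.1 (by omega), Option.some.injEq]

theorem positions_pairwise [DecidableEq α] (s : List α) (k : α) (b : ℕ) :
    (0 :: positions s k b).Pairwise (· < ·) := by
  refine List.pairwise_cons.2 ⟨fun x hx => ?_, List.Pairwise.filter _ (List.pairwise_lt_range' (s := 1) (n := b))⟩
  have := List.mem_range'_1.1 (List.mem_of_mem_filter hx)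
  omega

theorem length_positions_le [DecidableEq α] (s : List α) (k : α) (b : ℕ) :
    (positions s k b).length ≤ b :=
  (List.length_filter_le _ _).trans (by simp)

/-- The first `b` elements of `s` are in the main list. -/
structure StreamInv [LinearOrder α] (w : ℕ) (s : List α) (b : ℕ) (H : HS α) (cs : ℕ → ℕ → ℕ)
    (P : ℕ → List ℕ) (mk : ℕ → α) (I : List ℕ) : Prop where
  main : MainInv w s.toFinset (fun k => positions s k s.length) H cs P mk
  path : Lst (H.a aMn) (H.a aMn 0) I
  ids : ∀ i, i ∈ I ↔ 1 ≤ i ∧ i ≤ H.v xD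
  srt : I.Pairwise (fun i j => mk i < mk j)
  tgt : ∀ k, lookM P mk I k = positions s k b
  base : H.v xBase = b
  le : b ≤ s.length
  inp : H.inp = s.drop b
  out : H.out = []

theorem StreamInv.length [LinearOrder α] {s : List α} {b : ℕ} {H : HS α} {cs : ℕ → ℕ → ℕ}
    {P : ℕ → List ℕ} {mk : ℕ → α} {I : List ℕ} (h : StreamInv w s b H cs P mk I) :
    I.length = H.v xD := by
  have h1 : I.toFinset = Finset.Icc 1 (H.v xD) := by
    ext i; simp [h.ids]
  rw [← List.toFinset_card_of_nodup (nodup_of_pairwise_key h.srt), h1]; simp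

theorem nodes_length (B : List (ℕ × List ℕ)) : (nodes B).length = size B := by
  simp [nodes, size, List.length_flatMap]

theorem length_le_size (B : List (ℕ × List ℕ)) : B.length ≤ size B := by
  induction B with
  | nil => simp
  | cons g B ih => simp only [size, List.map_cons, List.sum_cons, List.length_cons] at ih ⊢; omega

/-- The merge measure is at most `d + 2 m`, at 60 units each; reading adds `12 m`, and draining `20
m` besides the charge to the queues. Together these give `60 d + 152 m`. -/
theorem batch_wp [LinearOrder α] (h0 : 1 < w) (hX : 64 + 16 * X ≤ 2 ^ w) {s : List α}
    (hU : room w s.toFinset (fun k => positions s k s.length) + 2 ≤ X)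
    (hs : s.length + 1 < 2 ^ w) {b : ℕ} {key : ℕ → α}
    (hkey : ∀ x, 1 ≤ x → b + x ≤ s.length → s[b + x - 1]? = some (key x)) {H : HS α}
    {cs : ℕ → ℕ → ℕ} {P : ℕ → List ℕ} {mk : ℕ → α} {I : List ℕ}
    (h : StreamInv w s b H cs P mk I) :
    batch.wp w X (fun H' => ∃ m cs' P' mk' I', StreamInv w s (b + m) H' cs' P' mk' I' ∧
      (H'.v xMore = 1 ∧ m = H.v xD + 1 ∨ H'.v xMore = 0 ∧ b + m = s.length) ∧
      H'.tm + 20 * tot (H.v xD) P ≤ H.tm + 20 * tot (H'.v xD) P' +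
        41 * sortCost key (singles m) + 60 * H.v xD + 152 * m + 22) H := by
  have hw0 : w ≠ 0 := by omega
  have hd : H.v xD + 1 < X := by
    have h1 := cells_le_room (w := w) (F := fun k => positions s k s.length) h.main.mem h.main.pre
      h.main.inj
    have h2 := le_cells (w := w) (H.v xD) fun i => qbits (P i)
    omega
  simp only [batch, blk, Stmt.wp_seq]
  simp only [readBatch, blk, Stmt.wp_seq]
  refine ⟨by simp, by simp [hw0], ?_⟩
  have hread : ReadInv s b key H ((H.setV xM 0).setV xCont 1) 0 := by
    refine ⟨by simp, h.le, by simpa using h.inp, trivial, fun x h1 h2 => by omega, fun _ => rfl,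
      fun r hr => ?_, fun _ _ => rfl, rfl⟩
    simp at hr
    simp [hr]
  refine Stmt.wp_mono _ (readLoop_wp hX hkey rfl hd (H.v xD + 1) hread (by omega) (by simp)
    (by omega)) ?_
  rintro H1 ⟨m, h1, hm, hmore, ht1⟩
  have hfl := flatten_singles m
  refine Stmt.wp_mono _ (sortBatch_wp hX (Bs := singles m) (key := key) (by
    rw [length_singles]; omega) (by rw [length_singles]; exact h1.xm) h1.slots
    (fun c hc => by obtain ⟨x, _, rfl⟩ := List.mem_map.1 hc; simp)
    (by rw [hfl]; exact List.nodup_range') (fun x hx => by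
      rw [hfl, List.mem_range'_1] at hx; omega)
    (fun x hx => by rw [hfl, List.mem_range'_1] at hx; exact h1.e x hx.1 (by omega))) ?_
  rintro H2 ⟨h2, ⟨L, hL⟩, ht2⟩
  rw [hfl] at hL
  refine ⟨by simp; omega, by simp, ?_⟩
  obtain ⟨H3, hH3⟩ : ∃ H3, H3 = (H2.setV xB (H2.a aSlot 0)).setV xPrev 0 := ⟨_, rfl⟩
  simp only [Expr.val_a, Expr.val_c]
  rw [← hH3]
  have hv3 : ∀ r, r ∉ [xM, xMore, xCont] → r ∉ sortVars → H3.v r = H.v r := by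
    intro r hr1 hr2
    rw [← h1.v r hr1, ← h2.v r hr2, hH3]
    simp only [sortVars, List.mem_cons, not_or] at hr2
    simp only [HS.setV_v, hr2, if_false]
  have ha3 : ∀ f, 4 ≤ f → H3.a f = H.a f := by
    intro f hf
    rw [← h1.a f hf, ← h2.a f hf, hH3]; rfl
  have he3 : H3.e = H1.e := by rw [hH3]; exact h2.e
  have hin : ∀ g ∈ L, ∀ x ∈ g.1 :: g.2, 1 ≤ x ∧ x ≤ m := by
    intro g hg x hx
    have := List.mem_range'_1.1 (hL.perm.mem_iff.1 (mem_nodes hg hx))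
    omega
  have hb3 : H3.v xBase = b := by rw [hv3 _ (by simp) (by simp [sortVars]), h.base]
  have hd3 : H3.v xD = H.v xD := hv3 _ (by simp) (by simp [sortVars])
  have hle := h1.le
  have hinv : MergeInv w X s.toFinset (fun k => positions s k s.length) key
      (fun k => positions s k (b + m)) H3 H3 cs P mk [] I L := by
    refine ⟨h.main.congr hd3 (hv3 _ (by simp) (by simp [sortVars])) (fun f hf _ => ha3 f (by omega))
      (fun i => by rw [he3, h1.eo]), ?_, by simp [hH3], ?_, h.srt, by simp, ?_, ?_, ?_, ?_, hL.srt,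
      ?_, fun _ _ => rfl, fun _ _ => rfl, fun _ => rfl, rfl, rfl⟩
    · rw [ha3 _ (by simp)]; exact h.path
    · rw [hd3]; exact h.ids
    · have : H3.v xB = H2.a aSlot 0 := by rw [hH3]; simp
      rw [this, hH3]; exact hL.lst
    · intro g hg
      rw [hH3]; exact (hL.grp g hg).dn
    · intro g hg x hx
      have := hin g hg x hx
      rw [hb3]; omega
    · intro g hg
      have := hin g hg g.1 (by simp)
      rw [he3]
      refine ⟨h1.e _ this.1 this.2, ?_⟩
      rw [List.mem_toFinset]
      exact List.mem_of_getElem? (hkey g.1 this.1 (by omega))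
    · intro k
      simp only [List.nil_append]
      rw [h.tgt, hL.look, hb3, positions_add hkey hle]
  refine Stmt.wp_mono _ (mainMerge_wp h0 hX (by omega) (fun k => positions_pairwise s k _)
    (fun k => lt_of_le_of_lt (length_positions_le s k _) (by omega))
    (fun k => positions_prefix s k hle) _ hinv rfl) ?_
  rintro H4 ⟨cs', P', mk', D', I', h4, ht4⟩
  have hb4 : H4.v xBase = b := by rw [h4.v _ (by simp), hb3]
  have hm4 : H4.v xM = m := by
    rw [h4.v _ (by simp), hH3]
    simp only [HS.setV_v, if_neg (show ¬ (xM = xB) by decide), if_neg (show ¬ (xM = xPrev) by decide)]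
    rw [h2.v _ (by simp [sortVars]), h1.xm]
  have hmore4 : H4.v xMore = H1.v xMore := by
    rw [h4.v _ (by simp), hH3]
    simp only [HS.setV_v, if_neg (show ¬ (xMore = xB) by decide),
      if_neg (show ¬ (xMore = xPrev) by decide)]
    rw [h2.v _ (by simp [sortVars])]
  refine ⟨by simp [hb4, hm4]; omega, m, cs', P', mk', D' ++ I', ⟨?_, h4.path, ?_, h4.srt, ?_, ?_,
    hle, ?_, ?_⟩, ?_, ?_⟩
  · exact h4.main.congr (by simp) (by simp) (fun _ _ _ => rfl) fun _ => rfl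
  · simpa using h4.ids
  · intro k
    have := h4.tgt k
    simpa [lookB] using this
  · simp [hb4, hm4]
  · have : H3.inp = H1.inp := by rw [hH3]; exact h2.inp
    exact (h4.inp.trans this).trans h1.inp
  · have : H3.out = H1.out := by rw [hH3]; exact h2.out
    exact (h4.out.trans this).trans (h1.out.trans h.out)
  · simpa [hmore4] using hmore
  · have hsz : size L = m := by
      rw [← nodes_length, hL.perm.length_eq]; simp
    have h5 := length_le_size L
    rw [hd3, h.length] at ht4
    simp at ht1 ht4 ⊢
    rw [hH3] at ht4
    simp at ht4
    omega

end StreamRAM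

namespace StreamRAM

open StreamRAM.Expr (add sub mul div mod or lt eq)
set_option linter.unusedSimpArgs false

variable {α : Type*} {w X : ℕ}

/-! ### Writing the output -/

/-- The variables that are used to write the output. -/
def outVars : List ℕ := [xC, xCell, xR, xCur, xK, xY, xZ, xU]

/-- The queue of main node `i` is to be read from bit `t` on. -/
structure Ptr (w : ℕ) (cs : ℕ → ℕ → ℕ) (i : ℕ) (H0 : HS α) (t : ℕ) (H : HS α) : Prop where
  cell : H.v xCell = cs i (t / w)
  r : H.v xR = 2 ^ (t % w)
  a : H.a = H0.a
  v : ∀ r, r ∉ outVars → H.v r = H0.v r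

theorem drop_eq_cons {β : Type*} {l : List β} {t : ℕ} {x : β} {r : List β} (h : l.drop t = x :: r) :
    t < l.length ∧ (∀ y, l.getD t y = x) ∧ l.drop (t + 1) = r := by
  have hlt : t < l.length := by
    by_contra hcon
    rw [List.drop_eq_nil_of_le (by omega)] at h
    simp at h
  rw [List.drop_eq_getElem_cons hlt] at h
  obtain ⟨h1, h2⟩ := List.cons.inj h
  refine ⟨hlt, fun y => ?_, h2⟩
  rw [List.getD_eq_getElem _ _ hlt, h1]

theorem getBit_wp [LinearOrder α] (h0 : 1 < w) (hX : 64 + 16 * X ≤ 2 ^ w) {H0 H : HS α}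
    {cs : ℕ → ℕ → ℕ} {Bt : ℕ → List Bool} (hQ : QInv w H0 cs Bt) (hc : H0.v xNc < X) {i t : ℕ}
    (h1 : 1 ≤ i) (hi : i ≤ H0.v xD) {z : Bool} {l : List Bool} (hl : (Bt i).drop t = z :: l)
    (h : Ptr w cs i H0 t H) :
    getBit.wp w X (fun H' => Ptr w cs i H0 (t + 1) H' ∧ H'.v xZ = (if z then 1 else 0) ∧
      (∀ r, r ∉ [xZ, xR, xCell] → H'.v r = H.v r) ∧ H'.out = H.out ∧ H'.tm ≤ H.tm + 6) H := by
  obtain ⟨hlt, hz, -⟩ := drop_eq_cons hl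
  have hw : 0 < w := by omega
  have hj : t / w ≤ (Bt i).length / w := Nat.div_le_div_right hlt.le
  have hrng := hQ.rng i h1 hi _ hj
  have hk : t % w < w := Nat.mod_lt _ hw
  have hbit := hQ.bit i h1 hi _ hj _ hk
  rw [show t / w * w + t % w = t by rw [mul_comm]; exact Nat.div_add_mod t w, hz] at hbit
  have hbit' : H0.a aData (cs i (t / w)) / 2 ^ (t % w) % 2 = if z then 1 else 0 := by
    rw [Nat.testBit_eq_decide_div_mod_eq] at hbit
    have h3 := Nat.mod_two_eq_zero_or_one (H0.a aData (cs i (t / w)) / 2 ^ (t % w))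
    cases z
    · simp at hbit ⊢; omega
    · simpa using hbit
  have h2w : 2 < 2 ^ w := by omega
  simp only [getBit, blk, Stmt.wp_seq]
  refine ⟨by simp [h.cell]; omega, by simp; omega, by simp, ?_, ?_⟩
  · intro hv
    have hne : t % w + 1 ≠ w := by
      intro hcon
      apply hv
      simp [h.r, ← pow_succ', hcon]
    have h3 : (2 * 2 ^ (t % w)) % 2 ^ w = 2 ^ (t % w + 1) := by
      rw [← pow_succ']
      exact Nat.mod_eq_of_lt (Nat.pow_lt_pow_right (by simp) (by omega))
    have h4 : (t + 1) % w = t % w + 1 := by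
      rw [Nat.add_mod, Nat.mod_eq_of_lt h0]; exact Nat.mod_eq_of_lt (by omega)
    have h5 : (t + 1) / w = t / w := by
      rw [Nat.succ_div_of_not_dvd]
      rw [Nat.dvd_iff_mod_eq_zero, h4]; omega
    refine ⟨⟨by simp [h.cell, h5], by simp [h.r, h3, h4], by simpa using h.a, fun r hr => ?_⟩,
      by simp [h.cell, h.r, h.a, hbit'], fun r hr => ?_, by simp, by simp⟩
    · rw [← h.v r hr]
      simp only [outVars, List.mem_cons, not_or] at hr
      simp [hr]
    · simp at hr
      simp [hr]
  · intro hv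
    have he : t % w + 1 = w := by
      by_contra hcon
      have h3 : (2 * 2 ^ (t % w)) % 2 ^ w = 2 ^ (t % w + 1) := by
        rw [← pow_succ']
        exact Nat.mod_eq_of_lt (Nat.pow_lt_pow_right (by simp) (by omega))
      simp [h.r, h3] at hv
    have h4 : (t + 1) % w = 0 := by
      rw [Nat.add_mod, Nat.mod_eq_of_lt h0, he, Nat.mod_self]
    have h5 : (t + 1) / w = t / w + 1 := by
      rw [Nat.succ_div_of_dvd (Nat.dvd_of_mod_eq_zero h4)]
    -- Bit `t` exists, so `t + 1` is at most the length; the next cell exists even if this was the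
    -- last bit, because cells are opened eagerly.
    have h6 : t / w < (Bt i).length / w := by
      have h7 : (t + 1) / w ≤ (Bt i).length / w := Nat.div_le_div_right (by omega)
      omega
    refine ⟨by simp [h.cell]; omega, by simp; omega, ?_⟩
    refine ⟨⟨by simp [h.cell, h.a, h5, hQ.lk i h1 hi _ h6], by simp [h4], by simpa using h.a,
      fun r hr => ?_⟩, by simp [h.cell, h.r, h.a, hbit'], fun r hr => ?_, by simp, by simp⟩
    · rw [← h.v r hr]
      simp only [outVars, List.mem_cons, not_or] at hr
      simp [hr]
    · simp at hr
      simp [hr]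

/-- Separates the marker, which is already in `xZ` when the loop tests it, from the bits that are
still in the queue. -/
theorem code_eq (n : ℕ) : code n = decide (n ≠ 0) :: (code n).tail := by
  rcases Nat.eq_zero_or_pos n with rfl | hn
  · simp [code_zero]
  · rw [code_pos (by omega)]; simp; omega

/-- The quantity `y + u * n` is invariant, since `n = 2 * (n / 2) + n % 2`, and its bound keeps the
sum in range. After the last digit the doubled weight may wrap around, so its value matters only
while `n ≠ 0`. -/
theorem getNumLoop_wp [LinearOrder α] (h0 : 1 < w) (hX : 64 + 16 * X ≤ 2 ^ w) {H0 : HS α}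
    {cs : ℕ → ℕ → ℕ} {Bt : ℕ → List Bool} (hQ : QInv w H0 cs Bt) (hc : H0.v xNc < X) {i : ℕ}
    (h1 : 1 ≤ i) (hi : i ≤ H0.v xD) (l : List Bool) (n : ℕ) :
    ∀ {H : HS α} {t y u : ℕ}, (Bt i).drop t = (code n).tail ++ l → Ptr w cs i H0 t H →
      H.v xZ = (if n ≠ 0 then 1 else 0) → H.v xY = y → (n ≠ 0 → H.v xU = u) →
      y + u * n < 2 ^ w →
      (Stmt.whl (.v xZ) (blk [
        getBit,
        .asg xY (add (.v xY) (mul (.v xZ) (.v xU))),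
        .asg xU (mul (.c 2) (.v xU)),
        getBit])).wp w X (fun H' => (∃ t', (Bt i).drop t' = l ∧ Ptr w cs i H0 t' H') ∧
          H'.v xY = y + u * n ∧ (∀ r, r ∉ [xZ, xR, xCell, xY, xU] → H'.v r = H.v r) ∧
          H'.out = H.out ∧ H'.tm ≤ H.tm + 16 * (code n).length) H := by
  induction n using Nat.strong_induction_on with
  | _ n ih =>
  intro H t y u hd hp hz hy hu hlt
  refine Stmt.wp_whl (by simp) (fun hv => ?_) fun hv => ?_
  · have hn : n ≠ 0 := by
      intro hn; simp [hz, hn] at hv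
    rw [code_pos hn, List.tail_cons, List.cons_append] at hd
    have hu := hu hn
    have hn2 : n = 2 * (n / 2) + n % 2 := by omega
    have hun : u ≤ u * n := Nat.le_mul_of_pos_right _ (by omega)
    simp only [blk, Stmt.wp_seq]
    refine Stmt.wp_mono _ (getBit_wp h0 hX hQ hc h1 hi hd
      (⟨hp.cell, hp.r, hp.a, hp.v⟩ : Ptr w cs i H0 t H.tick)) ?_
    rintro H1 ⟨hp1, hz1, hv1, ho1, ht1⟩
    have hd1 := (drop_eq_cons hd).2.2
    have hy1 : H1.v xY = y := by rw [hv1 _ (by simp)]; exact hy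
    have hu1 : H1.v xU = u := by rw [hv1 _ (by simp)]; exact hu
    have hb : (H1.v xZ * H1.v xU) % 2 ^ w = u * (n % 2) := by
      rw [hz1, hu1]
      rcases Nat.mod_two_eq_zero_or_one n with h2 | h2
      · simp [h2]
      · simp only [h2, decide_true, if_true, one_mul, mul_one]
        exact Nat.mod_eq_of_lt (by omega)
    have hb2 := hb
    rw [hu1] at hb2
    have hun2 : u * n = (2 * u) * (n / 2) + u * (n % 2) := by
      conv_lhs => rw [hn2]
      ring
    have h2w : 2 < 2 ^ w := by omega
    refine ⟨?_, by simp; omega, ?_⟩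
    · simp only [Expr.ok_add, Expr.ok_v, Expr.ok_mul, Expr.val_v, Expr.val_mul, true_and, and_self,
        hb, hy1]
      omega
    rw [code_eq, List.cons_append] at hd1
    obtain ⟨H2, hH2⟩ : ∃ H2, H2 = (H1.setV xY (y + u * (n % 2))).setV xU
      ((2 * u) % 2 ^ w) := ⟨_, rfl⟩
    simp only [Expr.val_add, Expr.val_v, Expr.val_mul, Expr.val_c, hy1, HS.setV_v,
      Nat.reduceEqDiff, if_false, hu1, hb2]
    rw [← hH2]
    have hp2 : Ptr w cs i H0 (t + 1) H2 := by
      rw [hH2]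
      refine ⟨by simpa using hp1.cell, by simpa using hp1.r, hp1.a, fun r hr => ?_⟩
      rw [← hp1.v r hr]
      simp only [outVars, List.mem_cons, not_or] at hr
      simp [hr]
    refine Stmt.wp_mono _ (getBit_wp h0 hX hQ hc h1 hi hd1 hp2) ?_
    rintro H3 ⟨hp3, hz3, hv3, ho3, ht3⟩
    refine Stmt.wp_mono _ (ih (n / 2) (by omega) (drop_eq_cons hd1).2.2 hp3
      (y := y + u * (n % 2)) (u := 2 * u) (by rw [hz3]; simp) ?_ ?_ (by omega)) ?_
    · rw [hv3 _ (by simp), hH2]; simp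
    · intro hn'
      rw [hv3 _ (by simp), hH2]
      simp only [HS.setV_v, if_true]
      refine Nat.mod_eq_of_lt ?_
      have : 2 * u ≤ 2 * u * (n / 2) := Nat.le_mul_of_pos_right _ (by omega)
      omega
    · rintro H4 ⟨hp4, hy4, hv4, ho4, ht4⟩
      refine ⟨hp4, by rw [hy4]; omega, fun r hr => ?_, ?_, ?_⟩
      · simp only [List.mem_cons, not_or] at hr
        rw [hv4 r (by simp [hr]), hv3 r (by simp [hr]), hH2]
        simp only [HS.setV_v, hr, if_false]
        rw [hv1 r (by simp [hr]), HS.tick_v]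
      · rw [ho4, ho3, hH2]; exact ho1
      · rw [hH2] at ht3
        rw [code_pos hn]
        simp at ht1 ht3 ⊢
        omega
  · have hn : n = 0 := by
      by_contra hn; simp [hz, hn] at hv
    subst hn
    refine ⟨⟨t, by simpa [code_zero] using hd, ⟨hp.cell, hp.r, hp.a, hp.v⟩⟩, by simpa using hy,
      fun _ _ => rfl, rfl, by simp [code_zero]⟩

theorem getNum_wp [LinearOrder α] (h0 : 1 < w) (hX : 64 + 16 * X ≤ 2 ^ w) {H0 : HS α}
    {cs : ℕ → ℕ → ℕ} {Bt : ℕ → List Bool} (hQ : QInv w H0 cs Bt) (hc : H0.v xNc < X) {i : ℕ}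
    (h1 : 1 ≤ i) (hi : i ≤ H0.v xD) {l : List Bool} {n : ℕ} (hn : n < 2 ^ w) {H : HS α} {t : ℕ}
    (hd : (Bt i).drop t = code n ++ l) (hp : Ptr w cs i H0 t H) :
    getNum.wp w X (fun H' => (∃ t', (Bt i).drop t' = l ∧ Ptr w cs i H0 t' H') ∧
      H'.v xY = n ∧ (∀ r, r ∉ [xZ, xR, xCell, xY, xU] → H'.v r = H.v r) ∧
      H'.out = H.out ∧ H'.tm ≤ H.tm + 24 * (code n).length) H := by
  have h2w : 2 < 2 ^ w := by omega
  rw [code_eq, List.cons_append] at hd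
  simp only [getNum, blk, Stmt.wp_seq]
  refine ⟨by simp, by simp; omega, ?_⟩
  obtain ⟨H2, hH2⟩ : ∃ H2, H2 = (H.setV xY 0).setV xU 1 := ⟨_, rfl⟩
  simp only [Expr.val_c]
  rw [← hH2]
  have hp2 : Ptr w cs i H0 t H2 := by
    rw [hH2]
    refine ⟨by simpa using hp.cell, by simpa using hp.r, hp.a, fun r hr => ?_⟩
    rw [← hp.v r hr]
    simp only [outVars, List.mem_cons, not_or] at hr
    simp [hr]
  refine Stmt.wp_mono _ (getBit_wp h0 hX hQ hc h1 hi hd hp2) ?_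
  rintro H3 ⟨hp3, hz3, hv3, ho3, ht3⟩
  refine Stmt.wp_mono _ (getNumLoop_wp h0 hX hQ hc h1 hi l n (drop_eq_cons hd).2.2 hp3
    (y := 0) (u := 1) (by rw [hz3]; simp) ?_ ?_ (by omega)) ?_
  · rw [hv3 _ (by simp), hH2]; simp
  · intro _
    rw [hv3 _ (by simp), hH2]; simp
  · rintro H4 ⟨hp4, hy4, hv4, ho4, ht4⟩
    refine ⟨hp4, by rw [hy4]; omega, fun r hr => ?_, ?_, ?_⟩
    · simp only [List.mem_cons, not_or] at hr
      rw [hv4 r (by simp [hr]), hv3 r (by simp [hr]), hH2]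
      simp only [HS.setV_v, hr, if_false]
    · rw [ho4, ho3, hH2]; rfl
    · rw [hH2] at ht3
      have := code_length_pos n
      simp at ht3
      omega

theorem writeRun_wp [LinearOrder α] (n : ℕ) :
    ∀ {H : HS α} {p : ℕ}, H.v xY = n → H.v xCur = p → p + n + 1 < 2 ^ w →
      writeRun.wp w X (fun H' => H'.v xCur = p + n ∧ H'.out = H.out ++ List.range' p n ∧
        (∀ r, r ∉ [xY, xCur] → H'.v r = H.v r) ∧ H'.a = H.a ∧ H'.tm ≤ H.tm + 4 * n + 1) H := by
  induction n with
  | zero =>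
    intro H p hy hp hlt
    exact Stmt.wp_whl (by simp) (fun hv => absurd hy hv) fun _ =>
      ⟨hp, by simp, fun _ _ => rfl, rfl, by simp⟩
  | succ n ih =>
    intro H p hy hp hlt
    refine Stmt.wp_whl (by simp) (fun _ => ?_) fun hv => absurd hv (by simp [hy])
    simp only [blk, Stmt.wp_seq]
    refine ⟨by simp, ⟨by simp, show 1 < 2 ^ w by omega, by simp [hp]; omega⟩,
      ⟨by simp, show 1 < 2 ^ w by omega, by simp [hy]⟩, ?_⟩
    refine Stmt.wp_mono _ (ih (p := p + 1) (by simp [hy]) (by simp [hp]) (by omega)) ?_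
    rintro H1 ⟨h1, h2, h3, h4, h5⟩
    refine ⟨by rw [h1]; omega, ?_, fun r hr => ?_, ?_, ?_⟩
    · rw [h2, List.range'_succ]; simp [hp]
    · rw [h3 r hr]
      simp at hr
      simp [hr]
    · rw [h4]; simp
    · simp at h5
      omega

/-- The numbers in the runs that are given by pairs of lengths and gaps, from `p` on. -/
def runs : ℕ → List (ℕ × ℕ) → List ℕ
  | _, [] => []
  | p, q :: ps => List.range' p q.1 ++ runs (p + q.1 + q.2) ps

/-- The start of the run after those of `runs`. -/
def runsEnd : ℕ → List (ℕ × ℕ) → ℕ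
  | p, [] => p
  | p, q :: ps => runsEnd (p + q.1 + q.2) ps

theorem le_runsEnd (p : ℕ) (ps : List (ℕ × ℕ)) : p ≤ runsEnd p ps := by
  induction ps generalizing p with
  | nil => exact le_rfl
  | cons q ps ih => have := ih (p + q.1 + q.2); simp only [runsEnd]; omega

theorem runs_concat (p : ℕ) (ps : List (ℕ × ℕ)) (q : ℕ × ℕ) :
    runs p (ps ++ [q]) = runs p ps ++ List.range' (runsEnd p ps) q.1 := by
  induction ps generalizing p with
  | nil => simp [runs, runsEnd]
  | cons q' ps ih => simp [runs, runsEnd, ih]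

theorem runsEnd_concat (p : ℕ) (ps : List (ℕ × ℕ)) (q : ℕ × ℕ) :
    runsEnd p (ps ++ [q]) = runsEnd p ps + q.1 + q.2 := by
  induction ps generalizing p with
  | nil => simp [runsEnd]
  | cons q' ps ih => simp [runsEnd, ih]

/-- The second conjunct carries the induction: the run under construction ends just before the
expected position, so extending a run and opening one after a gap both decode correctly. -/
theorem decode_encode {l : List ℕ} (h : (0 :: l).Pairwise (· < ·)) :
    runs 1 (encode l).pairs ++ List.range' (runsEnd 1 (encode l).pairs) (encode l).len = l ∧
      runsEnd 1 (encode l).pairs + (encode l).len = (encode l).pos := by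
  induction l using List.reverseRecOn with
  | nil => simp [encode_nil, runs, runsEnd]
  | append_singleton l p ih =>
    obtain ⟨h1, h2⟩ := ih (h.sublist (by simp))
    have h3 := encode_pos_le h
    rw [encode_concat, Enc.step]
    split_ifs with hp
    · refine ⟨?_, by simp only; omega⟩
      simp only [List.range'_concat, one_mul, h2, ← List.append_assoc, h1, hp]
    · simp only [runs_concat, runsEnd_concat, h1]
      refine ⟨?_, by omega⟩
      rw [show runsEnd 1 (encode l).pairs + (encode l).len + (p - (encode l).pos) = p by omega]
      simp

theorem writePairs_wp [LinearOrder α] (h0 : 1 < w) (hX : 64 + 16 * X ≤ 2 ^ w) {H0 : HS α}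
    {cs : ℕ → ℕ → ℕ} {Bt : ℕ → List Bool} (hQ : QInv w H0 cs Bt) (hc : H0.v xNc < X) {i : ℕ}
    (h1 : 1 ≤ i) (hi : i ≤ H0.v xD) (ps : List (ℕ × ℕ)) :
    ∀ {H : HS α} {t p : ℕ}, (Bt i).drop t = (ps.flatMap fun q => code q.1 ++ code q.2) →
      Ptr w cs i H0 t H → H.v xK = ps.length → H.v xC = i → H.v xCur = p →
      runsEnd p ps + 1 < 2 ^ w →
      (Stmt.whl (.v xK) (blk [
        getNum,
        writeRun,
        getNum,
        .asg xCur (add (.v xCur) (.v xY)),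
        .asg xK (sub (.v xK) (.c 1))])).wp w X (fun H' => (∃ t', Ptr w cs i H0 t' H') ∧
          H'.v xCur = runsEnd p ps ∧ H'.out = H.out ++ runs p ps ∧ H'.v xC = i ∧
          H'.tm ≤ H.tm + 30 * (ps.flatMap fun q => code q.1 ++ code q.2).length +
            4 * (runs p ps).length + 1) H := by
  induction ps with
  | nil =>
    intro H t p hd hp hk hc hcur hlt
    exact Stmt.wp_whl (by simp) (fun hv => absurd hk hv) fun _ =>
      ⟨⟨t, hp.cell, hp.r, hp.a, hp.v⟩, hcur, by simp [runs], hc, by simp⟩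
  | cons q ps ih =>
    intro H t p hd hp hk hxc hcur hlt
    have hle := le_runsEnd (p + q.1 + q.2) ps
    simp only [runsEnd] at hlt
    rw [List.flatMap_cons, List.append_assoc] at hd
    refine Stmt.wp_whl (by simp) (fun _ => ?_) fun hv => absurd hv (by simp [hk])
    simp only [blk, Stmt.wp_seq]
    refine Stmt.wp_mono _ (getNum_wp h0 hX hQ hc h1 hi (by omega) hd
      (⟨hp.cell, hp.r, hp.a, hp.v⟩ : Ptr w cs i H0 t H.tick)) ?_
    rintro H1 ⟨⟨t1, hd1, hp1⟩, hy1, hv1, ho1, ht1⟩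
    refine Stmt.wp_mono _ (writeRun_wp q.1 hy1 (p := p) (by rw [hv1 _ (by simp)]; exact hcur)
      (by omega)) ?_
    rintro H2 ⟨hcur2, ho2, hv2, ha2, ht2⟩
    have hp2 : Ptr w cs i H0 t1 H2 := by
      refine ⟨by rw [hv2 _ (by simp), hp1.cell], by rw [hv2 _ (by simp), hp1.r], ha2.trans hp1.a,
        fun r hr => ?_⟩
      rw [← hp1.v r hr]
      simp only [outVars, List.mem_cons, not_or] at hr
      exact hv2 r (by simp [hr])
    refine Stmt.wp_mono _ (getNum_wp h0 hX hQ hc h1 hi (by omega) hd1 hp2) ?_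
    rintro H3 ⟨⟨t3, hd3, hp3⟩, hy3, hv3, ho3, ht3⟩
    have hcur3 : H3.v xCur = p + q.1 := by rw [hv3 _ (by simp), hcur2]
    have hk3 : H3.v xK = ps.length + 1 := by
      rw [hv3 _ (by simp), hv2 _ (by simp), hv1 _ (by simp)]; exact hk
    refine ⟨by simp [hcur3, hy3]; omega, ⟨by simp, show 1 < 2 ^ w by omega, by simp [hk3]⟩, ?_⟩
    refine Stmt.wp_mono _ (ih (p := p + q.1 + q.2) (t := t3) hd3 ?_ ?_ ?_ ?_ hlt) ?_
    · refine ⟨by simpa using hp3.cell, by simpa using hp3.r, hp3.a, fun r hr => ?_⟩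
      rw [← hp3.v r hr]
      simp only [outVars, List.mem_cons, not_or] at hr
      simp [hr]
    · simp [hk3]
    · have : H3.v xC = i := by
        rw [hv3 _ (by simp), hv2 _ (by simp), hv1 _ (by simp)]; exact hxc
      simpa using this
    · simp [hcur3, hy3]
    · rintro H4 ⟨hp4, hcur4, ho4, hc4, ht4⟩
      refine ⟨hp4, hcur4, ?_, hc4, ?_⟩
      · rw [ho4]
        simp [ho3, ho2, ho1, runs]
      · have e1 := code_length_pos q.1
        have e2 := code_length_pos q.2
        simp only [runs, List.flatMap_cons, List.length_append, List.length_range']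
        simp only [HS.setV_tm, HS.tick_tm] at ht1 ht4
        omega

theorem writeNode_wp [LinearOrder α] (h0 : 1 < w) (hX : 64 + 16 * X ≤ 2 ^ w) {H0 : HS α}
    {cs : ℕ → ℕ → ℕ} {P : ℕ → List ℕ} (hM : MInv w H0 cs P) (hc : H0.v xNc < X) {i : ℕ}
    (h1 : 1 ≤ i) (hi : i ≤ H0.v xD) (hiX : i < X) (hP : (0 :: P i).Pairwise (· < ·))
    (hpos : (encode (P i)).pos + 1 < 2 ^ w) {H : HS α} (ha : H.a = H0.a)
    (hv : ∀ r, r ∉ outVars → H.v r = H0.v r) (hxc : H.v xC = i) :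
    writeNode.wp w X (fun H' => H'.a = H0.a ∧ (∀ r, r ∉ outVars → H'.v r = H0.v r) ∧
      H'.v xC = i ∧ H'.out = H.out ++ P i ∧
      H'.tm ≤ H.tm + 30 * (qbits (P i)).length + 8 * (P i).length + 7) H := by
  obtain ⟨hdec, hend⟩ := decode_encode hP
  have h2w : 2 < 2 ^ w := by omega
  simp only [writeNode, blk, Stmt.wp_seq]
  refine ⟨by simp [hxc, hiX], by simp; omega, by simp; omega, by simp [hxc, hiX], ?_⟩
  have hstep : ∀ H1 : HS α, Ptr w cs i H0 0 H1 → H1.v xK = (encode (P i)).pairs.length →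
      H1.v xC = i → H1.v xCur = 1 → H1.out = H.out → H1.tm = H.tm + 4 →
      (blk [.whl (.v xK) (blk [
        getNum,
        writeRun,
        getNum,
        .asg xCur (add (.v xCur) (.v xY)),
        .asg xK (sub (.v xK) (.c 1))]),
      .asg xY (.a aLen (.v xC)),
      writeRun]).wp w X (fun H' => H'.a = H0.a ∧ (∀ r, r ∉ outVars → H'.v r = H0.v r) ∧
      H'.v xC = i ∧ H'.out = H.out ++ P i ∧
      H'.tm ≤ H.tm + 30 * (qbits (P i)).length + 8 * (P i).length + 7) H1 := by
    intro H1 hp1 hk1 hc1 hcur1 ho1 ht1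
    simp only [blk, Stmt.wp_seq]
    refine Stmt.wp_mono _ (writePairs_wp h0 hX hM.q hc h1 hi (encode (P i)).pairs
      (t := 0) (p := 1) rfl hp1 hk1 hc1 hcur1 (by omega)) ?_
    rintro H2 ⟨⟨t, hp2⟩, hcur2, ho2, hc2, ht2⟩
    refine ⟨by simp [hc2, hiX], ?_⟩
    refine Stmt.wp_mono _ (writeRun_wp (encode (P i)).len (p := runsEnd 1 (encode (P i)).pairs)
      ?_ ?_ (by omega)) ?_
    · simp [hc2, hp2.a, hM.len i h1 hi]
    · simp [hcur2]
    · rintro H3 ⟨hcur3, ho3, hv3, ha3, ht3⟩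
      refine ⟨ha3.trans hp2.a, fun r hr => ?_, ?_, ?_, ?_⟩
      · rw [← hp2.v r hr]
        simp only [outVars, List.mem_cons, not_or] at hr
        rw [hv3 r (by simp [hr])]
        simp [hr]
      · rw [hv3 _ (by simp)]
        simp [hc2]
      · rw [ho3]
        simp only [HS.setV_out, ho2, ho1, List.append_assoc, hdec]
      · have h4 := congrArg List.length hdec
        rw [List.length_append, List.length_range'] at h4
        have h5 : ((encode (P i)).pairs.flatMap fun q => code q.1 ++ code q.2) = qbits (P i) := rfl
        rw [h5] at ht2
        simp only [HS.setV_tm] at ht3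
        omega
  refine hstep _ ⟨?_, ?_, ?_, fun r hr => ?_⟩ ?_ ?_ ?_ ?_ ?_
  · simp [hxc, ha, hM.q.hd i h1 hi]
  · simp
  · simpa using ha
  · rw [← hv r hr]
    simp only [outVars, List.mem_cons, not_or] at hr
    simp [hr]
  · simp [hxc, ha, hM.np i h1 hi]
  · simp [hxc]
  · simp
  · simp
  · simp

theorem writeLoop_wp [LinearOrder α] (h0 : 1 < w) (hX : 64 + 16 * X ≤ 2 ^ w) {H0 : HS α}
    {cs : ℕ → ℕ → ℕ} {P : ℕ → List ℕ} (hM : MInv w H0 cs P) (hc : H0.v xNc < X)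
    (hdX : H0.v xD < X) (hP : ∀ i, 1 ≤ i → i ≤ H0.v xD → (0 :: P i).Pairwise (· < ·))
    (hpos : ∀ i, 1 ≤ i → i ≤ H0.v xD → (encode (P i)).pos + 1 < 2 ^ w) (I : List ℕ) :
    ∀ {H : HS α}, H.a = H0.a → (∀ r, r ∉ outVars → H.v r = H0.v r) → Lst (H0.a aMn) (H.v xC) I →
      (∀ i ∈ I, 1 ≤ i ∧ i ≤ H0.v xD) →
      (Stmt.whl (.v xC) (blk [
        writeNode,
        .asg xC (.a aMn (.v xC))])).wp w X (fun H' => H'.out = H.out ++ I.flatMap P ∧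
          H'.tm ≤ H.tm +
            (I.map fun i => 30 * (qbits (P i)).length + 8 * (P i).length + 9).sum + 1) H := by
  induction I with
  | nil =>
    intro H _ _ hl _
    exact Stmt.wp_whl (by simp) (fun h => absurd hl h) fun _ => ⟨by simp, by simp⟩
  | cons i I ih =>
    intro H ha hv hl hI
    obtain ⟨hxc, hi0, hl⟩ := hl
    obtain ⟨h1, hi⟩ := hI i (by simp)
    refine Stmt.wp_whl (by simp) (fun _ => ?_) fun h => absurd (hxc.symm.trans h) hi0
    simp only [blk, Stmt.wp_seq]
    refine Stmt.wp_mono _ (writeNode_wp h0 hX hM hc h1 hi (by omega) (hP i h1 hi) (hpos i h1 hi)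
      (H := H.tick) ha hv hxc) ?_
    rintro H1 ⟨ha1, hv1, hc1, ho1, ht1⟩
    refine ⟨by simp [hc1]; omega, ?_⟩
    refine Stmt.wp_mono _ (ih (by simpa using ha1) (fun r hr => ?_) (by simpa [hc1, ha1] using hl)
      fun j hj => hI j (by simp [hj])) ?_
    · rw [← hv1 r hr]
      simp only [outVars, List.mem_cons, not_or] at hr
      simp [hr]
    · rintro H2 ⟨ho2, ht2⟩
      refine ⟨by rw [ho2]; simp [ho1], ?_⟩
      simp only [HS.setV_tm, HS.tick_tm] at ht1 ht2
      simp only [List.map_cons, List.sum_cons]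
      omega

theorem writeAll_wp [LinearOrder α] (h0 : 1 < w) (hX : 64 + 16 * X ≤ 2 ^ w) {s : List α}
    (hU : room w s.toFinset (fun k => positions s k s.length) + 2 ≤ X)
    (hs : s.length + 2 < 2 ^ w) {H : HS α} {cs : ℕ → ℕ → ℕ} {P : ℕ → List ℕ} {mk : ℕ → α}
    {I : List ℕ} (h : StreamInv w s s.length H cs P mk I) :
    writeAll.wp w X (fun H' => H'.out = I.flatMap P ∧
      H'.tm ≤ H.tm + 30 * tot (H.v xD) P + 8 * (I.flatMap P).length + 9 * H.v xD + 2) H := by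
  have hcell := cells_le_room (w := w) (F := fun k => positions s k s.length) h.main.mem h.main.pre
    h.main.inj
  have hd := le_cells (w := w) (H.v xD) fun i => qbits (P i)
  have hnc : H.v xNc = cells w (H.v xD) fun i => qbits (P i) := h.main.m.q.cnt
  have hpw : ∀ i, 1 ≤ i → i ≤ H.v xD → (0 :: P i).Pairwise (· < ·) := fun i h1 hi =>
    (positions_pairwise s (mk i) s.length).sublist ((h.main.pre i h1 hi).sublist.cons_cons 0)
  have hpos : ∀ i, 1 ≤ i → i ≤ H.v xD → (encode (P i)).pos + 1 < 2 ^ w := by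
    intro i h1 hi
    rcases List.eq_nil_or_concat (P i) with h2 | ⟨l, p, h2⟩
    · rw [h2, encode_nil]; simp only; omega
    · have h3 : p ∈ positions s (mk i) s.length :=
        (h.main.pre i h1 hi).subset (by rw [h2]; simp)
      have h4 := List.mem_range'_1.1 (List.mem_of_mem_filter h3)
      rw [h2, List.concat_eq_append, encode_pos_concat]
      omega
  simp only [writeAll, blk, Stmt.wp_seq]
  refine ⟨by simp; omega, ?_⟩
  refine Stmt.wp_mono _ (writeLoop_wp h0 hX h.main.m (by omega) (by omega) hpw hpos I
    (H := H.setV xC (H.a aMn 0)) rfl (fun r hr => ?_) (by simpa using h.path)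
    fun i hi => (h.ids i).1 hi) ?_
  · simp only [outVars, List.mem_cons, not_or] at hr
    simp [hr]
  · rintro H1 ⟨ho, ht⟩
    refine ⟨by rw [ho]; simp [h.out], ?_⟩
    have hI : I.toFinset = Finset.Icc 1 (H.v xD) := by ext i; simp [h.ids]
    have h1 : (I.map fun i => (qbits (P i)).length).sum = tot (H.v xD) P := by
      rw [tot, ← hI, List.sum_toFinset _ (nodup_of_pairwise_key h.srt)]
    have h2 : (I.map fun i => 30 * (qbits (P i)).length + 8 * (P i).length + 9).sum =
        30 * (I.map fun i => (qbits (P i)).length).sum + 8 * (I.flatMap P).length +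
          9 * I.length := by
      clear h1 hI ht ho h
      induction I with
      | nil => simp
      | cons i I ih =>
        simp only [List.map_cons, List.sum_cons, ih, List.flatMap_cons, List.length_append,
          List.length_cons]
        ring
    rw [h2, h1, h.length] at ht
    simp only [HS.setV_tm] at ht
    omega

end StreamRAM

namespace StreamRAM

open StreamRAM.Expr (add sub mul div mod or lt eq)
set_option linter.unusedSimpArgs false

variable {α : Type*} {w X : ℕ}

/-! ### Entropy -/

/-- The contribution to the entropy of a sequence of length `N`, times `N`, of an element that
occurs `c` times. -/
noncomputable def ent (c N : ℕ) : ℝ := c * Real.logb 2 ((N : ℝ) / c)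

@[simp] theorem ent_zero (N : ℕ) : ent 0 N = 0 := by simp [ent]

theorem log_two_pos : (0 : ℝ) < Real.log 2 := Real.log_pos (by norm_num)

theorem ent_nonneg {c N : ℕ} (h : c ≤ N) : 0 ≤ ent c N := by
  rcases Nat.eq_zero_or_pos c with rfl | hc
  · simp
  · have hc' : (0 : ℝ) < c := by exact_mod_cast hc
    refine mul_nonneg hc'.le (Real.logb_nonneg (by norm_num) ?_)
    rw [le_div_iff₀ hc', one_mul]
    exact_mod_cast h

theorem ent_mono {c N N' : ℕ} (hc : c ≤ N) (h : N ≤ N') : ent c N ≤ ent c N' := by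
  rcases Nat.eq_zero_or_pos c with rfl | hc0
  · simp
  · have hc' : (0 : ℝ) < c := by exact_mod_cast hc0
    have hN : (0 : ℝ) < N := by exact_mod_cast hc0.trans_le hc
    refine mul_le_mul_of_nonneg_left ?_ hc'.le
    refine Real.logb_le_logb_of_le (by norm_num) (by positivity) ?_
    gcongr

/-- The log sum inequality. -/
theorem ent_add_le {c₁ c₂ N₁ N₂ : ℕ} (h₁ : c₁ ≤ N₁ ∨ 0 < c₂ ∧ 0 < N₁)
    (h₂ : c₂ ≤ N₂ ∨ 0 < c₁ ∧ 0 < N₂) : ent c₁ N₁ + ent c₂ N₂ ≤ ent (c₁ + c₂) (N₁ + N₂) := by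
  rcases Nat.eq_zero_or_pos c₁ with rfl | hc₁
  · simp only [ent_zero, zero_add]
    exact ent_mono (by omega) (by omega)
  rcases Nat.eq_zero_or_pos c₂ with rfl | hc₂
  · simp only [ent_zero, add_zero]
    exact ent_mono (by omega) (by omega)
  have hN₁ : 0 < N₁ := by omega
  have hN₂ : 0 < N₂ := by omega
  have a1 : (0 : ℝ) < c₁ := by exact_mod_cast hc₁
  have a2 : (0 : ℝ) < c₂ := by exact_mod_cast hc₂
  have b1 : (0 : ℝ) < N₁ := by exact_mod_cast hN₁
  have b2 : (0 : ℝ) < N₂ := by exact_mod_cast hN₂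
  -- The tangent bound `log t ≤ t - 1`, with `t` the quotient of the ratio `N / c` and the pooled
  -- ratio; the two error terms cancel in the sum.
  have key : ∀ c N : ℝ, 0 < c → 0 < N → c * Real.log (N / c) ≤
      c * Real.log ((N₁ + N₂) / (c₁ + c₂)) + (N * (c₁ + c₂) / (N₁ + N₂) - c) := by
    intro c N hc hN
    have h1 := Real.log_le_sub_one_of_pos (show 0 < (N / c) / ((N₁ + N₂) / (c₁ + c₂) : ℝ) by
      positivity)
    rw [Real.log_div (by positivity) (by positivity)] at h1
    have h2 := mul_le_mul_of_nonneg_left h1 hc.le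
    have h3 : c * ((N / c) / ((N₁ + N₂) / (c₁ + c₂) : ℝ) - 1) = N * (c₁ + c₂) / (N₁ + N₂) - c := by
      field_simp
    linarith
  have k1 := key c₁ N₁ a1 b1
  have k2 := key c₂ N₂ a2 b2
  have h4 : (N₁ * (c₁ + c₂) / (N₁ + N₂) - c₁ : ℝ) + (N₂ * (c₁ + c₂) / (N₁ + N₂) - c₂) = 0 := by
    field_simp; ring
  simp only [ent, Real.logb, Nat.cast_add]
  rw [← mul_div_assoc, ← mul_div_assoc, ← mul_div_assoc, ← add_div]
  refine div_le_div_of_nonneg_right ?_ log_two_pos.le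
  linarith

/-- The length of a sequence times its entropy. -/
noncomputable def entList [DecidableEq α] (l : List α) : ℝ :=
  ∑ a ∈ l.toFinset, ent (l.count a) l.length

theorem entList_eq [DecidableEq α] {l : List α} {K : Finset α} (h : l.toFinset ⊆ K) :
    entList l = ∑ a ∈ K, ent (l.count a) l.length := by
  refine Finset.sum_subset h fun a _ ha => ?_
  rw [List.count_eq_zero_of_not_mem (by simpa using ha), ent_zero]

/-- The log sum inequality for each key. It allows the entropies of the batches to be charged to the
entropy of the whole sequence. -/
theorem entList_append_le [DecidableEq α] (l l' : List α) :
    entList l + entList l' ≤ entList (l ++ l') := by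
  rw [entList_eq (l := l) (K := (l ++ l').toFinset) (by simp [List.toFinset_append]),
    entList_eq (l := l') (K := (l ++ l').toFinset) (by simp [List.toFinset_append]), entList,
    ← Finset.sum_add_distrib]
  refine Finset.sum_le_sum fun a _ => ?_
  rw [List.count_append, List.length_append]
  exact ent_add_le (Or.inl List.count_le_length) (Or.inl List.count_le_length)

theorem sum_count [DecidableEq α] (l : List α) : ∑ a ∈ l.toFinset, l.count a = l.length := by
  simp

/-! ### The cost of sorting a batch -/

/-- The potential of a key that occurs `c` times in a block after `l` passes. -/
noncomputable def pot (c : ℕ) (l : ℕ) : ℝ :=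
  if c = 0 then 0 else c * (l - Real.logb 2 c) + 3 * c - 2

/-- If both counts are positive, the logarithmic term does not decrease, since binary entropy is at
most 1, and the constant `-2` is counted once instead of twice, which pays for two groups. If only
one is, the increase of `l` alone yields `c ≥ 1`. The summand `3 * c` makes single elements start
with a nonnegative potential. -/
theorem pot_add_le (c₁ c₂ l : ℕ) :
    pot c₁ l + pot c₂ l + ((if c₁ = 0 then 0 else 1) + (if c₂ = 0 then 0 else 1)) ≤
      pot (c₁ + c₂) (l + 1) := by
  have one : ∀ c : ℕ, c ≠ 0 → pot c l + 1 ≤ pot c (l + 1) := by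
    intro c hc
    have : (1 : ℝ) ≤ c := by exact_mod_cast Nat.one_le_iff_ne_zero.2 hc
    simp only [pot, if_neg hc, Nat.cast_add, Nat.cast_one]
    nlinarith
  rcases eq_or_ne c₁ 0 with rfl | h₁
  · rcases eq_or_ne c₂ 0 with rfl | h₂
    · simp [pot]
    · have := one c₂ h₂
      simp only [if_neg h₂, zero_add, if_true, show pot 0 l = 0 by simp [pot]]
      linarith
  rcases eq_or_ne c₂ 0 with rfl | h₂
  · have := one c₁ h₁
    simp only [if_neg h₁, add_zero, if_true, show pot 0 l = 0 by simp [pot]]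
    linarith
  -- With `N₁ = N₂ = 1` this is the bound on binary entropy. Counts above 1 are allowed here by the
  -- second alternatives in the hypotheses of `ent_add_le`.
  have key := ent_add_le (c₁ := c₁) (c₂ := c₂) (N₁ := 1) (N₂ := 1) (by omega) (by omega)
  have a1 : (0 : ℝ) < c₁ := by exact_mod_cast Nat.pos_of_ne_zero h₁
  have a2 : (0 : ℝ) < c₂ := by exact_mod_cast Nat.pos_of_ne_zero h₂
  simp only [ent, Nat.cast_add, Nat.cast_one] at key
  rw [Real.logb_div (by norm_num) a1.ne', Real.logb_div (by norm_num) a2.ne',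
    Real.logb_div (by norm_num) (by positivity), show (1 + 1 : ℝ) = 2 by norm_num,
    Real.logb_self_eq_one (by norm_num), Real.logb_one] at key
  simp only [pot, if_neg h₁, if_neg h₂, if_neg (show c₁ + c₂ ≠ 0 by omega), Nat.cast_add,
    Nat.cast_one]
  nlinarith

theorem pot_mono {c l l' : ℕ} (h : l ≤ l') : pot c l ≤ pot c l' := by
  have : (l : ℝ) ≤ l' := by exact_mod_cast h
  unfold pot
  split_ifs
  · exact le_rfl
  · gcongr

/-- The potential of a block. -/
noncomputable def blockPot [DecidableEq α] (K : Finset α) (key : ℕ → α) (l : ℕ) (b : List ℕ) : ℝ :=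
  ∑ k ∈ K, pot ((b.map key).count k) l

theorem nd_eq_sum [DecidableEq α] {K : Finset α} {key : ℕ → α} {b : List ℕ}
    (h : ∀ x ∈ b, key x ∈ K) :
    (nd key b : ℝ) = ∑ k ∈ K, if (b.map key).count k = 0 then 0 else 1 := by
  have h1 : (b.map key).toFinset = K.filter fun k => ¬ (b.map key).count k = 0 := by
    ext k
    simp only [List.mem_toFinset, Finset.mem_filter, List.count_eq_zero, not_not]
    refine ⟨fun hk => ⟨?_, hk⟩, fun hk => hk.2⟩
    obtain ⟨x, hx, rfl⟩ := List.mem_map.1 hk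
    exact h x hx
  rw [nd, h1, Finset.card_filter]
  push_cast
  refine Finset.sum_congr rfl fun k _ => ?_
  split_ifs <;> simp_all

theorem blockPot_add_le [DecidableEq α] {K : Finset α} {key : ℕ → α} {b b' : List ℕ} (l : ℕ)
    (h : ∀ x ∈ b, key x ∈ K) (h' : ∀ x ∈ b', key x ∈ K) :
    blockPot K key l b + blockPot K key l b' + (nd key b + nd key b') ≤
      blockPot K key (l + 1) (b ++ b') := by
  rw [nd_eq_sum h, nd_eq_sum h']
  simp only [blockPot, ← Finset.sum_add_distrib, List.map_append, List.count_append]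
  exact Finset.sum_le_sum fun k _ => pot_add_le _ _ _

theorem sum_blockPot_pairUp [DecidableEq α] {K : Finset α} {key : ℕ → α} (l : ℕ) :
    ∀ {Bs : List (List ℕ)}, (∀ b ∈ Bs, ∀ x ∈ b, key x ∈ K) →
      (Bs.map (blockPot K key l)).sum + ((Bs.map (nd key)).sum : ℕ) ≤
        ((pairUp Bs).map (blockPot K key (l + 1))).sum
  | [], _ => by simp [pairUp]
  -- An unpaired block counts as merged with an empty one, whose potential is `0`.
  | [b], h => by
    have h1 := blockPot_add_le (b := b) (b' := []) l (h b (by simp)) (by simp)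
    simp only [pairUp, List.map_cons, List.map_nil, List.sum_cons, List.sum_nil, add_zero]
    simpa [blockPot, pot, nd] using h1
  | a :: b :: R, h => by
    have h1 := blockPot_add_le l (h a (by simp)) (h b (by simp))
    have h2 := sum_blockPot_pairUp l (Bs := R) fun c hc => h c (by simp [hc])
    simp only [pairUp, List.map_cons, List.sum_cons, Nat.cast_add]
    linarith

/-- Each pass raises the total potential by at least the number of groups it looks at, so the costs
telescope. Passes halve the number of blocks, hence `L` of them suffice; superfluous levels only
raise the potential. -/
theorem sortCost_le_blockPot [DecidableEq α] {K : Finset α} {key : ℕ → α} (L : ℕ) :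
    ∀ {Bs : List (List ℕ)} (l : ℕ), Bs ≠ [] → Bs.length ≤ 2 ^ L → (∀ b ∈ Bs, ∀ x ∈ b, key x ∈ K) →
      sortCost key Bs + (Bs.map (blockPot K key l)).sum ≤ blockPot K key (l + L) Bs.flatten := by
  induction L with
  | zero =>
    intro Bs l hne hl _
    obtain ⟨b, rfl⟩ := List.length_eq_one_iff.1 (show Bs.length = 1 by
      have := List.length_pos_of_ne_nil hne; omega)
    rw [sortCost, dif_neg (by simp)]
    simp
  | succ L ih =>
    intro Bs l hne hl hK
    have hpos := List.length_pos_of_ne_nil hne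
    by_cases h1 : 1 < Bs.length
    · have hl' := length_pairUp Bs
      have h2 := ih (Bs := pairUp Bs) (l + 1) (by
        intro h; rw [h] at hl'; simp at hl'; omega) (by rw [pow_succ] at hl; omega) (by
        intro b hb x hx
        have h3 : x ∈ (pairUp Bs).flatten := List.mem_flatten.2 ⟨b, hb, hx⟩
        rw [flatten_pairUp] at h3
        obtain ⟨b', hb', hx'⟩ := List.mem_flatten.1 h3
        exact hK b' hb' x hx')
      have h3 := sum_blockPot_pairUp l hK
      rw [flatten_pairUp] at h2
      rw [sortCost, dif_pos h1, show l + (L + 1) = l + 1 + L by ring]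
      push_cast at h3 ⊢
      linarith
    · obtain ⟨b, rfl⟩ := List.length_eq_one_iff.1 (show Bs.length = 1 by omega)
      rw [sortCost, dif_neg h1]
      simp only [Nat.cast_zero, zero_add, List.map_cons, List.map_nil, List.sum_cons, List.sum_nil,
        add_zero, List.flatten_cons, List.flatten_nil, List.append_nil]
      exact Finset.sum_le_sum fun k _ => pot_mono (by omega)

/-- The initial potential is nonnegative, and with `clog 2 m ≤ 1 + logb 2 m` levels a key that
occurs `c` times ends with at most `c log (m / c) + 4 c`. -/
theorem sortCost_singles_le [DecidableEq α] (key : ℕ → α) (m : ℕ) :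
    (sortCost key (singles m) : ℝ) ≤ entList ((List.range' 1 m).map key) + 4 * m := by
  rcases Nat.eq_zero_or_pos m with rfl | hm
  · rw [sortCost, dif_neg (by simp [singles])]; simp [entList]
  set l := (List.range' 1 m).map key with hl
  have hlen : l.length = m := by simp [hl]
  have hL := sortCost_le_blockPot (K := l.toFinset) (key := key) (Nat.clog 2 m) (Bs := singles m) 0
    (by intro h; have := length_singles m; rw [h] at this; simp at this; omega)
    (by rw [length_singles]; exact Nat.le_pow_clog (by norm_num) m) (by
      intro b hb x hx
      have h3 : x ∈ (singles m).flatten := List.mem_flatten.2 ⟨b, hb, hx⟩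
      rw [flatten_singles] at h3
      rw [List.mem_toFinset]
      exact List.mem_map.2 ⟨x, h3, rfl⟩)
  rw [flatten_singles, zero_add] at hL
  have hnn : 0 ≤ ((singles m).map (blockPot l.toFinset key 0)).sum := by
    refine List.sum_nonneg fun x hx => ?_
    obtain ⟨b, hb, rfl⟩ := List.mem_map.1 hx
    obtain ⟨y, _, rfl⟩ := List.mem_map.1 hb
    refine Finset.sum_nonneg fun k _ => ?_
    by_cases hk : key y = k
    · simp [pot, hk]; norm_num
    · simp [pot, hk]
  have hm' : (0 : ℝ) < m := by exact_mod_cast hm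
  have hclog : (Nat.clog 2 m : ℝ) ≤ 1 + Real.logb 2 m := by
    rcases Nat.eq_or_lt_of_le hm with rfl | hm1
    · simp
    · have h1 := Nat.pow_pred_clog_lt_self (b := 2) (by norm_num) hm1
      have h2 : (2 : ℝ) ^ (((Nat.clog 2 m).pred : ℕ) : ℝ) ≤ m := by
        rw [Real.rpow_natCast]; exact_mod_cast h1.le
      rw [← Real.le_logb_iff_rpow_le (by norm_num) hm'] at h2
      have h3 : (Nat.clog 2 m : ℝ) ≤ ((Nat.clog 2 m).pred : ℕ) + 1 := by
        exact_mod_cast (show Nat.clog 2 m ≤ (Nat.clog 2 m).pred + 1 by simp; omega)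
      linarith
  have hfin : blockPot l.toFinset key (Nat.clog 2 m) (List.range' 1 m) ≤
      ∑ k ∈ l.toFinset, (ent (l.count k) m + 4 * (l.count k : ℝ)) := by
    refine Finset.sum_le_sum fun k hk => ?_
    have hc : l.count k ≠ 0 := by
      rw [List.mem_toFinset] at hk
      exact (List.count_pos_iff.2 hk).ne'
    have hc' : (0 : ℝ) < l.count k := by exact_mod_cast Nat.pos_of_ne_zero hc
    rw [← hl, pot, if_neg hc, ent, Real.logb_div hm'.ne' hc'.ne']
    nlinarith
  rw [Finset.sum_add_distrib, ← Finset.mul_sum, ← Nat.cast_sum, sum_count, hlen] at hfin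
  rw [entList, hlen]
  linarith

/-! ### The lengths of the queues -/

theorem length_code_le (n : ℕ) : ((code n).length : ℝ) ≤ 3 + 2 * Real.logb 2 ((n + 1 : ℕ) : ℝ) := by
  have h1 : ∀ n : ℕ, n ≠ 0 → ((code n).length : ℝ) ≤ 3 + 2 * Real.logb 2 n := by
    intro n
    induction n using Nat.strong_induction_on with
    | _ n ih =>
    intro hn
    rw [code_pos hn]
    simp only [List.length_cons]
    rcases eq_or_ne (n / 2) 0 with h | h
    · obtain rfl : n = 1 := by omega
      rw [h, code_zero]; norm_num
    · have h2 := ih (n / 2) (by omega) h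
      have h3 : Real.logb 2 ((n / 2 : ℕ) : ℝ) ≤ Real.logb 2 n - 1 := by
        have hp : (0 : ℝ) < (n / 2 : ℕ) := by exact_mod_cast Nat.pos_of_ne_zero h
        have h4 : ((n / 2 : ℕ) : ℝ) * 2 ≤ n := by exact_mod_cast Nat.div_mul_le_self n 2
        have h5 := Real.logb_le_logb_of_le (b := 2) (by norm_num) (by positivity) h4
        rw [Real.logb_mul hp.ne' (by norm_num), Real.logb_self_eq_one (by norm_num)] at h5
        linarith
      push_cast
      linarith
  rcases eq_or_ne n 0 with rfl | hn
  · simp [code_zero]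
  · refine (h1 n hn).trans ?_
    have hp : (0 : ℝ) < n := by exact_mod_cast Nat.pos_of_ne_zero hn
    gcongr
    · norm_num
    · omega

/-- The tangent of the logarithm at `y` bounds each term. This is Jensen's inequality with a free
parameter in place of the mean, so that only upper bounds on the length and the sum are needed
later. -/
theorem sum_log_le {xs : List ℕ} (h : ∀ x ∈ xs, 1 ≤ x) {y : ℝ} (hy : 1 ≤ y) :
    (xs.map fun x : ℕ => Real.log (x : ℝ)).sum ≤ xs.length * Real.log y + (xs.sum : ℕ) / y := by
  have hy0 : 0 < y := by linarith
  induction xs with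
  | nil => simp
  | cons x xs ih =>
    have h1 := ih fun x hx => h x (by simp [hx])
    have hx : (0 : ℝ) < x := by exact_mod_cast h x (by simp)
    have h2 := Real.log_le_sub_one_of_pos (show 0 < (x : ℝ) / y by positivity)
    rw [Real.log_div hx.ne' hy0.ne'] at h2
    simp only [List.map_cons, List.sum_cons, List.length_cons, Nat.cast_add, Nat.cast_one, add_div]
    linarith

/-- The tangent point is `y = 2 N / m`, for which the linear term is at most `m` and `log y = log 2
+ log (N / m)`. Division by `log 2 > 1 / 2` turns the excess into at most `3 m`. -/
theorem sum_logb_le {xs : List ℕ} (h : ∀ x ∈ xs, 1 ≤ x) {m N : ℕ} (hm : 0 < m) (hN : m ≤ N)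
    (hl : xs.length ≤ m) (hs : xs.sum ≤ 2 * N) :
    (xs.map fun x : ℕ => Real.logb 2 (x : ℝ)).sum ≤ 3 * m + ent m N := by
  have hm' : (0 : ℝ) < m := by exact_mod_cast hm
  have hN' : (m : ℝ) ≤ N := by exact_mod_cast hN
  have hN0 : (0 : ℝ) < N := hm'.trans_le hN'
  have hl' : (xs.length : ℝ) ≤ m := by exact_mod_cast hl
  have hs' : ((xs.sum : ℕ) : ℝ) ≤ 2 * N := by exact_mod_cast hs
  have hy : (1 : ℝ) ≤ 2 * N / m := by rw [le_div_iff₀ hm']; linarith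
  have h1 := sum_log_le h hy
  have h2 : ((xs.sum : ℕ) : ℝ) / (2 * N / m) ≤ m := by
    rw [div_le_iff₀ (by positivity)]
    field_simp
    linarith
  have h3 : (xs.length : ℝ) * Real.log (2 * N / m) ≤ m * Real.log (2 * N / m) :=
    mul_le_mul_of_nonneg_right hl' (Real.log_nonneg hy)
  have h4 : (xs.map fun x : ℕ => Real.logb 2 (x : ℝ)).sum =
      (xs.map fun x : ℕ => Real.log (x : ℝ)).sum / Real.log 2 := by
    rw [div_eq_mul_inv, ← List.sum_map_mul_right]; rfl
  have h5 : Real.log (2 * N / m) = Real.log 2 + Real.log (N / m) := by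
    rw [mul_div_assoc, Real.log_mul (by norm_num) (by positivity)]
  have h6 : (1 : ℝ) / 2 < Real.log 2 := by have := Real.log_two_gt_d9; linarith
  have hlp := log_two_pos
  rw [h4, div_le_iff₀ hlp, ent, Real.logb]
  have h7 : (3 * (m : ℝ) + m * (Real.log (N / m) / Real.log 2)) * Real.log 2 =
      3 * m * Real.log 2 + m * Real.log (N / m) := by field_simp
  rw [h7]
  rw [h5] at h1 h3
  nlinarith

theorem le_ent {m N : ℕ} (h : 2 * m ≤ N) : (m : ℝ) ≤ ent m N := by
  rcases Nat.eq_zero_or_pos m with rfl | hm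
  · simp
  have hm' : (0 : ℝ) < m := by exact_mod_cast hm
  refine le_mul_of_one_le_right hm'.le ?_
  rw [Real.le_logb_iff_rpow_le (by norm_num) (by
    have : (0 : ℝ) < N := by exact_mod_cast (by omega : 0 < N)
    positivity), Real.rpow_one, le_div_iff₀ hm']
  exact_mod_cast h

/-- Two numbers per pair give `6 m` plus twice `2 * (3 m + ent m N)`, in all `18 m + 4 ent m N`, and
`m ≤ ent m N` when `2 m ≤ N`. Here `m` is any bound on the number of pairs, so it may be the
frequency of the element or the number of other elements. -/
theorem length_qbits_le {l : List ℕ} {m N : ℕ} (hm : 0 < m) (hN : 2 * m ≤ N)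
    (hp : (encode l).pairs.length ≤ m)
    (hs : ((encode l).pairs.map fun q => q.1 + q.2).sum ≤ N) :
    ((qbits l).length : ℝ) ≤ 22 * ent m N := by
  have hm' : (0 : ℝ) < m := by exact_mod_cast hm
  unfold qbits
  generalize (encode l).pairs = ps at hp hs
  have h1 : ((ps.flatMap fun q => code q.1 ++ code q.2).length : ℝ) ≤ 6 * ps.length +
      2 * ((ps.map fun q => q.1 + 1).map fun x : ℕ => Real.logb 2 (x : ℝ)).sum +
      2 * ((ps.map fun q => q.2 + 1).map fun x : ℕ => Real.logb 2 (x : ℝ)).sum := by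
    clear hp hs
    induction ps with
    | nil => simp
    | cons q ps ih =>
      have e1 := length_code_le q.1
      have e2 := length_code_le q.2
      simp only [List.flatMap_cons, List.length_append, Nat.cast_add, List.map_cons, List.sum_cons,
        List.length_cons, Nat.cast_one] at *
      linarith
  have h2 : (ps.map fun q => q.1 + q.2).sum + 2 * ps.length =
      (ps.map fun q => q.1 + 1).sum + (ps.map fun q => q.2 + 1).sum := by
    clear h1 hp hs
    induction ps with
    | nil => simp
    | cons q ps ih => simp only [List.map_cons, List.sum_cons, List.length_cons]; omega
  have h3 := sum_logb_le (xs := ps.map fun q => q.1 + 1)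
    (fun x hx => by obtain ⟨q, _, rfl⟩ := List.mem_map.1 hx; omega) hm (N := N) (by omega)
    (by simpa using hp) (by omega)
  have h4 := sum_logb_le (xs := ps.map fun q => q.2 + 1)
    (fun x hx => by obtain ⟨q, _, rfl⟩ := List.mem_map.1 hx; omega) hm (N := N) (by omega)
    (by simpa using hp) (by omega)
  have h5 := le_ent hN
  have h6 : (ps.length : ℝ) ≤ m := by exact_mod_cast hp
  linarith

/-- Runs and gaps are disjoint stretches of `1, …, n`. Each pair ends with a nonempty gap, which
contains no position of `l`; so the number of pairs is at most the number of places outside `l`. -/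
theorem encode_pairs_bounds {l : List ℕ} (h : (0 :: l).Pairwise (· < ·)) {n : ℕ}
    (hn : ∀ p ∈ l, p ≤ n) :
    ((encode l).pairs.map fun q => q.1 + q.2).sum ≤ n ∧ (encode l).pairs.length + l.length ≤ n := by
  have key : ∀ l : List ℕ, (0 :: l).Pairwise (· < ·) →
      ((encode l).pairs.map fun q => q.1 + q.2).sum + (encode l).len + 1 = (encode l).pos ∧
      (encode l).pairs.length + l.length + 1 ≤ (encode l).pos := by
    intro l
    induction l using List.reverseRecOn with
    | nil => intro _; simp [encode_nil]
    | append_singleton l p ih =>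
      intro h
      obtain ⟨h1, h2⟩ := ih (h.sublist (by simp))
      have h3 := encode_pos_le h
      rw [encode_concat, Enc.step]
      split_ifs with hp
      · simp only [List.length_append, List.length_singleton]; omega
      · simp only [List.map_append, List.sum_append, List.map_cons, List.map_nil, List.sum_cons,
          List.sum_nil, List.length_append, List.length_singleton]
        omega
  have h1 := key l h
  have h2 : (encode l).pos ≤ n + 1 := by
    rcases List.eq_nil_or_concat l with h2 | ⟨l', p, h2⟩
    · rw [h2, encode_nil]; simp
    · rw [h2, List.concat_eq_append, encode_pos_concat]
      exact Nat.add_le_add_right (hn p (by rw [h2]; simp)) 1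
  omega

theorem length_positions [DecidableEq α] (s : List α) (k : α) {b : ℕ} (hb : b ≤ s.length) :
    (positions s k b).length = (s.take b).count k := by
  induction b with
  | zero => simp [positions]
  | succ b ih =>
    have h1 : positions s k (b + 1) = positions s k b ++ (if s[b]? = some k then [b + 1] else []) := by
      simp [positions, List.range'_concat, add_comm 1 b, List.filter_cons]
    rw [h1, List.length_append, ih (by omega), List.take_add_one, List.count_append,
      List.getElem?_eq_getElem (by omega)]
    simp [List.count_cons]
    split_ifs <;> simp

/-- Only the most frequent element `a₀` can fill more than half of the sequence. Every other one is
bounded through its own frequency, and `a₀`, if necessary, through the number `q` of all other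
elements. The share of `a₀` and that of the rest are each at most `22 * entList s`. -/
theorem sum_qbits_le [LinearOrder α] {s : List α} (hs : 2 ≤ s.toFinset.card) :
    ((∑ a ∈ s.toFinset, (qbits (positions s a s.length)).length : ℕ) : ℝ) ≤ 44 * entList s ∧
      (s.toFinset.card : ℝ) * Real.logb 2 s.length ≤ 4 * entList s := by
  obtain ⟨a₀, ha₀, hmax⟩ := s.toFinset.exists_max_image (fun a => s.count a)
    (Finset.card_pos.1 (by omega))
  have hsum := sum_count s
  rw [← Finset.add_sum_erase _ _ ha₀] at hsum
  have hle : ∀ a ∈ s.toFinset.erase a₀, s.count a ≤ ∑ a ∈ s.toFinset.erase a₀, s.count a :=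
    fun a ha => Finset.single_le_sum (f := fun a => s.count a) (fun _ _ => Nat.zero_le _) ha
  have hpos : ∀ a ∈ s.toFinset, 0 < s.count a := fun a ha =>
    List.count_pos_iff.2 (List.mem_toFinset.1 ha)
  have hb : ∀ a m, 0 < m → 2 * m ≤ s.length → (s.count a ≤ m ∨ s.length ≤ m + s.count a) →
      ((qbits (positions s a s.length)).length : ℝ) ≤ 22 * ent m s.length := by
    intro a m hm h2 h3
    have h4 := encode_pairs_bounds (positions_pairwise s a s.length) (n := s.length) fun p hp => by
      have := List.mem_range'_1.1 (List.mem_of_mem_filter hp); omega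
    have h5 := length_positions s a le_rfl
    rw [List.take_length] at h5
    have h6 := (encode_len_le (positions s a s.length)).2
    exact length_qbits_le hm h2 (by omega) h4.1
  have hne : (s.toFinset.erase a₀).Nonempty := by
    rw [← Finset.card_pos, Finset.card_erase_of_mem ha₀]; omega
  have hent : entList s = ent (s.count a₀) s.length +
      ∑ a ∈ s.toFinset.erase a₀, ent (s.count a) s.length := by
    rw [entList, ← Finset.add_sum_erase _ _ ha₀]
  have hnn : 0 ≤ ent (s.count a₀) s.length := ent_nonneg List.count_le_length
  have hnn' : 0 ≤ ∑ a ∈ s.toFinset.erase a₀, ent (s.count a) s.length :=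
    Finset.sum_nonneg fun a _ => ent_nonneg List.count_le_length
  have hhalf : ∀ a ∈ s.toFinset.erase a₀, 2 * s.count a ≤ s.length := by
    intro a ha
    have h1 := hle a ha
    have h2 := hmax a (Finset.mem_of_mem_erase ha)
    omega
  constructor
  · have h0 : ((qbits (positions s a₀ s.length)).length : ℝ) ≤ 22 * entList s := by
      by_cases h1 : 2 * s.count a₀ ≤ s.length
      · have := hb a₀ (s.count a₀) (hpos a₀ ha₀) h1 (Or.inl le_rfl)
        linarith
      · obtain ⟨b, hb'⟩ := hne
        set q := ∑ a ∈ s.toFinset.erase a₀, s.count a with hq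
        have hq0 : 0 < q := (hpos b (Finset.mem_of_mem_erase hb')).trans_le (hle b hb')
        have h2 := hb a₀ q hq0 (by omega) (by omega)
        -- Splitting `q` into the frequencies `c` of the other elements, `log (n / q) ≤ log (n / c)`
        -- for each of them.
        have h3 : ent q s.length ≤ ∑ a ∈ s.toFinset.erase a₀, ent (s.count a) s.length := by
          rw [ent, hq]
          push_cast
          rw [Finset.sum_mul]
          refine Finset.sum_le_sum fun a ha => ?_
          have hc : (0 : ℝ) < s.count a := by exact_mod_cast hpos a (Finset.mem_of_mem_erase ha)
          have hn : (0 : ℝ) < s.length := by exact_mod_cast (by omega : 0 < s.length)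
          have hcq : (s.count a : ℝ) ≤ ∑ a ∈ s.toFinset.erase a₀, (s.count a : ℝ) := by
            exact_mod_cast hle a ha
          refine mul_le_mul_of_nonneg_left (Real.logb_le_logb_of_le (by norm_num)
            (div_pos hn (hc.trans_le hcq)) ?_) hc.le
          gcongr
        linarith
    have h1 : ∑ a ∈ s.toFinset.erase a₀, ((qbits (positions s a s.length)).length : ℝ) ≤
        22 * ∑ a ∈ s.toFinset.erase a₀, ent (s.count a) s.length := by
      rw [Finset.mul_sum]
      exact Finset.sum_le_sum fun a ha => hb a _ (hpos a (Finset.mem_of_mem_erase ha))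
        (hhalf a ha) (Or.inl le_rfl)
    push_cast
    rw [← Finset.add_sum_erase _ _ ha₀]
    linarith
  -- Here `log n = log (n / c) + log c`. The first summand is at most `ent c n` as `c ≥ 1`, the
  -- second at most `c ≤ ent c n` as `2 c ≤ n`. The excluded element costs another factor 2, since
  -- `σ ≤ 2 (σ - 1)`.
  · have h1 : ∀ a ∈ s.toFinset.erase a₀, Real.logb 2 s.length ≤ 2 * ent (s.count a) s.length := by
      intro a ha
      have hc := hpos a (Finset.mem_of_mem_erase ha)
      have h2 := hhalf a ha
      have h3 := le_ent h2
      have hc' : (1 : ℝ) ≤ s.count a := by exact_mod_cast hc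
      have hn : (0 : ℝ) < s.length := by exact_mod_cast (by omega : 0 < s.length)
      have h4 : Real.logb 2 (s.count a) ≤ s.count a := by
        rw [Real.logb_le_iff_le_rpow (by norm_num) (by linarith), Real.rpow_natCast]
        exact_mod_cast Nat.lt_two_pow_self.le
      have h5 : Real.logb 2 (s.length / s.count a) =
          Real.logb 2 s.length - Real.logb 2 (s.count a) :=
        Real.logb_div hn.ne' (by linarith)
      have h6 : Real.logb 2 (s.length / s.count a) ≤ ent (s.count a) s.length := by
        refine le_mul_of_one_le_left (Real.logb_nonneg (by norm_num) ?_) hc'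
        rw [le_div_iff₀ (by linarith), one_mul]
        exact_mod_cast List.count_le_length
      linarith
    have h2 := Finset.sum_le_sum h1
    rw [Finset.sum_const, Finset.card_erase_of_mem ha₀, nsmul_eq_mul, ← Finset.mul_sum] at h2
    have h3 : (s.toFinset.card : ℝ) ≤ 2 * (s.toFinset.card - 1 : ℕ) := by
      exact_mod_cast (by omega : s.toFinset.card ≤ 2 * (s.toFinset.card - 1))
    have h4 : 0 ≤ Real.logb 2 s.length := by
      refine Real.logb_nonneg (by norm_num) ?_
      have := hpos a₀ ha₀
      exact_mod_cast (by omega : 1 ≤ s.length)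
    nlinarith

/-- A crude bound that serves only to show that the array size is linear in `n`, so that addresses
fit in a word. -/
theorem entList_le [DecidableEq α] (s : List α) : entList s ≤ s.length * Real.logb 2 s.length := by
  have h : ∀ a ∈ s.toFinset, ent (s.count a) s.length ≤ s.count a * Real.logb 2 s.length := by
    intro a ha
    have hc : (1 : ℝ) ≤ s.count a := by
      exact_mod_cast List.count_pos_iff.2 (List.mem_toFinset.1 ha)
    have hn : (s.count a : ℝ) ≤ s.length := by exact_mod_cast List.count_le_length
    refine mul_le_mul_of_nonneg_left (Real.logb_le_logb_of_le (by norm_num) ?_ ?_) (by linarith)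
    · exact div_pos (by linarith) (by linarith)
    · exact div_le_self (by linarith) hc
  refine (Finset.sum_le_sum h).trans ?_
  rw [← Finset.sum_mul, ← Nat.cast_sum, sum_count]

end StreamRAM

namespace StreamRAM

open StreamRAM.Expr (add sub mul div mod or lt eq)
set_option linter.unusedSimpArgs false

variable {α : Type*} {w X : ℕ}

/-! ### The whole program -/

theorem StreamInv.sum_le [LinearOrder α] {s : List α} {b : ℕ} {H : HS α} {cs : ℕ → ℕ → ℕ}
    {P : ℕ → List ℕ} {mk : ℕ → α} {I : List ℕ} (h : StreamInv w s b H cs P mk I) (f : α → ℕ) :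
    ∑ i ∈ Finset.Icc 1 (H.v xD), f (mk i) ≤ ∑ a ∈ s.toFinset, f a := by
  rw [← Finset.sum_image (s := Finset.Icc 1 (H.v xD)) (g := mk) (f := f)]
  · refine Finset.sum_le_sum_of_subset fun a ha => ?_
    obtain ⟨i, hi, rfl⟩ := Finset.mem_image.1 ha
    rw [Finset.mem_Icc] at hi
    exact h.main.mem i hi.1 hi.2
  · intro i hi j hj hij
    simp only [Finset.coe_Icc, Set.mem_Icc] at hi hj
    exact h.main.inj i hi.1 hi.2 j hj.1 hj.2 hij

theorem StreamInv.le_card [LinearOrder α] {s : List α} {b : ℕ} {H : HS α} {cs : ℕ → ℕ → ℕ}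
    {P : ℕ → List ℕ} {mk : ℕ → α} {I : List ℕ} (h : StreamInv w s b H cs P mk I) :
    H.v xD ≤ s.toFinset.card := by
  simpa using h.sum_le fun _ => 1

/-- A full batch has `m = d + 1`, so `60 d` is covered by `60 m`; with `41 * 4 m` from sorting and
`152 m` this stays below `400 m`. The final batch may be shorter, hence the extra term in the number
of distinct elements. -/
theorem streamLoop_wp [LinearOrder α] (h0 : 1 < w) (hX : 64 + 16 * X ≤ 2 ^ w) {s : List α} (a₀ : α)
    (hU : room w s.toFinset (fun k => positions s k s.length) + 2 ≤ X)
    (hs : s.length + 1 < 2 ^ w) (n : ℕ) :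
    ∀ {H : HS α} {b : ℕ} {cs P mk I}, StreamInv w s b H cs P mk I → b + n = s.length →
      H.v xMore = 1 →
      (H.tm : ℝ) ≤ 20 * tot (H.v xD) P + 41 * entList (s.take b) + 400 * b + 1 →
      (Stmt.whl (.v xMore) batch).wp w X (fun H' => ∃ cs P mk I,
        StreamInv w s s.length H' cs P mk I ∧
        (H'.tm : ℝ) ≤ 20 * tot (H'.v xD) P + 41 * entList s + 400 * s.length +
          60 * s.toFinset.card + 40) H := by
  induction n using Nat.strong_induction_on with
  | _ n ih =>
  intro H b cs P mk I h hb hmore ht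
  refine Stmt.wp_whl (by simp) (fun _ => ?_) fun hv => absurd hv (by simp [hmore])
  -- The default `a₀` only makes `key` total; indices beyond the end of `s` do not occur in a batch.
  set key : ℕ → α := fun x => (s[b + x - 1]?).getD a₀ with hkeydef
  have hkey : ∀ x, 1 ≤ x → b + x ≤ s.length → s[b + x - 1]? = some (key x) := by
    intro x h1 h2
    simp only [hkeydef, List.getElem?_eq_getElem (show b + x - 1 < s.length by omega),
      Option.getD_some]
  have htick : StreamInv w s b H.tick cs P mk I :=
    ⟨h.main.congr rfl rfl (fun _ _ _ => rfl) fun _ => rfl, h.path, h.ids, h.srt, h.tgt, h.base, h.le,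
      h.inp, h.out⟩
  refine Stmt.wp_mono _ (batch_wp h0 hX hU hs hkey htick) ?_
  rintro H1 ⟨m, cs1, P1, mk1, I1, h1, hm, ht1⟩
  have hbm := h1.le
  have hent : entList (s.take b) + sortCost key (singles m) ≤ entList (s.take (b + m)) + 4 * m := by
    have e1 := sortCost_singles_le key m
    have e2 : (List.range' 1 m).map key = (s.drop b).take m := by
      refine List.ext_getElem (by simp; omega) fun i hi hi' => ?_
      have h3 : i < m := by simpa using hi
      have h4 := hkey (1 + i) (by omega) (by omega)
      rw [show b + (1 + i) - 1 = b + i by omega, List.getElem?_eq_getElem (by omega)] at h4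
      simpa using (Option.some.inj h4).symm
    have e3 := entList_append_le (s.take b) ((s.drop b).take m)
    rw [← List.take_add, ← e2] at e3
    linarith
  have ht1' : (H1.tm : ℝ) + 20 * tot (H.v xD) P ≤ H.tm + 1 + 20 * tot (H1.v xD) P1 +
      41 * sortCost key (singles m) + 60 * H.v xD + 152 * m + 22 := by
    have h2 : H.tick.tm = H.tm + 1 := rfl
    rw [h2] at ht1
    exact_mod_cast ht1
  rcases hm with ⟨hmore1, hm⟩ | ⟨hmore1, hm⟩
  · have hm' : (m : ℝ) = H.v xD + 1 := by exact_mod_cast hm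
    have hdm : (0 : ℝ) ≤ H.v xD := Nat.cast_nonneg _
    exact ih (n - m) (by simp at hm; omega) h1 (by simp at hm; omega) hmore1 (by push_cast; linarith)
  · refine Stmt.wp_whl (by simp) (fun hv => absurd hmore1 hv) fun _ => ?_
    refine ⟨cs1, P1, mk1, I1, ?_, ?_⟩
    · rw [← hm]
      exact ⟨h1.main.congr rfl rfl (fun _ _ _ => rfl) fun _ => rfl, h1.path, h1.ids, h1.srt, h1.tgt,
        h1.base, h1.le, h1.inp, h1.out⟩
    · have h3 : (H.v xD : ℝ) ≤ s.toFinset.card := by exact_mod_cast h.le_card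
      have h4 : (s.length : ℝ) = b + m := by exact_mod_cast hm.symm
      rw [hm, List.take_length] at hent
      have h5 : (0 : ℝ) ≤ b := Nat.cast_nonneg _
      have h6 : (0 : ℝ) ≤ m := Nat.cast_nonneg _
      simp only [HS.tick_tm, HS.tick_v, Nat.cast_add, Nat.cast_one, h4]
      linarith

/-- The initial abstract state. -/
def HS.init (s : List α) : HS α where
  v := fun _ => 0
  a := fun _ _ => 0
  e := fun _ => none
  inp := s
  out := []
  tm := 0

theorem Sim.init (s : List α) : Sim w X (State.init s) (HS.init s) :=
  ⟨fun _ _ => rfl, fun _ _ _ _ => rfl, fun _ _ => Nat.two_pow_pos w, fun _ _ _ _ => Nat.two_pow_pos w,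
    rfl, rfl, rfl⟩

/-- The order of the positions in the stable sort of `s`. -/
def PosLt [LinearOrder α] (s : List α) (p q : ℕ) : Prop :=
  ∃ a b, s[p - 1]? = some a ∧ s[q - 1]? = some b ∧ (a < b ∨ a = b ∧ p < q)

/-- The list `l` is the list of the positions of `s`, stably sorted. -/
structure SortedPos [LinearOrder α] (s : List α) (l : List ℕ) : Prop where
  srt : l.Pairwise (PosLt s)
  perm : l.Perm (List.range' 1 s.length)

/-- Positions of different keys are ordered by the list, those of one key by size. Strict order
excludes repetitions, so it remains to compare members with `1, …, n`. -/
theorem sortedPos_flatMap [LinearOrder α] {s : List α} {I : List ℕ} {P : ℕ → List ℕ} {mk : ℕ → α}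
    (hs : I.Pairwise (fun i j => mk i < mk j)) (hP : ∀ i ∈ I, P i = positions s (mk i) s.length)
    (hI : ∀ a ∈ s, ∃ i ∈ I, mk i = a) : SortedPos s (I.flatMap P) := by
  have hmem : ∀ i ∈ I, ∀ p ∈ P i, s[p - 1]? = some (mk i) ∧ p ∈ List.range' 1 s.length := by
    intro i hi p hp
    rw [hP i hi, positions, List.mem_filter] at hp
    exact ⟨by simpa using hp.2, hp.1⟩
  have hsrt : (I.flatMap P).Pairwise (PosLt s) := by
    rw [List.pairwise_flatMap]
    refine ⟨fun i hi => ?_, hs.imp_of_mem fun {i j} hi hj hij p hp q hq =>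
      ⟨mk i, mk j, (hmem i hi p hp).1, (hmem j hj q hq).1, Or.inl hij⟩⟩
    have h1 : (P i).Pairwise (· < ·) := by
      rw [hP i hi]; exact (List.pairwise_cons.1 (positions_pairwise s (mk i) s.length)).2
    exact h1.imp_of_mem fun {p q} hp hq hpq =>
      ⟨mk i, mk i, (hmem i hi p hp).1, (hmem i hi q hq).1, Or.inr ⟨rfl, hpq⟩⟩
  refine ⟨hsrt, (List.perm_ext_iff_of_nodup ?_ List.nodup_range').2 fun p => ⟨fun hp => ?_,
    fun hp => ?_⟩⟩
  · refine hsrt.imp ?_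
    rintro p _ ⟨a, b, ha, hb, h⟩ rfl
    rw [ha] at hb
    obtain rfl := Option.some.inj hb
    rcases h with h | h
    · exact lt_irrefl _ h
    · exact lt_irrefl _ h.2
  · obtain ⟨i, hi, hp⟩ := List.mem_flatMap.1 hp
    exact (hmem i hi p hp).2
  · have h1 := List.mem_range'_1.1 hp
    have h2 : s[p - 1]? = some s[p - 1] := List.getElem?_eq_getElem (by omega)
    obtain ⟨i, hi, h3⟩ := hI s[p - 1] (List.getElem_mem _)
    refine List.mem_flatMap.2 ⟨i, hi, ?_⟩
    rw [hP i hi, positions, List.mem_filter, h3, h2]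
    exact ⟨hp, by simp⟩

theorem stableSort_wp [LinearOrder α] (h0 : 1 < w) (hX : 64 + 16 * X ≤ 2 ^ w) {s : List α}
    (hU : room w s.toFinset (fun k => positions s k s.length) + 2 ≤ X)
    (hs : s.length + 2 < 2 ^ w) (h2 : 2 ≤ s.toFinset.card) :
    stableSort.wp w X (fun H' => SortedPos s H'.out ∧
      (H'.tm : ℝ) ≤ 2300 * (entList s + s.length)) (HS.init s) := by
  obtain ⟨a₀, _⟩ := Finset.card_pos.1 (show 0 < s.toFinset.card by omega)
  simp only [stableSort, blk, Stmt.wp_seq]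
  refine ⟨by show 1 < 2 ^ w; omega, ?_⟩
  have hinit : StreamInv w s 0 ((HS.init s).setV xMore 1) (fun _ _ => 0) (fun _ => [])
      (fun _ => a₀) [] := by
    have hd : ((HS.init s).setV xMore 1).v xD = 0 := by simp [HS.init]
    refine ⟨⟨⟨⟨?_, ?_, ?_, ?_, ?_, ?_, ?_, ?_⟩, ?_, ?_, ?_⟩, ?_, ?_, ?_, ?_⟩, rfl, ?_, by simp,
      fun k => rfl, by simp [HS.init], by omega, rfl, rfl⟩
    any_goals (intro i h1 h2; omega)
    · simp [HS.init]
    · intro i; rw [hd]; simp; omega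
  refine Stmt.wp_mono _ (streamLoop_wp h0 hX a₀ hU (by omega) s.length hinit (by omega) (by simp)
    (by simp [entList, HS.init, tot])) ?_
  rintro H1 ⟨cs, P, mk, I, h, ht⟩
  have hP : ∀ i ∈ I, P i = positions s (mk i) s.length := by
    intro i hi
    rw [← h.tgt, lookM_self h.srt hi]
  have hI : ∀ a ∈ s, ∃ i ∈ I, mk i = a := by
    intro a ha
    by_contra hcon
    push Not at hcon
    have h3 := h.tgt a
    rw [lookM_eq_nil hcon] at h3
    have h4 := length_positions s a le_rfl
    rw [← h3, List.take_length] at h4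
    exact (List.count_pos_iff.2 ha).ne h4
  have hsp := sortedPos_flatMap h.srt hP hI
  refine Stmt.wp_mono _ (writeAll_wp h0 hX hU hs h) ?_
  rintro H2 ⟨ho, ht2⟩
  refine ⟨by rw [ho]; exact hsp, ?_⟩
  have hlen : (I.flatMap P).length = s.length := by rw [hsp.perm.length_eq]; simp
  have htot : tot (H1.v xD) P ≤ ∑ a ∈ s.toFinset, (qbits (positions s a s.length)).length := by
    refine le_trans (le_of_eq ?_) (h.sum_le fun a => (qbits (positions s a s.length)).length)
    refine Finset.sum_congr rfl fun i hi => ?_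
    rw [hP i ((h.ids i).2 (Finset.mem_Icc.1 hi))]
  have hq := (sum_qbits_le h2).1
  -- Writing and reading cost 50 units per bit in total, so the coefficient of the entropy is `50 *
  -- 44 + 41 = 2241`, below `2300`.
  have htot' : (tot (H1.v xD) P : ℝ) ≤ 44 * entList s := le_trans (by exact_mod_cast htot) hq
  have hcard : (s.toFinset.card : ℝ) ≤ s.length := by exact_mod_cast List.toFinset_card_le s
  have hd : (H1.v xD : ℝ) ≤ s.toFinset.card := by exact_mod_cast h.le_card
  rw [hlen] at ht2
  have ht2' : (H2.tm : ℝ) ≤ H1.tm + 30 * tot (H1.v xD) P + 8 * s.length + 9 * H1.v xD + 2 := by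
    exact_mod_cast ht2
  have hn : (2 : ℝ) ≤ s.length := by exact_mod_cast h2.trans (List.toFinset_card_le s)
  have hE : 0 ≤ entList s := Finset.sum_nonneg fun a _ => ent_nonneg List.count_le_length
  linarith

end StreamRAM

/-! ### Transfer to sequences and the final constants -/

namespace StreamRAM

variable {α : Type*} {w X : ℕ}

theorem toFinset_ofFn [LinearOrder α] {n : ℕ} (f : Fin n → α) :
    (List.ofFn f).toFinset = Finset.univ.image f := by
  ext a; simp [List.mem_ofFn]

theorem count_ofFn [LinearOrder α] {n : ℕ} (f : Fin n → α) (a : α) :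
    (List.ofFn f).count a = occ f a := by
  rw [occ, List.ofFn_eq_map, List.count_eq_countP, List.countP_map, List.countP_eq_length_filter,
    ← List.toFinset_card_of_nodup ((List.nodup_finRange n).filter _)]
  congr 1
  ext i
  simp

theorem entList_ofFn [LinearOrder α] {n : ℕ} (f : Fin n → α) :
    entList (List.ofFn f) = seqEntropy f * n := by
  rcases Nat.eq_zero_or_pos n with rfl | hn
  · simp [entList]
  have hn' : (n : ℝ) ≠ 0 := by exact_mod_cast hn.ne'
  rw [entList, toFinset_ofFn, seqEntropy, Finset.sum_mul]
  refine Finset.sum_congr rfl fun a _ => ?_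
  rw [ent, count_ofFn, List.length_ofFn]
  field_simp

/-- The output counts from `1`, hence the shift. A rearrangement of `1, …, n` has no repetitions, so
it gives an injection of `Fin n` into itself. -/
theorem exists_perm_of_sortedPos [LinearOrder α] {n : ℕ} {f : Fin n → α} {l : List ℕ}
    (h : SortedPos (List.ofFn f) l) :
    ∃ π : Equiv.Perm (Fin n), IsStableSort f π ∧ l = List.ofFn fun i => (π i : ℕ) + 1 := by
  have hlen : l.length = n := by rw [h.perm.length_eq]; simp
  have hmem : ∀ i : Fin n, 1 ≤ l[i] ∧ l[i] ≤ n := fun i => by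
    have := List.mem_range'_1.1 (h.perm.mem_iff.1 (List.getElem_mem (l := l) (n := i) (by omega)))
    simp at this
    simp only [Fin.getElem_fin]
    omega
  have hnd : l.Nodup := h.perm.nodup_iff.2 List.nodup_range'
  have hinj : Function.Injective fun i : Fin n =>
      (⟨l[i] - 1, by have := hmem i; omega⟩ : Fin n) := by
    intro i j hij
    have h1 := hmem i
    have h2 := hmem j
    have h3 : l[i] - 1 = l[j] - 1 := congrArg Fin.val hij
    have h4 : l[(i : ℕ)]'(by omega) = l[(j : ℕ)]'(by omega) := by
      simp only [Fin.getElem_fin] at h1 h2 h3; omega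
    exact Fin.ext ((hnd.getElem_inj_iff).1 h4)
  refine ⟨Equiv.ofBijective _ (Finite.injective_iff_bijective.1 hinj), fun i j hij => ?_, ?_⟩
  · have h1 := List.pairwise_iff_getElem.1 h.srt i j (by omega) (by omega) (by omega)
    obtain ⟨a, b, ha, hb, hab⟩ := h1
    have h2 := hmem i
    have h3 := hmem j
    simp only [Fin.getElem_fin] at h2 h3
    rw [List.getElem?_eq_getElem (by simp; omega), List.getElem_ofFn] at ha hb
    simp only [Equiv.ofBijective_apply, Fin.getElem_fin, Fin.mk_lt_mk]
    rw [Option.some.inj ha, Option.some.inj hb]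
    refine ⟨hab.elim le_of_lt fun h => h.1.le, fun he => ?_⟩
    rcases hab with hab | hab
    · exact absurd he hab.ne
    · omega
  · refine List.ext_getElem (by simp [hlen]) fun i hi hi' => ?_
    have h2 := hmem ⟨i, by omega⟩
    simp only [Fin.getElem_fin] at h2
    simp
    omega

/-- Rounding up to whole words costs at most one word for each distinct element. -/
theorem room_mul_le [LinearOrder α] {s : List α} (h2 : 2 ≤ s.toFinset.card) :
    (room w s.toFinset (fun k => positions s k s.length) : ℝ) * w ≤
      44 * entList s + s.toFinset.card * w := by
  have h1 : room w s.toFinset (fun k => positions s k s.length) * w ≤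
      (∑ a ∈ s.toFinset, (qbits (positions s a s.length)).length) + s.toFinset.card * w := by
    rw [room, Finset.sum_mul, Finset.card_eq_sum_ones, Finset.sum_mul, ← Finset.sum_add_distrib]
    refine Finset.sum_le_sum fun a _ => ?_
    rw [add_mul]
    exact Nat.add_le_add_right (Nat.div_mul_le_self _ _) _
  have h3 := (sum_qbits_le h2).1
  have h4 : (room w s.toFinset (fun k => positions s k s.length) : ℝ) * w ≤
      ((∑ a ∈ s.toFinset, (qbits (positions s a s.length)).length : ℕ) : ℝ) +
        s.toFinset.card * w := by exact_mod_cast h1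
  linarith

theorem stableSort_computes [LinearOrder α] {n : ℕ} (s : Fin n → α) (h2 : 2 ≤ numDistinct s)
    (hw : Real.logb 2 n + 10 ≤ w) :
    ∃ (π : Equiv.Perm (Fin n)) (t : ℕ), IsStableSort s π ∧
      Computes (mach w (room w (List.ofFn s).toFinset
        (fun k => positions (List.ofFn s) k n) + 2)) stableSort.comp (List.ofFn s)
        (List.ofFn fun i => (π i : ℕ) + 1) t ∧
      (t : ℝ) ≤ 920000 * ((seqEntropy s + 1) * n) := by
  set l := List.ofFn s with hl
  have hlen : l.length = n := by simp [hl]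
  have hcard : 2 ≤ l.toFinset.card := by rw [hl, toFinset_ofFn]; exact h2
  have hn2 : 2 ≤ n := hlen ▸ hcard.trans (List.toFinset_card_le l)
  have hn : (2 : ℝ) ≤ n := by exact_mod_cast hn2
  have hlog : 0 ≤ Real.logb 2 n := Real.logb_nonneg (by norm_num) (by linarith)
  have hw0 : (0 : ℝ) < w := by linarith
  have hw1 : 1 < w := by
    have : (1 : ℝ) < w := by linarith
    exact_mod_cast this
  have hpow : 1024 * n ≤ 2 ^ w := by
    have h3 : (2 : ℝ) ^ (Real.logb 2 n + 10) ≤ (2 : ℝ) ^ (w : ℝ) :=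
      Real.rpow_le_rpow_of_exponent_le (by norm_num) hw
    rw [Real.rpow_add (by norm_num), Real.rpow_logb (by norm_num) (by norm_num) (by linarith),
      Real.rpow_natCast] at h3
    have h4 : (2 : ℝ) ^ (10 : ℝ) = 1024 := by norm_num
    rw [h4] at h3
    have h5 : ((1024 * n : ℕ) : ℝ) ≤ ((2 ^ w : ℕ) : ℝ) := by push_cast; linarith
    exact_mod_cast h5
  -- Since `entList l ≤ n log n ≤ n w`, there are at most `44 n + n` cells; then `16 * (45 n + 2) +
  -- 64` fits below `1024 n`, which explains the constant 10.
  have hroom : room w l.toFinset (fun k => positions l k n) ≤ 45 * n := by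
    have h3 := room_mul_le hcard (w := w)
    have h4 := entList_le l
    have h5 : (l.toFinset.card : ℝ) ≤ n := by rw [← hlen]; exact_mod_cast List.toFinset_card_le l
    rw [hlen] at h3 h4
    have h6 : (room w l.toFinset (fun k => positions l k n) : ℝ) * w ≤ (45 * n : ℝ) * w := by
      nlinarith
    exact_mod_cast le_of_mul_le_mul_right h6 hw0
  have hX : 64 + 16 * (room w l.toFinset (fun k => positions l k n) + 2) ≤ 2 ^ w := by omega
  obtain ⟨S', H', t, hex, hsim, ⟨hsp, htm⟩, ht⟩ := Stmt.exec (by omega) hX stableSort stableSort_wf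
    _ _ _ (Sim.init l) (stableSort_wp hw1 hX (by rw [hlen]) (by omega) hcard)
  obtain ⟨π, hπ, ho⟩ := exists_perm_of_sortedPos hsp
  refine ⟨π, t, hπ, ⟨S', hex, hsim.out.trans ho⟩, ?_⟩
  -- The factor `unitCost = 400`, times the `2300` of the abstract clock, gives `920000`.
  have h3 : (t : ℝ) ≤ 400 * H'.tm := by
    have h4 : t ≤ 400 * H'.tm := by simp only [unitCost, HS.init] at ht; omega
    exact_mod_cast h4
  rw [hlen, hl, entList_ofFn] at htm
  linarith

end StreamRAM

theorem mainTheorem11 :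
    ∃ (P : StreamRAM.Prog) (c₀ : ℕ), ∀ (C : ℝ) (κ : ℕ), ∃ K : ℝ,
      ∀ (α : Type*) [LinearOrder α] (n : ℕ) (s : Fin n → α) (w : ℕ),
        2 ≤ numDistinct s →
        Real.logb 2 n + c₀ ≤ w → (w : ℝ) ≤ C * Real.logb 2 n →
        ∃ (π : Equiv.Perm (Fin n)) (M : StreamRAM.Machine) (t : ℕ),
          IsStableSort s π ∧
          M.wordBits = w ∧
          StreamRAM.Computes M P (List.ofFn s) (List.ofFn fun i => (π i : ℕ) + 1) t ∧
          (t : ℝ) ≤ K * ((seqEntropy s + 1) * n) ∧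
          (M.memoryBits κ : ℝ) ≤ K * (seqEntropy s * n) := by
  -- With array size `room + 2` the memory is `(96 + 4 κ) w + (16 + 2 κ) room w` bits. With `E = n
  -- H`, the two factors of `K` come from `w ≤ 2 |C| E` and `room w ≤ 44 E + 4 |C| E`; the absolute
  -- value makes negative `C` harmless.
  refine ⟨StreamRAM.stableSort.comp, 10, fun C κ => ⟨920000 + ((96 + 4 * κ) * (2 * |C|) +
    (16 + 2 * κ) * (44 + 4 * |C|)), fun α _ n s w h2 hw hw' => ?_⟩⟩
  obtain ⟨π, t, hπ, hc, ht⟩ := StreamRAM.stableSort_computes s h2 (by exact_mod_cast hw)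
  refine ⟨π, _, t, hπ, rfl, hc, ?_, ?_⟩
  all_goals
    have hE := StreamRAM.entList_ofFn s
    set l := List.ofFn s with hl
    have hlen : l.length = n := by simp [hl]
    have hE0 : 0 ≤ StreamRAM.entList l := Finset.sum_nonneg fun a _ =>
      StreamRAM.ent_nonneg List.count_le_length
    have hκ : (0 : ℝ) ≤ κ := Nat.cast_nonneg κ
    have hC := abs_nonneg C
  · refine ht.trans (mul_le_mul_of_nonneg_right (le_add_of_nonneg_right (by positivity)) ?_)
    rw [add_mul, ← hE]
    positivity
  · have hcard : 2 ≤ l.toFinset.card := by rw [hl, StreamRAM.toFinset_ofFn]; exact h2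
    have hn : (2 : ℝ) ≤ n := by
      exact_mod_cast hlen ▸ hcard.trans (List.toFinset_card_le l)
    have hlog : 0 ≤ Real.logb 2 n := Real.logb_nonneg (by norm_num) (by linarith)
    have h3 := StreamRAM.room_mul_le hcard (w := w)
    have h4 := (StreamRAM.sum_qbits_le hcard).2
    rw [hlen] at h3 h4
    have hwC : (w : ℝ) ≤ |C| * Real.logb 2 n :=
      hw'.trans (mul_le_mul_of_nonneg_right (le_abs_self C) hlog)
    have h5 : (l.toFinset.card : ℝ) * w ≤ |C| * (4 * StreamRAM.entList l) := by
      calc (l.toFinset.card : ℝ) * w ≤ l.toFinset.card * (|C| * Real.logb 2 n) := by gcongr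
        _ = |C| * (l.toFinset.card * Real.logb 2 n) := by ring
        _ ≤ _ := by gcongr
    have hc2 : (2 : ℝ) ≤ l.toFinset.card := by exact_mod_cast hcard
    -- A single word is already too much if the entropy is small; `σ ≥ 2` lets even the constant
    -- number of words be charged to `H n`.
    have h6 : (w : ℝ) ≤ 2 * |C| * StreamRAM.entList l := by
      have : (2 : ℝ) * w ≤ l.toFinset.card * w := by gcongr
      linarith
    rw [← hE]
    simp only [StreamRAM.Machine.memoryBits, StreamRAM.mach]
    push_cast
    calc _ = (96 + 4 * κ : ℝ) * w + (16 + 2 * κ) *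
          ((StreamRAM.room w l.toFinset fun k => StreamRAM.positions l k n : ℕ) * w) := by ring
      _ ≤ (96 + 4 * κ : ℝ) * (2 * |C| * StreamRAM.entList l) + (16 + 2 * κ) *
          (44 * StreamRAM.entList l + |C| * (4 * StreamRAM.entList l)) := by
          gcongr
          linarith
      _ = ((96 + 4 * κ) * (2 * |C|) + (16 + 2 * κ) * (44 + 4 * |C|)) *
          StreamRAM.entList l := by ring
      _ ≤ _ := mul_le_mul_of_nonneg_right (by linarith) hE0
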